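/- Let $(M,\sigma)$ be a symplectic 4-manifold and $f=(h,K)\colon M\to\mathbb R^2$ a completely integrable Hamiltonian system on it: $h$ (the Hamiltonian) and $K$ are smooth, Poisson-commute, are independent almost everywhere, and the level sets of $f$ are compact and connected. Assume that the set of singularities of $f$ of focus-focus type is finite. Hamiltonian vector fields are given by $i_{X_g}\sigma=-dg$. Let $B\subset f(M)$ be the set of regular values of $f$. For $b\in B$ let $P_b\subset\mathbb R^2$ be the period lattice of the Liouville torus $f^{-1}(b)$, i.e. the set of $(a_1,a_2)$ such that the time-1 flow of $a_1X_h+a_2X_K$ is the identity on $f^{-1}(b)$; its elements are the classes of cycles on this torus. The canonical connection $\nabla^{can}$ is the flat connection on the bundle with fibre $\mathbb R^2$ over $B$ whose local covariantly constant sections are the combinations $c_1\,dI_1+c_2\,dI_2$ with constant coefficients, where $(I_1,I_2)$ are local action variables (functions on an open set of $B$ whose differentials form a basis of $P_b$ at each $b$); its holonomy is the monodromy of the system. Let $U\subset B$ be open (for instance $U=B$) and suppose that over $U$ a cycle $\gamma_1$ is fixed, i.e. a primitive vector $\alpha(b)\in P_b$ which depends continuously on $b\in U$ and is such that $X_h$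 is nowhere tangent to the orbits of the corresponding 1-periodic flow. Let $T(b)>0$ be the first return time of the flow of $X_h$ to the orbit $\gamma_1$ of its starting point $x\in f^{-1}(b)$ and let $\Theta(b)$ be the rotation number, i.e. the parameter on $\gamma_1$ (starting at $x$, a full turn having length 1) of the point of return; $\Theta(b)$ is determined modulo $\mathbb Z$. The second cycle is $\gamma_2=T\cdot(1,0)-\Theta\,\alpha$. Put $\tau=-\Theta+iT$. For $\tau\in\mathbb H$, the upper half-plane, and $j=0,1$ let $$\theta_{2,j}(z,\tau)=\sum_{n\in\mathbb Z}e^{\frac{i}{2}\pi(2n+j)^2\tau+2\pi i(2n+j)z},$$ let $V_\tau$ be the space of entire functions of $z$ spanned by $\theta_{2,0}(\cdot,\tau),\theta_{2,1}(\cdot,\tau)$, and let $\nabla$ be the heat connection on $V\to\mathbb H$, whose covariantly constant sections $s$ satisfy $\partial_{\bar\tau}s=0$ and $\bigl(\partial_\tau+\frac{i}{8\pi}\partial_z^2\bigr)s=0$. As $V_{\tau+1}=V_\tau$, the pull-backs of $(V,\nabla)$ along the local maps $\tau=-\Theta+iT$ (with continuous local choices of $\Theta$) glue to a rank-2 bundle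 over $U$ with a flat connection $\nabla^{heat}$. Let $Z_0=\begin{pmatrix}1&1\\0&1\end{pmatrix}\in SL(2,\mathbb Z)$, and for $Z$ in the subgroup $\langle Z_0\rangle$ let $Q(Z)$ be the matrix, in the basis $(\theta_{2,0}(\cdot,\tau),\theta_{2,1}(\cdot,\tau))$, of the parallel displacement $V_\tau\to V_{Z\cdot\tau}=V_\tau$ for $\nabla$. Then $Q$ is well defined, independent of $\tau$, a homomorphism from $\langle Z_0\rangle$ to $GL(2,\mathbb C)$, and $$Q(Z_0)=\begin{pmatrix}1&0\\0&e^{i\pi/2}\end{pmatrix}.$$ For each $b_0\in U$ the first return time and the rotation number exist, and for each value of the latter (that is, for each resulting choice of $\gamma_2$ and of $\tau_0=-\Theta(b_0)+iT(b_0)$) parallel transport along loops in $U$ at $b_0$ gives representations $$hol(\nabla^{can})\colon\pi_1(U,b_0)\to\langle Z_0\rangle\subset SL(2,\mathbb Z),\qquad hol(\nabla^{heat})\colon\pi_1(U,b_0)\to GL(2,\mathbb C),$$ the matrices being taken in the basis $(\gamma_1,\gamma_2)$ at $b_0$ and in the basis $(\theta_{2,0}(\cdot,\tau_0),\theta_{2,1}(\cdot,\tau_0))$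 respectively, and $$hol(\nabla^{heat})=Q\bigl(hol(\nabla^{can})\bigr).$$ Consequently, if the holonomy of $\nabla^{heat}$ is nontrivial, then the system has monodromy, i.e. the holonomy of $\nabla^{can}$ over $B$ is nontrivial. -/

import Mathlib

open scoped Manifold ContDiff Topology MatrixGroups

noncomputable section

namespace HeatMonodromy

/-- The model space of a manifold of dimension four. -/
abbrev E4 : Type := EuclideanSpace ℝ (Fin 4)

section Symplectic

variable {M : Type*} [TopologicalSpace M] [ChartedSpace E4 M]

/-- The expression, in the preferred chart at `x₀`, of a field of alternating 2-forms on `M`. -/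
def chartForm (w : ∀ x : M, (TangentSpace (𝓡 4) x) [⋀^Fin 2]→L[ℝ] ℝ) (x₀ : M) (y : E4) :
    E4 [⋀^Fin 2]→L[ℝ] ℝ :=
  (w ((extChartAt (𝓡 4) x₀).symm y)).compContinuousLinearMap
    (mfderiv 𝓘(ℝ, E4) (𝓡 4) (extChartAt (𝓡 4) x₀).symm y)

/-- The differential of a real function, as a linear form on the tangent space. -/
def dif (g : M → ℝ) (x : M) : TangentSpace (𝓡 4) x →L[ℝ] ℝ :=
  mfderiv (𝓡 4) 𝓘(ℝ, ℝ) g x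

end Symplectic

/-- A symplectic form on a manifold of dimension four: smooth, closed and nondegenerate. -/
structure SymplecticForm (M : Type*) [TopologicalSpace M] [ChartedSpace E4 M] where
  form : ∀ x : M, (TangentSpace (𝓡 4) x) [⋀^Fin 2]→L[ℝ] ℝ
  smooth : ∀ x₀ : M, ContDiffOn ℝ ∞ (chartForm form x₀) (extChartAt (𝓡 4) x₀).target
  closed : ∀ x₀ : M, ∀ y ∈ (extChartAt (𝓡 4) x₀).target, extDeriv (chartForm form x₀) y = 0
  nondegenerate : ∀ (x : M) (v : TangentSpace (𝓡 4) x),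
    (∀ w : TangentSpace (𝓡 4) x, form x ![v, w] = 0) → v = 0

section Symplectic

variable {M : Type*} [TopologicalSpace M] [ChartedSpace E4 M]

/-- In finite dimension a nondegenerate form represents every linear form. -/
theorem exists_represents (β : E4 [⋀^Fin 2]→L[ℝ] ℝ)
    (hβ : ∀ v : E4, (∀ w : E4, β ![v, w] = 0) → v = 0) (d : E4 →L[ℝ] ℝ) :
    ∃ X : E4, ∀ w : E4, β ![X, w] = -d w := by
  have key : ∀ u v w : E4, Function.update ![u, v] 1 w = ![u, w] := fun u v w => by
    ext i : 1
    fin_cases i <;> simp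
  let B : E4 →ₗ[ℝ] Module.Dual ℝ E4 :=
    LinearMap.mk₂ ℝ (fun v w : E4 => β ![v, w])
      (fun u v w => β.toMultilinearMap.cons_add ![w] u v)
      (fun c v w => β.toMultilinearMap.cons_smul ![w] c v)
      (fun u v w => by
        have h := β.map_update_add ![u, v] 1 v w
        rw [key, key, key] at h
        exact h)
      (fun c v w => by
        have h := β.map_update_smul ![v, w] 1 c w
        rw [key, key] at h
        exact h)
  have hinj : Function.Injective B := by
    rw [injective_iff_map_eq_zero]
    intro v hv
    exact hβ v fun w => LinearMap.congr_fun hv w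
  have hsurj : Function.Surjective B :=
    (LinearMap.injective_iff_surjective_of_finrank_eq_finrank
      (Subspace.dual_finrank_eq (K := ℝ) (V := E4)).symm).1 hinj
  obtain ⟨X, hX⟩ := hsurj (-(d : E4 →ₗ[ℝ] ℝ))
  exact ⟨X, fun w => LinearMap.congr_fun hX w⟩

theorem SymplecticForm.exists_hamVec (σ : SymplecticForm M) (g : M → ℝ) (x : M) :
    ∃ X : TangentSpace (𝓡 4) x, ∀ w : TangentSpace (𝓡 4) x,
      σ.form x ![X, w] = -dif g x w :=
  exists_represents (σ.form x) (σ.nondegenerate x) (dif g x)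

/-- The Hamiltonian vector field `X` of `g`, defined by `i_X σ = -dg`. -/
def SymplecticForm.hamVec (σ : SymplecticForm M) (g : M → ℝ) (x : M) : TangentSpace (𝓡 4) x :=
  Classical.choose (σ.exists_hamVec g x)

/-- The Hessian of `g` in the preferred chart at `p`
(intrinsic when `p` is a critical point of `g`). -/
def hess (g : M → ℝ) (p : M) (v w : E4) : ℝ :=
  iteratedFDeriv ℝ 2 (g ∘ (extChartAt (𝓡 4) p).symm) (extChartAt (𝓡 4) p p) ![v, w]

/-- The map `(h, K)` is a submersion at `x`. -/
def IsRegularPoint (h K : M → ℝ) (x : M) : Prop :=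
  Function.Surjective fun v : TangentSpace (𝓡 4) x => (dif h x v, dif K x v)

end Symplectic

/-- A completely integrable Hamiltonian system with two degrees of freedom: a symplectic
manifold of dimension four, the Hamiltonian `h`, and a second integral `K` which Poisson-commutes
with `h` and is independent of it almost everywhere; the joint level sets are compact and
connected. -/
structure IntegrableSystem (M : Type*) [TopologicalSpace M] [ChartedSpace E4 M] where
  σ : SymplecticForm M
  h : M → ℝ
  K : M → ℝ
  smooth_h : ContMDiff (𝓡 4) 𝓘(ℝ, ℝ) ∞ h
  smooth_K : ContMDiff (𝓡 4) 𝓘(ℝ, ℝ) ∞ K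
  commute : ∀ x : M, σ.form x ![σ.hamVec h x, σ.hamVec K x] = 0
  independent_ae : ∀ x₀ : M, MeasureTheory.volume
    (extChartAt (𝓡 4) x₀ '' {x ∈ (extChartAt (𝓡 4) x₀).source | ¬ IsRegularPoint h K x}) = 0
  compact_levels : ∀ b : ℝ × ℝ, IsCompact {x : M | (h x, K x) = b}
  connected_levels : ∀ b : ℝ × ℝ, IsPreconnected {x : M | (h x, K x) = b}

/-- The gradient of a function on the plane, as a pair of partial derivatives. -/
def grad (I : ℝ × ℝ → ℝ) (b : ℝ × ℝ) : ℝ × ℝ :=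
  (fderiv ℝ I b (1, 0), fderiv ℝ I b (0, 1))

namespace IntegrableSystem

variable {M : Type*} [TopologicalSpace M] [ChartedSpace E4 M] (S : IntegrableSystem M)

/-- The energy-momentum map. -/
def f (x : M) : ℝ × ℝ := (S.h x, S.K x)

/-- The base `B` of the fibration in Liouville tori: the regular values of the energy-momentum
map (in its image). -/
def base : Set (ℝ × ℝ) :=
  {b | (∃ x, S.f x = b) ∧ ∀ x, S.f x = b → IsRegularPoint S.h S.K x}

/-- A singularity of focus-focus type: a fixed point of both Hamiltonian vector fields at which
the Hessians of `h` and `K` are linearly independent and the linearization `A` of the Hamiltonian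
vector field of some combination `a h + b K` has an eigenvalue that is neither real nor purely
imaginary (so that the eigenvalues of `A` form a quadruple `± α ± i β`). -/
def IsFocusFocus (p : M) : Prop :=
  dif S.h p = 0 ∧ dif S.K p = 0 ∧
  (∀ a b : ℝ, (∀ v w : E4, a * hess S.h p v w + b * hess S.K p v w = 0) → a = 0 ∧ b = 0) ∧
  ∃ (a b : ℝ) (A : E4 →ₗ[ℝ] E4),
    (∀ v w : E4, (S.σ.form p : E4 [⋀^Fin 2]→L[ℝ] ℝ) ![A v, w] =
      -(a * hess S.h p v w + b * hess S.K p v w)) ∧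
    ∃ μ : ℂ, (A.charpoly.map (algebraMap ℝ ℂ)).IsRoot μ ∧ μ.re ≠ 0 ∧ μ.im ≠ 0

/-- The combination `a₁ X_h + a₂ X_K` of the two Hamiltonian vector fields. On the level set over
`b` it is the Hamiltonian vector field of `I ∘ f` whenever `grad I b = a`. -/
def field (a : ℝ × ℝ) (x : M) : TangentSpace (𝓡 4) x :=
  a.1 • S.σ.hamVec S.h x + a.2 • S.σ.hamVec S.K x

/-- `a` is in the period lattice of the level set over `b`: the flow of `a₁ X_h + a₂ X_K` is
1-periodic there. For `b` in the base, the period lattice is the lattice of (homology classes of)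
cycles on the Liouville torus, the period `a` corresponding to the class of the orbits. -/
def IsPeriod (b a : ℝ × ℝ) : Prop :=
  ∀ x, S.f x = b → ∃ c : ℝ → M, IsMIntegralCurve c (S.field a) ∧ c 0 = x ∧ c 1 = x

/-- `(I 0, I 1)` are action variables over the open subset `W` of the base: the differentials of
the two actions form, at each `b ∈ W`, a basis of the period lattice. Thus the Hamiltonian vector
fields of `I 0 ∘ f` and `I 1 ∘ f` generate the torus action (periods are normalized to 1).
Such functions are automatically smooth. -/
def IsActionPair (W : Set (ℝ × ℝ)) (I : Fin 2 → ℝ × ℝ → ℝ) : Prop :=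
  IsOpen W ∧ W ⊆ S.base ∧ (∀ i, ContDiffOn ℝ 1 (I i) W) ∧
  ∀ b ∈ W, LinearIndependent ℝ (fun i => grad (I i) b) ∧
    ∀ a : ℝ × ℝ, S.IsPeriod b a ↔ ∃ n : Fin 2 → ℤ, a = ∑ i, (n i : ℝ) • grad (I i) b

/-- The canonical connection: the covariantly constant sections over `W` of the bundle with fibre
`ℝ²` are the combinations, with constant coefficients, of the differentials of local actions. -/
def CanFlat (W : Set (ℝ × ℝ)) (σ : ℝ × ℝ → ℝ × ℝ) : Prop :=
  ∃ I : Fin 2 → ℝ × ℝ → ℝ, S.IsActionPair W I ∧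
    ∃ c : Fin 2 → ℝ, ∀ b ∈ W, σ b = ∑ i, c i • grad (I i) b

/-- `α` describes a choice over `U` of the cycle `γ₁`: `α b` is a primitive vector of the period
lattice that depends continuously on `b`, and `X_h` is nowhere tangent to the corresponding orbits
(so that the flow of `X_h` has a first return to them). -/
def IsFirstCycle (U : Set (ℝ × ℝ)) (α : ℝ × ℝ → ℝ × ℝ) : Prop :=
  ContinuousOn α U ∧
  ∀ b ∈ U, S.IsPeriod b (α b) ∧ (∀ r : ℝ, S.IsPeriod b (r • α b) → ∃ n : ℤ, r = n) ∧
    (α b).2 ≠ 0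

/-- `T` is the first return time, and `Θ` the rotation number, of the torus over `b`: the flow of
`X_h` through any point `x` of the torus meets again the orbit `γ₁` of `x` at the time `T > 0`,
not before, and it does so at the point with parameter `Θ` on this orbit (starting from `x`, a
full turn having length 1). -/
def IsReturn (α : ℝ × ℝ → ℝ × ℝ) (b : ℝ × ℝ) (Θ T : ℝ) : Prop :=
  0 < T ∧ ∀ x, S.f x = b → ∃ c d : ℝ → M,
    IsMIntegralCurve c (S.field (1, 0)) ∧ c 0 = x ∧
    IsMIntegralCurve d (S.field (α b)) ∧ d 0 = x ∧
    c T = d Θ ∧ ∀ t, 0 < t → t < T → ∀ s, c t ≠ d s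

/-- The second cycle `γ₂` attached to `Θ` and `T`, as an element of the period lattice: follow
`X_h` during the time `T`, then return along `γ₁`. -/
def secondCycle (α : ℝ × ℝ → ℝ × ℝ) (b : ℝ × ℝ) (Θ T : ℝ) : ℝ × ℝ :=
  T • ((1, 0) : ℝ × ℝ) - Θ • α b

/-- The parameter `τ = -Θ + i T`. -/
def tau (Θ T : ℝ) : ℂ := -(Θ : ℂ) + Complex.I * (T : ℂ)

/-- A local map `τ_W : W → ℍ`, `τ_W b = -Θ b + i T b`, with a continuous choice of `Θ`. -/
def IsTauBranch (α : ℝ × ℝ → ℝ × ℝ) (W : Set (ℝ × ℝ)) (τ : ℝ × ℝ → ℂ) : Prop :=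
  ContinuousOn τ W ∧ ∀ b ∈ W, ∃ Θ T : ℝ, S.IsReturn α b Θ T ∧ τ b = tau Θ T

end IntegrableSystem

/-- The theta functions of level `k`. -/
def theta (k : ℕ) (j : Fin k) (τ z : ℂ) : ℂ :=
  ∑' n : ℤ, Complex.exp (Complex.I / k * Real.pi * ((k : ℂ) * n + (j : ℕ)) ^ 2 * τ
    + 2 * Real.pi * Complex.I * ((k : ℂ) * n + (j : ℕ)) * z)

/-- The fibre at `τ` of the bundle of level `k` theta functions on the upper half-plane. -/
def thetaSpace (k : ℕ) (τ : ℂ) : Submodule ℂ (ℂ → ℂ) :=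
  Submodule.span ℂ (Set.range fun j : Fin k => theta k j τ)

/-- The heat connection: the covariant derivative at `τ`, in the direction `v`, of a section `s`
of the bundle of level `k` theta functions, i.e. `v (∂_τ + i/(4πk) ∂_z²) s + v̄ ∂_τ̄ s`. -/
def heatDeriv (k : ℕ) (s : ℂ → ℂ → ℂ) (τ v : ℂ) : ℂ → ℂ := fun z =>
  fderiv ℝ (fun τ' => s τ' z) τ v
    + v * (Complex.I / (4 * Real.pi * k)) * iteratedDeriv 2 (s τ) z

/-- Covariantly constant sections, over the subset `O` of the upper half-plane, of the bundle of
level `k` theta functions with the heat connection. -/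
def ThetaFlat (k : ℕ) (O : Set ℂ) (s : ℂ → ℂ → ℂ) : Prop :=
  ∀ τ ∈ O, s τ ∈ thetaSpace k τ ∧
    (∀ z, DifferentiableAt ℝ (fun τ' => s τ' z) τ) ∧ ∀ v, heatDeriv k s τ v = 0

/-- The open upper half-plane, as a subset of `ℂ`. -/
def upperHalf : Set ℂ := {τ | 0 < τ.im}

/-- `q` is the matrix, in the bases of level 2 theta functions at `τ`, of the parallel
displacement from the fibre at `τ` to the fibre at `Z • τ` (where these two spaces of functions
agree). As the upper half-plane is simply connected, the displacement is along any path. -/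
def IsThetaDisplacement (Z : SL(2, ℤ)) (q : Matrix (Fin 2) (Fin 2) ℂ) : Prop :=
  ∀ (τ : UpperHalfPlane) (s : ℂ → ℂ → ℂ), ThetaFlat 2 upperHalf s → ∀ c : Fin 2 → ℂ,
    s τ = ∑ j, c j • theta 2 j τ →
    s ((Z • τ : UpperHalfPlane) : ℂ) = ∑ j, (q.mulVec c) j • theta 2 j τ

/-- The pulled-back heat connection: a section over the open set `W` is covariantly constant if it
is the pull-back, along some `τ_W : W → ℍ`, of a covariantly constant section of the bundle of
level 2 theta functions. Its value at `b` lies in the fibre `thetaSpace 2 (τ_W b)`, which does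
not change if `τ_W b` is replaced by `τ_W b + 1`. -/
def IntegrableSystem.HeatFlat {M : Type*} [TopologicalSpace M] [ChartedSpace E4 M]
    (S : IntegrableSystem M) (α : ℝ × ℝ → ℝ × ℝ) (W : Set (ℝ × ℝ)) (σ : ℝ × ℝ → ℂ → ℂ) : Prop :=
  ∃ τ : ℝ × ℝ → ℂ, S.IsTauBranch α W τ ∧ ∃ (O : Set ℂ) (s : ℂ → ℂ → ℂ),
    IsOpen O ∧ O ⊆ upperHalf ∧ Set.MapsTo τ W O ∧ ThetaFlat 2 O s ∧ ∀ b ∈ W, σ b = s (τ b)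

/-- Parallel sections along a path, for a flat connection given by its covariantly constant local
sections: those which are locally the restriction of a covariantly constant section. -/
def ParallelAlong {F : Type*} (flat : Set (ℝ × ℝ) → (ℝ × ℝ → F) → Prop)
    (γ : unitInterval → ℝ × ℝ) (s : unitInterval → F) : Prop :=
  ∀ t₀, ∃ (W : Set (ℝ × ℝ)) (σ : ℝ × ℝ → F), IsOpen W ∧ γ t₀ ∈ W ∧ flat W σ ∧
    ∀ᶠ t in 𝓝 t₀, s t = σ (γ t)

/-- `A` is the matrix of the holonomy (parallel transport) along the loop `γ`, in the basis `e` of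
the fibre at the base point: for each initial vector there is a parallel section along `γ`, and
the coordinates of its final vector are determined through `A`. -/
def IsHolonomyMatrix {R F : Type*} [CommRing R] [AddCommGroup F] [Module R F]
    (flat : Set (ℝ × ℝ) → (ℝ × ℝ → F) → Prop) (γ : unitInterval → ℝ × ℝ) (e : Fin 2 → F)
    (A : Matrix (Fin 2) (Fin 2) R) : Prop :=
  ∀ c d : Fin 2 → R,
    (∃ s, ParallelAlong flat γ s ∧ s 0 = ∑ i, c i • e i ∧ s 1 = ∑ i, d i • e i) ↔
      d = A.mulVec c

/-- Parallel transport along some loop in `U` is not the identity. -/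
def NontrivialHolonomy {F : Type*} (flat : Set (ℝ × ℝ) → (ℝ × ℝ → F) → Prop)
    (U : Set (ℝ × ℝ)) : Prop :=
  ∃ (b : U) (γ : Path b b) (s : unitInterval → F),
    ParallelAlong flat (fun t => (γ t : ℝ × ℝ)) s ∧ s 1 ≠ s 0

/-- The system has monodromy: the canonical connection on the base has nontrivial holonomy. -/
def IntegrableSystem.HasMonodromy {M : Type*} [TopologicalSpace M] [ChartedSpace E4 M]
    (S : IntegrableSystem M) : Prop :=
  NontrivialHolonomy S.CanFlat S.base

/-- The element of `SL(2, ℤ)` that acts on the upper half-plane as `τ ↦ τ + 1`. -/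
def Z₀ : SL(2, ℤ) := ⟨!![1, 1; 0, 1], by simp [Matrix.det_fin_two]⟩

end HeatMonodromy

end

/-! Both holonomies record one integer per loop: the winding number of the rotation number `Θ`,
regarded as a continuous function on `U` with values in `ℝ/ℤ`.

To see that `Θ` is such a function, the torus action is built from the system. Levels are compact,
so the two Hamiltonian flows are complete (`exists_curve`). They are symplectic
(`flow_preserves_form`) and preserve both integrals, hence commute (`flow_comm`) and give an action
of `ℝ²`. Over a regular value a level is a single orbit, and its stabilizer is the period lattice
(`exists_basis_stab`). Periods continue to nearby levels by the inverse function theorem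
(`exists_local_periods`). They are closed one-forms, because acting by a period is a symplectic map
(`IsSectionAt.period_symmetric`), so they integrate to local actions (`exists_isActionPair`). A
unimodular change turns their differentials into `γ₁ = α` and `γ₂ = T (1, 0) - Θ α` with continuous
`Θ`, `T` (`exists_isAdapted`). Any other rotation number differs from `Θ` by an integer
(`IsAdapted.isReturn_iff`).

Along a loop a continuous choice of `Θ` ends at `Θ + n`. Then `γ₁`, `γ₂` form a parallel frame for
the canonical connection in which `γ₂` ends at `γ₂ - n γ₁`, which is the matrix `Z₀ ^ (-n)`. The
theta functions solve the heat equation term by term (`hasDerivAt_theta`), so they form a parallel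
frame for the heat connection (`ThetaFlat.exists_coeff`). Their modulus ends at `τ - n`, and
`theta_add_int` gives the diagonal matrix of the displacement by `-n`.

The integer `n` is a homomorphism on the fundamental group by lifting to the covering `ℝ → ℝ/ℤ`
(`exists_winding`). If the heat holonomy of a loop is nontrivial then `n ≠ 0`, and `γ₂` is moved. -/

noncomputable section

namespace HeatMonodromy

/-! ### Differentiability of composition operators on spaces of continuous curves. -/

section Nemytskii

open Set Metric

universe u

variable {K : Type*} [TopologicalSpace K] [CompactSpace K]

/-- Pointwise application of a continuous field of operators to a continuous field of vectors. -/
def pointwiseApply (E F : Type*) [NormedAddCommGroup E] [NormedSpace ℝ E]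
    [NormedAddCommGroup F] [NormedSpace ℝ F] :
    C(K, E →L[ℝ] F) →L[ℝ] C(K, E) →L[ℝ] C(K, F) :=
  LinearMap.mkContinuous₂
    (LinearMap.mk₂ ℝ (fun (A : C(K, E →L[ℝ] F)) (g : C(K, E)) => (⟨fun k => A k (g k), by fun_prop⟩ : C(K, F)))
      (fun A B g => by ext k; simp) (fun c A g => by ext k; simp)
      (fun A g g' => by ext k; simp) (fun c A g => by ext k; simp)) 1
    (fun A g => by
      rw [one_mul]
      refine (ContinuousMap.norm_le _ (by positivity)).2 fun k => ?_
      exact (A k).le_of_opNorm_le_of_le (A.norm_coe_le_norm k) (g.norm_coe_le_norm k))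

@[simp] theorem pointwiseApply_apply {E F : Type*} [NormedAddCommGroup E] [NormedSpace ℝ E]
    [NormedAddCommGroup F] [NormedSpace ℝ F] (A : C(K, E →L[ℝ] F)) (g : C(K, E)) (k : K) :
    pointwiseApply E F A g k = A k (g k) := rfl

/-- A continuous map is uniformly continuous around the range of a curve. -/
theorem exists_uniform_ball {E G : Type*} [NormedAddCommGroup E] [NormedAddCommGroup G]
    {w : E → G} (hw : Continuous w) (g : C(K, E)) {c : ℝ} (hc : 0 < c) :
    ∃ δ > 0, ∀ k, ∀ y ∈ ball (g k) δ, ‖w y - w (g k)‖ ≤ c := by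
  let w' : C(E, G) := ⟨w, hw⟩
  have hcont : ContinuousAt (fun g : C(K, E) => w'.comp g) g :=
    (ContinuousMap.continuous_postcomp w').continuousAt
  obtain ⟨δ, hδ, hδ'⟩ := Metric.continuousAt_iff.1 hcont c hc
  refine ⟨δ, hδ, fun k y hy => ?_⟩
  -- Translating the whole curve by the constant `y - g k` moves it by less than `δ` in the sup norm
  -- and makes it pass through `y` at `k`. Continuity of `g ↦ w ∘ g` at the single curve `g`
  -- therefore gives a bound uniform in `k`.
  have h1 : dist (g + ContinuousMap.const K (y - g k)) g < δ := by
    rw [dist_eq_norm, add_sub_cancel_left]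
    refine lt_of_le_of_lt ((ContinuousMap.norm_le _ (norm_nonneg (y - g k))).2 fun _ => le_rfl) ?_
    rwa [← dist_eq_norm]
  have h2 := hδ' h1
  rw [dist_eq_norm] at h2
  have h3 := ((w'.comp (g + ContinuousMap.const K (y - g k))) - w'.comp g).norm_coe_le_norm k
  simp only [ContinuousMap.sub_apply, ContinuousMap.comp_apply, ContinuousMap.add_apply,
    ContinuousMap.const_apply, add_sub_cancel] at h3
  exact h3.trans h2.le

/-- Postcomposition with a `C¹` map is differentiable on the space of continuous maps. -/
theorem hasFDerivAt_postcomp {E F : Type*} [NormedAddCommGroup E] [NormedSpace ℝ E]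
    [NormedAddCommGroup F] [NormedSpace ℝ F] (v : C(E, F)) (v' : C(E, E →L[ℝ] F))
    (hv : ∀ x, HasFDerivAt v (v' x) x) (g : C(K, E)) :
    HasFDerivAt (fun g : C(K, E) => v.comp g) (pointwiseApply E F (v'.comp g)) g := by
  rw [hasFDerivAt_iff_isLittleO_nhds_zero, Asymptotics.isLittleO_iff]
  intro c hc
  obtain ⟨δ, hδ, hball⟩ := exists_uniform_ball v'.continuous g hc
  filter_upwards [ball_mem_nhds (0 : C(K, E)) hδ] with w hw
  rw [mem_ball_zero_iff] at hw
  refine (ContinuousMap.norm_le _ (by positivity)).2 fun k => ?_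
  have hwk : ‖w k‖ ≤ ‖w‖ := w.norm_coe_le_norm k
  have h := (convex_ball (g k) δ).norm_image_sub_le_of_norm_hasFDerivWithin_le' (f := v)
    (f' := v') (φ := v' (g k)) (C := c) (x := g k) (y := g k + w k)
    (fun x _ => (hv x).hasFDerivWithinAt) (hball k) (mem_ball_self hδ)
    (by rw [mem_ball, dist_eq_norm, add_sub_cancel_left]; exact hwk.trans_lt hw)
  simp only [add_sub_cancel_left] at h
  exact h.trans (mul_le_mul_of_nonneg_left hwk hc.le)

/-- Postcomposition with a `Cⁿ` map is `Cⁿ` on the space of continuous maps. -/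
theorem contDiff_postcomp (n : ℕ) {E : Type u} [NormedAddCommGroup E] [NormedSpace ℝ E] :
    ∀ {F : Type u} [NormedAddCommGroup F] [NormedSpace ℝ F] (v : C(E, F)),
      ContDiff ℝ n v → ContDiff ℝ n (fun g : C(K, E) => v.comp g) := by
  induction n with
  | zero =>
    intro F _ _ v _
    exact contDiff_zero.2 (ContinuousMap.continuous_postcomp v)
  | succ n ih =>
    intro F _ _ v hv
    have hv' : ContDiff ℝ (n + 1 : ℕ) v := hv
    push_cast at hv' ⊢
    rw [contDiff_succ_iff_fderiv] at hv'
    -- The derivative is postcomposition with `fderiv ℝ v`, followed by a fixed bounded operator.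
    -- The induction thus passes from the target `F` to `E →L[ℝ] F`, which is why `E` and `F` share
    -- a universe.
    let v' : C(E, E →L[ℝ] F) := ⟨fderiv ℝ v, hv'.2.2.continuous⟩
    rw [contDiff_succ_iff_hasFDerivAt]
    refine ⟨fun g => pointwiseApply E F (v'.comp g), ?_,
      hasFDerivAt_postcomp v v' fun x => (hv'.1 x).hasFDerivAt⟩
    exact (pointwiseApply E F).contDiff.comp (ih v' hv'.2.2)

end Nemytskii

/-! ### Local flows depend differentiably on time and initial point, by the implicit function
theorem. -/

section LocalFlow

open Set Metric

universe u

variable {E : Type u} [NormedAddCommGroup E] [NormedSpace ℝ E]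

theorem continuous_IccExtend {X : Type*} [TopologicalSpace X] (g : C(Icc (-1 : ℝ) 1, X)) :
    Continuous (IccExtend (by norm_num : (-1 : ℝ) ≤ 1) g) := g.continuous.Icc_extend'

/-- Integration from `0`, as an operator on continuous curves on `[-1, 1]`. -/
def integrateFromZero (E : Type u) [NormedAddCommGroup E] [NormedSpace ℝ E] [CompleteSpace E] :
    C(Icc (-1 : ℝ) 1, E) →L[ℝ] C(Icc (-1 : ℝ) 1, E) :=
  LinearMap.mkContinuous
    { toFun := fun g => ⟨fun t => ∫ s in (0 : ℝ)..t, IccExtend (by norm_num) g s, by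
        have h : Continuous fun b : ℝ => ∫ s in (0 : ℝ)..b, IccExtend (by norm_num) g s :=
          intervalIntegral.continuous_primitive
            (fun a b => (continuous_IccExtend g).intervalIntegrable a b) 0
        exact h.comp continuous_subtype_val⟩
      map_add' := fun g g' => by
        ext t
        exact intervalIntegral.integral_add ((continuous_IccExtend g).intervalIntegrable _ _)
          ((continuous_IccExtend g').intervalIntegrable _ _)
      map_smul' := fun c g => by
        ext t
        exact intervalIntegral.integral_smul c _ } 1
    (fun g => by
      rw [one_mul]
      refine (ContinuousMap.norm_le _ (by positivity)).2 fun t => ?_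
      have h := intervalIntegral.norm_integral_le_of_norm_le_const (a := 0) (b := (t : ℝ))
        (f := IccExtend (by norm_num : (-1 : ℝ) ≤ 1) g) (C := ‖g‖)
        (fun s _ => g.norm_coe_le_norm _)
      refine h.trans ?_
      have : |(t : ℝ) - 0| ≤ 1 := by rw [sub_zero, abs_le]; exact t.2
      nlinarith [norm_nonneg g])

theorem integrateFromZero_apply [CompleteSpace E] (g : C(Icc (-1 : ℝ) 1, E))
    (t : Icc (-1 : ℝ) 1) :
    integrateFromZero E g t = ∫ s in (0 : ℝ)..t, IccExtend (by norm_num) g s := rfl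

/-- Rescaling of the time of a curve on `[-1, 1]`. -/
def rescale (r : Icc (-1 : ℝ) 1) (g : C(Icc (-1 : ℝ) 1, E)) : C(Icc (-1 : ℝ) 1, E) :=
  ⟨fun t => g ⟨r * t, by
      have h1 := abs_le.2 r.2
      have h2 := abs_le.2 t.2
      refine abs_le.1 ?_
      rw [abs_mul]
      nlinarith [abs_nonneg (r : ℝ), abs_nonneg (t : ℝ)]⟩, by fun_prop⟩

/-- Substitution `s ↦ r s` in the integral. It makes the rescaling of a solution of the integral
equation with time parameter `ε` a solution with parameter `r ε`. -/
theorem integrateFromZero_rescale [CompleteSpace E] (r : Icc (-1 : ℝ) 1)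
    (g : C(Icc (-1 : ℝ) 1, E)) :
    (r : ℝ) • integrateFromZero E (rescale r g) = rescale r (integrateFromZero E g) := by
  ext t
  have hmem : (r : ℝ) * t ∈ Icc (-1 : ℝ) 1 := by
    have h1 := abs_le.2 r.2
    have h2 := abs_le.2 t.2
    refine abs_le.1 ?_
    rw [abs_mul]
    nlinarith [abs_nonneg (r : ℝ), abs_nonneg (t : ℝ)]
  change (r : ℝ) • integrateFromZero E (rescale r g) t = integrateFromZero E g ⟨r * t, hmem⟩
  rw [integrateFromZero_apply, integrateFromZero_apply]
  have h := intervalIntegral.smul_integral_comp_mul_left (a := 0) (b := (t : ℝ))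
    (IccExtend (by norm_num : (-1 : ℝ) ≤ 1) g) (r : ℝ)
  rw [mul_zero] at h
  rw [← h]
  congr 1
  refine intervalIntegral.integral_congr fun s hs => ?_
  have hs' : s ∈ Icc (-1 : ℝ) 1 := by
    have := t.2
    rcases le_total 0 (t : ℝ) with h0 | h0
    · rw [uIcc_of_le h0] at hs; exact ⟨by linarith [hs.1], hs.2.trans this.2⟩
    · rw [uIcc_of_ge h0] at hs; exact ⟨this.1.trans hs.1, by linarith [hs.2]⟩
  have hrs : (r : ℝ) * s ∈ Icc (-1 : ℝ) 1 := by
    have h1 := abs_le.2 r.2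
    have h2 := abs_le.2 hs'
    refine abs_le.1 ?_
    rw [abs_mul]
    nlinarith [abs_nonneg (r : ℝ), abs_nonneg s]
  rw [IccExtend_of_mem _ _ hs', IccExtend_of_mem _ _ hrs]
  rfl

/-- The local flow of a globally defined `Cⁿ` vector field is `Cⁿ`. -/
theorem exists_contDiffAt_flow [CompleteSpace E] {n : ℕ} (hn : n ≠ 0) {v : E → E}
    (hv : ContDiff ℝ n v) (x₀ : E) :
    ∃ φ : ℝ × E → E, ContDiffAt ℝ n φ (0, x₀) ∧ ∃ ε > 0, ∀ᶠ x in 𝓝 x₀, φ (0, x) = x ∧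
      ∀ t ∈ Ioo (-ε) ε, HasDerivAt (fun t => φ (t, x)) (v (φ (t, x))) t := by
  let C := C(Icc (-1 : ℝ) 1, E)
  let vC : C(E, E) := ⟨v, hv.continuous⟩
  let cst : E →L[ℝ] C := ContinuousLinearMap.const ℝ _
  -- A zero `g` of `F ((t, x), ·)` satisfies `g(s) = x + t ∫₀ˢ v(g)`: it is the integral curve
  -- through `x`, run at speed `t` over `[-1, 1]`. The flow is its value at `s = 1`, and time
  -- becomes an ordinary parameter.
  let F : (ℝ × E) × C → C := fun q =>
    q.2 - cst q.1.2 - q.1.1 • integrateFromZero E (vC.comp q.2)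
  let u : (ℝ × E) × C := ((0, x₀), cst x₀)
  have hN : ContDiff ℝ n (fun g : C => vC.comp g) := contDiff_postcomp n vC hv
  have hF : ContDiff ℝ n F := by
    refine (contDiff_snd.sub (cst.contDiff.comp (contDiff_snd.comp contDiff_fst))).sub ?_
    exact (contDiff_fst.comp contDiff_fst).smul
      ((integrateFromZero E).contDiff.comp (hN.comp contDiff_snd))
  have hn' : (n : ℕ∞ω) ≠ 0 := by exact_mod_cast hn
  have hFu : F u = 0 := by simp [F, u]
  have hinv : (fderiv ℝ F u ∘L .inr ℝ (ℝ × E) C).IsInvertible := by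
    have h1 : HasFDerivAt (fun g : C => F ((0, x₀), g))
        (fderiv ℝ F u ∘L .inr ℝ (ℝ × E) C) (cst x₀) :=
      ((hF.differentiable hn') u).hasFDerivAt.comp (cst x₀)
        (hasFDerivAt_prodMk_right (0, x₀) (cst x₀))
    -- At `t = 0` the integral term vanishes identically, so the partial derivative in `g` is the
    -- identity.
    have h2 : HasFDerivAt (fun g : C => F ((0, x₀), g)) (.id ℝ C) (cst x₀) := by
      have : (fun g : C => F ((0, x₀), g)) = fun g => g - cst x₀ := by
        funext g; simp [F]
      rw [this]
      exact (hasFDerivAt_id _).sub_const _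
    rw [h1.unique h2]
    exact ⟨ContinuousLinearEquiv.refl ℝ C, rfl⟩
  have hFa : ContDiffAt ℝ n F u := hF.contDiffAt
  let Γ := hFa.implicitFunction hn' hinv
  have hΓ0 : Γ (0, x₀) = cst x₀ := hFa.implicitFunction_apply_self hn' hinv
  have hΓ : ContDiffAt ℝ n Γ (0, x₀) := hFa.contDiffAt_implicitFunction hn' hinv
  have hiff : ∀ᶠ q in 𝓝 u, F q = 0 ↔ Γ q.1 = q.2 := by
    have := hFa.eventually_apply_eq_iff_implicitFunction hn' hinv
    rwa [hFu] at this
  obtain ⟨δ, hδ, hball⟩ := Metric.eventually_nhds_iff_ball.1 hiff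
  have hΓc : ∀ᶠ p in 𝓝 ((0 : ℝ), x₀), Γ p ∈ ball (cst x₀) δ := by
    have := hΓ.continuousAt
    refine this.eventually_mem ?_
    rw [hΓ0]
    exact ball_mem_nhds _ hδ
  obtain ⟨η, hη, hηball⟩ := Metric.eventually_nhds_iff_ball.1 hΓc
  let ev1 : C →L[ℝ] E := ContinuousMap.evalCLM ℝ ⟨1, by norm_num⟩
  -- Half of the minimum, so that the closed range `|s| ≤ ε` stays inside both balls: the curve with
  -- `s = ε` serves as reference.
  let ε := min δ η / 2
  have hε : 0 < ε := by positivity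
  have hεδ : ε < δ := by have := min_le_left δ η; simp only [ε]; linarith
  have hεη : ε < η := by have := min_le_right δ η; simp only [ε]; linarith
  have hmemball : ∀ x ∈ ball x₀ ε, ∀ s : ℝ, |s| ≤ ε → ∀ g : C, g ∈ ball (cst x₀) δ →
      ((s, x), g) ∈ ball u δ := by
    intro x hx s hs g hg
    simp only [u, mem_ball, Prod.dist_eq, max_lt_iff]
    refine ⟨⟨?_, ?_⟩, hg⟩
    · rw [Real.dist_eq, sub_zero]; exact hs.trans_lt hεδ
    · exact (mem_ball.1 hx).trans hεδ
  have hΓball : ∀ x ∈ ball x₀ ε, ∀ s : ℝ, |s| ≤ ε → Γ (s, x) ∈ ball (cst x₀) δ := by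
    intro x hx s hs
    apply hηball
    simp only [mem_ball, Prod.dist_eq, max_lt_iff]
    exact ⟨by rw [Real.dist_eq, sub_zero]; exact hs.trans_lt hεη, (mem_ball.1 hx).trans hεη⟩
  have hsol : ∀ x ∈ ball x₀ ε, ∀ s : ℝ, |s| ≤ ε → F ((s, x), Γ (s, x)) = 0 := by
    intro x hx s hs
    exact (hball _ (hmemball x hx s hs _ (hΓball x hx s hs))).2 rfl
  have hεabs : |ε| ≤ ε := (abs_of_pos hε).le
  -- Both sides are zeros of `F` for the same parameters and near `cst x₀`, so the uniqueness in the
  -- implicit function theorem identifies them. All curves with `|t| ≤ ε` are then pieces of the one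
  -- at `ε`, from which the derivative in `t` is read off.
  have hscale : ∀ x ∈ ball x₀ ε, ∀ r : Icc (-1 : ℝ) 1,
      Γ (r * ε, x) = rescale r (Γ (ε, x)) := by
    intro x hx r
    have hr : |(r : ℝ) * ε| ≤ ε := by
      rw [abs_mul, abs_of_pos hε]
      have := abs_le.2 r.2
      nlinarith
    have hg : rescale r (Γ (ε, x)) ∈ ball (cst x₀) δ := by
      have h1 := hΓball x hx ε hεabs
      rw [mem_ball, ContinuousMap.dist_lt_iff hδ] at h1 ⊢
      exact fun t => h1 _
    refine (hball _ (hmemball x hx _ hr _ hg)).1 ?_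
    have h0 := hsol x hx ε hεabs
    have h1 : Γ (ε, x) = cst x + ε • integrateFromZero E (vC.comp (Γ (ε, x))) := by
      simp only [F] at h0
      rw [sub_sub, sub_eq_zero] at h0
      exact h0
    have h2 : rescale r (Γ (ε, x)) =
        cst x + ε • rescale r (integrateFromZero E (vC.comp (Γ (ε, x)))) := by
      conv_lhs => rw [h1]
      rfl
    simp only [F]
    rw [sub_sub, sub_eq_zero]
    have h3 : vC.comp (rescale r (Γ (ε, x))) = rescale r (vC.comp (Γ (ε, x))) := rfl
    rw [h3, mul_comm, mul_smul, integrateFromZero_rescale]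
    exact h2
  have hΦ : ∀ x ∈ ball x₀ ε, ∀ t ∈ Icc (-ε) ε, ev1 (Γ (t, x)) =
      x + ε • ∫ s in (0 : ℝ)..(t / ε), IccExtend (by norm_num : (-1 : ℝ) ≤ 1)
        (vC.comp (Γ (ε, x))) s := by
    intro x hx t ht
    have hr : t / ε ∈ Icc (-1 : ℝ) 1 := by
      constructor
      · rw [le_div_iff₀ hε]; linarith [ht.1]
      · rw [div_le_iff₀ hε]; linarith [ht.2]
    have h1 := hscale x hx ⟨t / ε, hr⟩
    simp only [div_mul_cancel₀ t hε.ne'] at h1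
    rw [h1]
    have h0 := hsol x hx ε hεabs
    simp only [F] at h0
    rw [sub_sub, sub_eq_zero] at h0
    have h2 : ev1 (rescale ⟨t / ε, hr⟩ (Γ (ε, x))) = Γ (ε, x) ⟨t / ε, hr⟩ := by
      change Γ (ε, x) ⟨t / ε * 1, _⟩ = _
      simp only [mul_one]
    rw [h2]
    conv_lhs => rw [h0]
    rfl
  refine ⟨fun q => ev1 (Γ q), ev1.contDiff.contDiffAt.comp _ hΓ, ε, hε, ?_⟩
  filter_upwards [ball_mem_nhds x₀ hε] with x hx
  constructor
  · have := hΦ x hx 0 ⟨by linarith, hε.le⟩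
    simpa using this
  · intro t ht
    have hr : t / ε ∈ Icc (-1 : ℝ) 1 := by
      constructor
      · rw [le_div_iff₀ hε]; linarith [ht.1]
      · rw [div_le_iff₀ hε]; linarith [ht.2]
    have h1 : HasDerivAt (fun t => x + ε • ∫ s in (0 : ℝ)..(t / ε),
        IccExtend (by norm_num : (-1 : ℝ) ≤ 1) (vC.comp (Γ (ε, x))) s)
        (ε • (1 / ε) • IccExtend (by norm_num : (-1 : ℝ) ≤ 1) (vC.comp (Γ (ε, x))) (t / ε)) t := by
      refine HasDerivAt.const_add _ (HasDerivAt.const_smul ε ?_)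
      have hc := continuous_IccExtend (vC.comp (Γ (ε, x)))
      have h2 := intervalIntegral.integral_hasDerivAt_right
        (hc.intervalIntegrable 0 (t / ε)) hc.aestronglyMeasurable.stronglyMeasurableAtFilter
        hc.continuousAt
      exact h2.scomp t ((hasDerivAt_id t).div_const ε)
    have h3 : v (ev1 (Γ (t, x))) =
        ε • (1 / ε) • IccExtend (by norm_num : (-1 : ℝ) ≤ 1) (vC.comp (Γ (ε, x))) (t / ε) := by
      rw [smul_smul, mul_one_div_cancel hε.ne', one_smul, IccExtend_of_mem _ _ hr]
      have h4 := hscale x hx ⟨t / ε, hr⟩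
      simp only [div_mul_cancel₀ t hε.ne'] at h4
      rw [h4]
      change v (Γ (ε, x) ⟨t / ε * 1, _⟩) = v (Γ (ε, x) ⟨t / ε, hr⟩)
      simp only [mul_one]
    rw [h3]
    refine h1.congr_of_eventuallyEq ?_
    filter_upwards [Ioo_mem_nhds ht.1 ht.2] with s hs
    exact hΦ x hx s ⟨hs.1.le, hs.2.le⟩

/-- The local flow of a `Cⁿ` vector field on an open subset of a finite dimensional space. -/
theorem exists_contDiffOn_flow [FiniteDimensional ℝ E] {n : ℕ} (hn : n ≠ 0) {v : E → E}
    {O : Set E} (hO : IsOpen O) (hv : ContDiffOn ℝ n v O) {x₀ : E} (hx₀ : x₀ ∈ O) :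
    ∃ φ : ℝ × E → E, ∃ ε > 0, ∃ N : Set E, IsOpen N ∧ x₀ ∈ N ∧ N ⊆ O ∧
      ContDiffOn ℝ n φ (Ioo (-ε) ε ×ˢ N) ∧ (∀ x ∈ N, φ (0, x) = x) ∧
      ∀ x ∈ N, ∀ t ∈ Ioo (-ε) ε, φ (t, x) ∈ O ∧
        HasDerivAt (fun t => φ (t, x)) (v (φ (t, x))) t := by
  obtain ⟨r, hr, hrO⟩ := Metric.isOpen_iff.1 hO x₀ hx₀
  -- The cut-off makes the field global. The flow is later confined to the ball of radius `r / 4`,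
  -- where `χ = 1` and the cut-off field is `v`.
  let χ : ContDiffBump x₀ := ⟨r / 4, r / 2, by positivity, by linarith⟩
  have hv' : ContDiff ℝ n (fun x => χ x • v x) := by
    rw [contDiff_iff_contDiffAt]
    intro x
    by_cases hx : x ∈ O
    · exact χ.contDiffAt.smul (hv.contDiffAt (hO.mem_nhds hx))
    · have : x ∉ tsupport χ := by
        rw [χ.tsupport_eq]
        intro h
        exact hx (hrO (closedBall_subset_ball (by simp only [χ]; linarith) h))
      have h0 : (fun x => χ x • v x) =ᶠ[𝓝 x] fun _ => 0 := by
        filter_upwards [notMem_tsupport_iff_eventuallyEq.1 this] with y hy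
        simp [hy]
      exact contDiffAt_const.congr_of_eventuallyEq h0
  obtain ⟨φ, hφ, ε₀, hε₀, hflow⟩ := exists_contDiffAt_flow hn hv' x₀
  obtain ⟨V, hV, hφV⟩ := hφ.contDiffOn le_rfl (by simp)
  have hφ0 : φ (0, x₀) = x₀ := hflow.self_of_nhds.1
  have hmem : ∀ᶠ q in 𝓝 ((0 : ℝ), x₀), q ∈ V ∧ φ q ∈ ball x₀ (r / 4) := by
    refine Filter.Eventually.and hV (hφ.continuousAt.eventually_mem ?_)
    rw [hφ0]
    exact ball_mem_nhds _ (by positivity)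
  obtain ⟨η, hη, hηV⟩ := Metric.eventually_nhds_iff_ball.1 hmem
  obtain ⟨η', hη', hηflow⟩ := Metric.eventually_nhds_iff_ball.1 hflow
  refine ⟨φ, min ε₀ η, by positivity, ball x₀ (min (min η η') r), isOpen_ball,
    mem_ball_self (by positivity), (ball_subset_ball (min_le_right _ _)).trans hrO, ?_, ?_, ?_⟩
  · refine hφV.mono fun q hq => (hηV q ?_).1
    simp only [mem_ball, Prod.dist_eq, max_lt_iff]
    constructor
    · rw [Real.dist_eq, sub_zero]
      exact (abs_lt.2 hq.1).trans_le (min_le_right _ _)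
    · exact (mem_ball.1 hq.2).trans_le ((min_le_left _ _).trans (min_le_left _ _))
  · intro x hx
    exact (hηflow x (ball_subset_ball ((min_le_left _ _).trans (min_le_right _ _)) hx)).1
  · intro x hx t ht
    have h1 : φ (t, x) ∈ ball x₀ (r / 4) := by
      refine (hηV (t, x) ?_).2
      simp only [mem_ball, Prod.dist_eq, max_lt_iff]
      constructor
      · rw [Real.dist_eq, sub_zero]
        exact (abs_lt.2 ht).trans_le (min_le_right _ _)
      · exact (mem_ball.1 hx).trans_le ((min_le_left _ _).trans (min_le_left _ _))
    refine ⟨hrO (ball_subset_ball (by linarith) h1), ?_⟩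
    have h2 := (hηflow x (ball_subset_ball ((min_le_left _ _).trans (min_le_right _ _)) hx)).2 t
      ⟨by have := min_le_left ε₀ η; linarith [ht.1], ht.2.trans_le (min_le_left _ _)⟩
    rwa [χ.one_of_mem_closedBall (ball_subset_closedBall h1), one_smul] at h2

end LocalFlow

end HeatMonodromy
end

/-! ### Hamiltonian flows on a normed space preserve the symplectic form. -/

noncomputable section

namespace HeatMonodromy

section LinearAlgebra

variable {E : Type*} [NormedAddCommGroup E] [NormedSpace ℝ E]

theorem update_vec_one {V : Type*} (u v w : V) : Function.update ![u, v] 1 w = ![u, w] := by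
  ext i : 1
  fin_cases i <;> simp

/-- The bilinear form underlying an alternating 2-form. -/
def bilinOf (β : E [⋀^Fin 2]→L[ℝ] ℝ) : E →L[ℝ] E →L[ℝ] ℝ :=
  LinearMap.mkContinuous₂
    (LinearMap.mk₂ ℝ (fun v w : E => β ![v, w])
      (fun u v w => β.toMultilinearMap.cons_add ![w] u v)
      (fun c v w => β.toMultilinearMap.cons_smul ![w] c v)
      (fun u v w => by
        have h := β.map_update_add ![u, v] 1 v w
        rw [update_vec_one, update_vec_one, update_vec_one] at h
        exact h)
      (fun c v w => by
        have h := β.map_update_smul ![v, w] 1 c w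
        rw [update_vec_one, update_vec_one] at h
        exact h)) ‖β‖
    (fun v w => by
      have h := β.le_opNorm ![v, w]
      simp only [Fin.prod_univ_two, Matrix.cons_val_zero, Matrix.cons_val_one,
        ← mul_assoc] at h
      exact h)

theorem norm_bilinOf_le (β : E [⋀^Fin 2]→L[ℝ] ℝ) : ‖bilinOf β‖ ≤ ‖β‖ :=
  LinearMap.mkContinuous₂_norm_le _ (norm_nonneg β) _

/-- The passage from alternating 2-forms to bilinear forms, as a continuous linear map. -/
def toBilin : (E [⋀^Fin 2]→L[ℝ] ℝ) →L[ℝ] E →L[ℝ] E →L[ℝ] ℝ :=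
  LinearMap.mkContinuous
    { toFun := bilinOf
      map_add' := fun β γ => by ext v w; rfl
      map_smul' := fun c β => by ext v w; rfl } 1
    (fun β => by
      rw [one_mul]
      exact norm_bilinOf_le β)

@[simp] theorem toBilin_apply (β : E [⋀^Fin 2]→L[ℝ] ℝ) (v w : E) :
    toBilin β v w = β ![v, w] := rfl

theorem hasFDerivAt_toBilin {Ω : E → E [⋀^Fin 2]→L[ℝ] ℝ} {x : E}
    {Ω' : E →L[ℝ] (E [⋀^Fin 2]→L[ℝ] ℝ)} (hw : HasFDerivAt Ω Ω' x) :
    HasFDerivAt (fun y => toBilin (Ω y)) (toBilin.comp Ω') x := by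
  have h : HasFDerivAt (toBilin (E := E)) toBilin (Ω x) := by fun_prop
  refine HasFDerivAt.comp (F := E [⋀^Fin 2]→L[ℝ] ℝ) (G := E →L[ℝ] E →L[ℝ] ℝ) (f := Ω)
    (f' := Ω') (g := fun b => toBilin b) x ?_ hw
  exact h

theorem toBilin_swap (β : E [⋀^Fin 2]→L[ℝ] ℝ) (v w : E) :
    toBilin β v w = -toBilin β w v := by
  have h := β.toAlternatingMap.map_swap ![w, v] (i := 0) (j := 1) (by decide)
  have e : (![w, v] ∘ Equiv.swap (0 : Fin 2) 1) = ![v, w] := by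
    ext i : 1
    fin_cases i <;> simp
  rw [e] at h
  exact h

/-- Closedness of a 2-form, expressed through the derivative of the associated bilinear form. -/
theorem fderiv_toBilin_cyclic {Ω : E → E [⋀^Fin 2]→L[ℝ] ℝ} {x : E}
    (hw : DifferentiableAt ℝ Ω x) (hclosed : extDeriv Ω x = 0) (u v w : E) :
    fderiv ℝ (fun y => toBilin (Ω y)) x u v w - fderiv ℝ (fun y => toBilin (Ω y)) x v u w
      + fderiv ℝ (fun y => toBilin (Ω y)) x w u v = 0 := by
  have hD : fderiv ℝ (fun y => toBilin (Ω y)) x = toBilin.comp (fderiv ℝ Ω x) :=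
    (hasFDerivAt_toBilin hw.hasFDerivAt).fderiv
  have h := DFunLike.congr_fun hclosed ![u, v, w]
  rw [extDeriv, ContinuousAlternatingMap.alternatizeUncurryFin_apply, Fin.sum_univ_three] at h
  have e0 : (0 : Fin 3).removeNth ![u, v, w] = ![v, w] := by
    ext i : 1; fin_cases i <;> rfl
  have e1 : (1 : Fin 3).removeNth ![u, v, w] = ![u, w] := by
    ext i : 1; fin_cases i <;> rfl
  have e2 : (2 : Fin 3).removeNth ![u, v, w] = ![u, v] := by
    ext i : 1; fin_cases i <;> rfl
  rw [e0, e1, e2] at h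
  simp only [hD, ContinuousLinearMap.comp_apply, toBilin_apply]
  simpa [sub_eq_add_neg] using h

end LinearAlgebra

section HamiltonianFlow

open Set

variable {E : Type*} [NormedAddCommGroup E] [NormedSpace ℝ E]

/-- Cartan's formula: the Lie derivative of a closed form along a Hamiltonian field vanishes. -/
theorem lieDeriv_hamiltonian_eq_zero {Ω : E → E [⋀^Fin 2]→L[ℝ] ℝ} {x : E}
    (hw : DifferentiableAt ℝ Ω x) (hclosed : extDeriv Ω x = 0) {X : E → E}
    (hX : DifferentiableAt ℝ X x) {H : E → ℝ} (hH : ContDiffAt ℝ 2 H x)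
    (hham : ∀ᶠ y in 𝓝 x, ∀ w, Ω y ![X y, w] = -fderiv ℝ H y w) (ξ η : E) :
    fderiv ℝ (fun y => toBilin (Ω y)) x (X x) ξ η + toBilin (Ω x) (fderiv ℝ X x ξ) η
      + toBilin (Ω x) ξ (fderiv ℝ X x η) = 0 := by
  have hB : DifferentiableAt ℝ (fun y => toBilin (Ω y)) x :=
    (hasFDerivAt_toBilin hw.hasFDerivAt).differentiableAt
  have hdH : DifferentiableAt ℝ (fderiv ℝ H) x :=
    (hH.fderiv_right (m := 1) (by norm_num)).differentiableAt one_ne_zero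
  have h1 : (fun y => toBilin (Ω y) (X y)) =ᶠ[𝓝 x] fun y => -fderiv ℝ H y := by
    filter_upwards [hham] with y hy
    ext w
    exact hy w
  have h2 : HasFDerivAt (fun y => toBilin (Ω y) (X y))
      ((toBilin (Ω x)).comp (fderiv ℝ X x) +
        (fderiv ℝ (fun y => toBilin (Ω y)) x).flip (X x)) x :=
    hB.hasFDerivAt.clm_apply hX.hasFDerivAt
  have h3 : HasFDerivAt (fun y => -fderiv ℝ H y) (-fderiv ℝ (fderiv ℝ H) x) x :=
    hdH.hasFDerivAt.neg
  have h4 := h2.unique (h3.congr_of_eventuallyEq h1)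
  have hsymm : IsSymmSndFDerivAt ℝ H x := hH.isSymmSndFDerivAt (by simp)
  -- This is the derivative of `i_X Ω = -dH`. Antisymmetrizing in `a`, `b` removes the Hessian of
  -- `H`, and closedness (`h6`) turns the remaining terms into the Lie derivative.
  have h5 : ∀ a b : E, toBilin (Ω x) (fderiv ℝ X x a) b +
      fderiv ℝ (fun y => toBilin (Ω y)) x a (X x) b = -fderiv ℝ (fderiv ℝ H) x a b := by
    intro a b
    have := DFunLike.congr_fun (DFunLike.congr_fun h4 a) b
    simpa using this
  have h6 := fderiv_toBilin_cyclic hw hclosed (X x) ξ η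
  have h7 : fderiv ℝ (fderiv ℝ H) x ξ η = fderiv ℝ (fderiv ℝ H) x η ξ := hsymm ξ η
  have h8 := h5 ξ η
  have h9 := h5 η ξ
  have h10 := toBilin_swap (Ω x) ξ (fderiv ℝ X x η)
  linarith

/-- The variational equation of a `C²` flow. -/
theorem hasDerivAt_fderiv_flow {φ : ℝ × E → E} {X : E → E} {t : ℝ} {x : E}
    (hφ : ContDiffAt ℝ 2 φ (t, x)) (hX : DifferentiableAt ℝ X (φ (t, x)))
    (hflow : ∀ᶠ y in 𝓝 x, HasDerivAt (fun s => φ (s, y)) (X (φ (t, y))) t)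
    (ξ : E) :
    HasDerivAt (fun s => fderiv ℝ φ (s, x) (0, ξ))
      (fderiv ℝ X (φ (t, x)) (fderiv ℝ φ (t, x) (0, ξ))) t := by
  have hd : DifferentiableAt ℝ (fderiv ℝ φ) (t, x) :=
    (hφ.fderiv_right (m := 1) (by norm_num)).differentiableAt one_ne_zero
  have hφd : ∀ᶠ q in 𝓝 (t, x), DifferentiableAt ℝ φ q := by
    filter_upwards [hφ.eventually (by simp)] with q hq
    exact hq.differentiableAt two_ne_zero
  have hsymm : IsSymmSndFDerivAt ℝ φ (t, x) := hφ.isSymmSndFDerivAt (by simp)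
  have h1 : HasDerivAt (fun s => fderiv ℝ φ (s, x)) (fderiv ℝ (fderiv ℝ φ) (t, x) (1, 0)) t := by
    have hc : HasDerivAt (fun s : ℝ => (s, x)) ((1 : ℝ), (0 : E)) t :=
      (hasDerivAt_id t).prodMk (hasDerivAt_const t x)
    exact hd.hasFDerivAt.comp_hasDerivAt t hc
  have h2 : HasDerivAt (fun s => fderiv ℝ φ (s, x) (0, ξ))
      (fderiv ℝ (fderiv ℝ φ) (t, x) (1, 0) (0, ξ)) t := by
    simpa using h1.clm_apply (hasDerivAt_const t ((0 : ℝ), ξ))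
  convert h2 using 1
  -- Symmetry of the second derivative, available because the flow is `C²`, exchanges time and
  -- space: what is left is the spatial derivative of `∂φ/∂t = X ∘ φ`.
  rw [hsymm (1, 0) (0, ξ)]
  have hy : HasFDerivAt (fun y : E => (t, y)) (ContinuousLinearMap.inr ℝ ℝ E) x :=
    hasFDerivAt_prodMk_right t x
  have h3 : HasFDerivAt (fun y => fderiv ℝ φ (t, y) (1, 0))
      (((fderiv ℝ (fderiv ℝ φ) (t, x)).comp (ContinuousLinearMap.inr ℝ ℝ E)).flip (1, 0)) x := by
    have := (hd.hasFDerivAt.comp x hy).clm_apply (hasFDerivAt_const ((1 : ℝ), (0 : E)) x)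
    simpa using this
  have h4 : (fun y => fderiv ℝ φ (t, y) (1, 0)) =ᶠ[𝓝 x] fun y => X (φ (t, y)) := by
    have hcont : ContinuousAt (fun y : E => (t, y)) x := hy.continuousAt
    filter_upwards [hflow, hcont.eventually hφd] with y hy1 hy2
    have hc : HasDerivAt (fun s : ℝ => (s, y)) ((1 : ℝ), (0 : E)) t :=
      (hasDerivAt_id t).prodMk (hasDerivAt_const t y)
    exact (hy2.hasFDerivAt.comp_hasDerivAt t hc).unique hy1
  have h5 : HasFDerivAt (fun y => X (φ (t, y)))
      ((fderiv ℝ X (φ (t, x))).comp ((fderiv ℝ φ (t, x)).comp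
        (ContinuousLinearMap.inr ℝ ℝ E))) x :=
    HasFDerivAt.comp x (g := X) hX.hasFDerivAt
      ((hφ.differentiableAt two_ne_zero).hasFDerivAt.comp x hy)
  have h6 := h3.unique (h5.congr_of_eventuallyEq h4)
  have := DFunLike.congr_fun h6 ξ
  simpa using this.symm

/-- A Hamiltonian flow preserves the symplectic form. -/
theorem flow_preserves_form {Ω : E → E [⋀^Fin 2]→L[ℝ] ℝ} {O : Set E} (hO : IsOpen O)
    (hw : DifferentiableOn ℝ Ω O) (hclosed : ∀ y ∈ O, extDeriv Ω y = 0) {X : E → E}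
    (hX : DifferentiableOn ℝ X O) {H : E → ℝ} (hH : ContDiffOn ℝ 2 H O)
    (hham : ∀ y ∈ O, ∀ w, Ω y ![X y, w] = -fderiv ℝ H y w)
    {φ : ℝ × E → E} {ε : ℝ} {N : Set E} (hN : IsOpen N)
    (hφ : ContDiffOn ℝ 2 φ (Ioo (-ε) ε ×ˢ N)) (hφ0 : ∀ x ∈ N, φ (0, x) = x)
    (hflow : ∀ x ∈ N, ∀ t ∈ Ioo (-ε) ε, φ (t, x) ∈ O ∧
        HasDerivAt (fun t => φ (t, x)) (X (φ (t, x))) t)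
    {x : E} (hx : x ∈ N) {t : ℝ} (ht : t ∈ Ioo (-ε) ε) (ξ η : E) :
    Ω (φ (t, x)) ![fderiv ℝ φ (t, x) (0, ξ), fderiv ℝ φ (t, x) (0, η)] = Ω x ![ξ, η] := by
  have hopen : IsOpen (Ioo (-ε) ε ×ˢ N) := isOpen_Ioo.prod hN
  have hu : ∀ s ∈ Ioo (-ε) ε, ∀ ζ : E, HasDerivAt (fun s => fderiv ℝ φ (s, x) (0, ζ))
      (fderiv ℝ X (φ (s, x)) (fderiv ℝ φ (s, x) (0, ζ))) s := by
    intro s hs ζ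
    refine hasDerivAt_fderiv_flow (hφ.contDiffAt (hopen.mem_nhds ⟨hs, hx⟩))
      (hX.differentiableAt (hO.mem_nhds (hflow x hx s hs).1)) ?_ ζ
    filter_upwards [hN.mem_nhds hx] with y hy
    exact (hflow y hy s hs).2
  have hq : ∀ s ∈ Ioo (-ε) ε, HasDerivAt (fun s => toBilin (Ω (φ (s, x)))
      (fderiv ℝ φ (s, x) (0, ξ)) (fderiv ℝ φ (s, x) (0, η))) 0 s := by
    intro s hs
    have hmem := hO.mem_nhds (hflow x hx s hs).1
    have hws := hw.differentiableAt hmem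
    have hB := (hasFDerivAt_toBilin hws.hasFDerivAt).differentiableAt.hasFDerivAt
    have h1 : HasDerivAt (fun s => toBilin (Ω (φ (s, x))))
        (fderiv ℝ (fun y => toBilin (Ω y)) (φ (s, x)) (X (φ (s, x)))) s :=
      HasFDerivAt.comp_hasDerivAt (F := E) (E := E →L[ℝ] E →L[ℝ] ℝ)
        (l := fun y => toBilin (Ω y)) (f := fun s => φ (s, x)) s hB (hflow x hx s hs).2
    have h2 := (h1.clm_apply (hu s hs ξ)).clm_apply (hu s hs η)
    have h3 := lieDeriv_hamiltonian_eq_zero hws (hclosed _ (mem_of_mem_nhds hmem))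
      (hX.differentiableAt hmem) (hH.contDiffAt hmem)
      (by filter_upwards [hmem] with y hy using hham y hy)
      (fderiv ℝ φ (s, x) (0, ξ)) (fderiv ℝ φ (s, x) (0, η))
    exact h2.congr_deriv h3
  have h0 : (0 : ℝ) ∈ Ioo (-ε) ε := ⟨by linarith [ht.1, ht.2], by linarith [ht.1, ht.2]⟩
  -- The pulled-back form is constant in time, so it can be compared with its value at time `0`,
  -- where the differential of the flow is the identity.
  have hconst := (convex_Ioo (-ε) ε).is_const_of_fderivWithin_eq_zero (𝕜 := ℝ)
    (f := fun s => toBilin (Ω (φ (s, x)))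
      (fderiv ℝ φ (s, x) (0, ξ)) (fderiv ℝ φ (s, x) (0, η)))
    (fun s hs => (hq s hs).differentiableAt.differentiableWithinAt)
    (fun s hs => by
      rw [fderivWithin_of_isOpen isOpen_Ioo hs]
      ext
      simpa using (hq s hs).deriv) ht h0
  have hid : ∀ ζ : E, fderiv ℝ φ (0, x) (0, ζ) = ζ := by
    intro ζ
    have hy : HasFDerivAt (fun y : E => ((0 : ℝ), y)) (ContinuousLinearMap.inr ℝ ℝ E) x :=
      hasFDerivAt_prodMk_right 0 x
    have hd : DifferentiableAt ℝ φ (0, x) :=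
      (hφ.contDiffAt (hopen.mem_nhds ⟨h0, hx⟩)).differentiableAt two_ne_zero
    have h1 := hd.hasFDerivAt.comp x hy
    have h2 : (φ ∘ fun y : E => ((0 : ℝ), y)) =ᶠ[𝓝 x] id := by
      filter_upwards [hN.mem_nhds hx] with y hy using hφ0 y hy
    have h3 := h1.unique ((hasFDerivAt_id x).congr_of_eventuallyEq h2)
    simpa using DFunLike.congr_fun h3 ζ
  simp only [hid, hφ0 x hx, toBilin_apply] at hconst
  exact hconst

end HamiltonianFlow

end HeatMonodromy
end

/-! ### Symplectic forms and Hamiltonian fields in charts of the manifold. -/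

noncomputable section

namespace HeatMonodromy

open Set

section

variable {M : Type*} [TopologicalSpace M] [ChartedSpace E4 M]

/-- The derivative of a map between manifolds modelled on normed spaces, with values in the
operators between the model spaces. -/
def derivE {E F : Type*} [NormedAddCommGroup E] [NormedSpace ℝ E] [NormedAddCommGroup F]
    [NormedSpace ℝ F] {M N : Type*} [TopologicalSpace M] [ChartedSpace E M] [TopologicalSpace N]
    [ChartedSpace F N] (φ : M → N) (x : M) : E →L[ℝ] F :=
  mfderiv 𝓘(ℝ, E) 𝓘(ℝ, F) φ x

/-- The symplectic form at a point, as a form on the model space. -/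
def SymplecticForm.formE (σ : SymplecticForm M) (x : M) : E4 [⋀^Fin 2]→L[ℝ] ℝ := σ.form x

/-- A Hamiltonian vector field, with values in the model space. -/
def SymplecticForm.hamE (σ : SymplecticForm M) (g : M → ℝ) (x : M) : E4 := σ.hamVec g x

theorem SymplecticForm.formE_hamE (σ : SymplecticForm M) (g : M → ℝ) (x : M) (w : E4) :
    σ.formE x ![σ.hamE g x, w] = -derivE g x w :=
  Classical.choose_spec (σ.exists_hamVec g x) w

theorem SymplecticForm.formE_swap (σ : SymplecticForm M) (x : M) (v w : E4) :
    σ.formE x ![v, w] = -σ.formE x ![w, v] := toBilin_swap (σ.formE x) v w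

theorem SymplecticForm.eq_zero_of_formE (σ : SymplecticForm M) (x : M) {v : E4}
    (h : ∀ w, σ.formE x ![v, w] = 0) : v = 0 := σ.nondegenerate x v h

theorem SymplecticForm.eq_of_formE (σ : SymplecticForm M) (x : M) {u v : E4}
    (h : ∀ w, σ.formE x ![u, w] = σ.formE x ![v, w]) : u = v := by
  rw [← sub_eq_zero]
  refine σ.eq_zero_of_formE x fun w => ?_
  have h1 := (toBilin (σ.formE x)).map_sub u v
  have h2 := DFunLike.congr_fun h1 w
  simp only [sub_apply, toBilin_apply] at h2
  rw [h2, h w, sub_self]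

/-- The expression of a Hamiltonian vector field in the preferred chart at `z`. -/
def SymplecticForm.chartField (σ : SymplecticForm M) (g : M → ℝ) (z : M) (y : E4) : E4 :=
  derivE (extChartAt (𝓡 4) z) ((extChartAt (𝓡 4) z).symm y)
    (σ.hamE g ((extChartAt (𝓡 4) z).symm y))

theorem chartForm_apply (z : M) (σ : SymplecticForm M) (y u v : E4) :
    chartForm σ.form z y ![u, v] = σ.formE ((extChartAt (𝓡 4) z).symm y)
      ![derivE (extChartAt (𝓡 4) z).symm y u, derivE (extChartAt (𝓡 4) z).symm y v] := by
  have h : chartForm σ.form z y ![u, v] = σ.formE ((extChartAt (𝓡 4) z).symm y)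
      (fun i => derivE (E := E4) (F := E4) (extChartAt (𝓡 4) z).symm y (![u, v] i)) := rfl
  rw [h]
  congr 1
  ext i : 1
  fin_cases i <;> rfl

end

section Chart

variable {M : Type*} [TopologicalSpace M] [ChartedSpace E4 M] [IsManifold (𝓡 4) ∞ M] (z : M)

instance isManifold_one : IsManifold (𝓡 4) 1 M := .of_le (n := ∞) (by simp)

theorem mdifferentiableAt_symm {y : E4} (hy : y ∈ (extChartAt (𝓡 4) z).target) :
    MDifferentiableAt 𝓘(ℝ, E4) (𝓡 4) (extChartAt (𝓡 4) z).symm y :=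
  (contMDiffOn_extChartAt_symm (n := 1) z).contMDiffAt
    ((isOpen_extChartAt_target z).mem_nhds hy) |>.mdifferentiableAt one_ne_zero

theorem mdifferentiableAt_chart {x : M} (hx : x ∈ (extChartAt (𝓡 4) z).source) :
    MDifferentiableAt (𝓡 4) 𝓘(ℝ, E4) (extChartAt (𝓡 4) z) x :=
  mdifferentiableAt_extChartAt (by rwa [← extChartAt_source (I := 𝓡 4)])

theorem derivE_chart_symm {y : E4} (hy : y ∈ (extChartAt (𝓡 4) z).target) (w : E4) :
    derivE (extChartAt (𝓡 4) z) ((extChartAt (𝓡 4) z).symm y)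
      (derivE (E := E4) (F := E4) (extChartAt (𝓡 4) z).symm y w) = w := by
  have h := mfderiv_extChartAt_comp_mfderivWithin_extChartAt_symm (I := 𝓡 4) (x := z) hy
  rw [ModelWithCorners.range_eq_univ, mfderivWithin_univ] at h
  exact DFunLike.congr_fun h w

theorem derivE_symm_chart {x : M} (hx : x ∈ (extChartAt (𝓡 4) z).source) (w : E4) :
    derivE (E := E4) (F := E4) (extChartAt (𝓡 4) z).symm (extChartAt (𝓡 4) z x)
      (derivE (extChartAt (𝓡 4) z) x w) = w := by
  have h := mfderivWithin_extChartAt_symm_comp_mfderiv_extChartAt' (I := 𝓡 4) (x := z) hx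
  rw [ModelWithCorners.range_eq_univ, mfderivWithin_univ] at h
  exact DFunLike.congr_fun h w

theorem chartForm_chart (σ : SymplecticForm M) {x : M}
    (hx : x ∈ (extChartAt (𝓡 4) z).source) (u v : E4) :
    chartForm σ.form z (extChartAt (𝓡 4) z x) ![derivE (extChartAt (𝓡 4) z) x u,
      derivE (extChartAt (𝓡 4) z) x v] = σ.formE x ![u, v] := by
  rw [chartForm_apply, derivE_symm_chart z hx, derivE_symm_chart z hx,
    (extChartAt (𝓡 4) z).left_inv hx]

theorem fderiv_comp_symm {g : M → ℝ} {y : E4} (hy : y ∈ (extChartAt (𝓡 4) z).target)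
    (hg : MDifferentiableAt (𝓡 4) 𝓘(ℝ, ℝ) g ((extChartAt (𝓡 4) z).symm y)) (w : E4) :
    fderiv ℝ (g ∘ (extChartAt (𝓡 4) z).symm) y w = derivE g ((extChartAt (𝓡 4) z).symm y)
      (derivE (E := E4) (F := E4) (extChartAt (𝓡 4) z).symm y w) := by
  rw [← mfderiv_eq_fderiv, mfderiv_comp y hg (mdifferentiableAt_symm z hy)]
  rfl

theorem contDiffOn_comp_symm {g : M → ℝ} (hg : ContMDiff (𝓡 4) 𝓘(ℝ, ℝ) ∞ g) :
    ContDiffOn ℝ ∞ (g ∘ (extChartAt (𝓡 4) z).symm) (extChartAt (𝓡 4) z).target :=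
  contMDiffOn_iff_contDiffOn.1 (hg.comp_contMDiffOn (contMDiffOn_extChartAt_symm z))

theorem chartForm_chartField (σ : SymplecticForm M) {g : M → ℝ}
    (hg : ContMDiff (𝓡 4) 𝓘(ℝ, ℝ) ∞ g) {y : E4} (hy : y ∈ (extChartAt (𝓡 4) z).target) (w : E4) :
    chartForm σ.form z y ![σ.chartField g z y, w] =
      -fderiv ℝ (g ∘ (extChartAt (𝓡 4) z).symm) y w := by
  have h1 := chartForm_chart z σ ((extChartAt (𝓡 4) z).map_target hy)
    (σ.hamE g ((extChartAt (𝓡 4) z).symm y))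
    (derivE (E := E4) (F := E4) (extChartAt (𝓡 4) z).symm y w)
  rw [(extChartAt (𝓡 4) z).right_inv hy, derivE_chart_symm z hy, σ.formE_hamE] at h1
  rw [fderiv_comp_symm z hy (hg.mdifferentiable (by simp) _)]
  exact h1

/-- In coordinates the symplectic form defines an isomorphism onto the dual space. -/
theorem isInvertible_toBilin_chartForm (σ : SymplecticForm M) {y : E4}
    (hy : y ∈ (extChartAt (𝓡 4) z).target) :
    (toBilin (chartForm σ.form z y)).IsInvertible := by
  have hinj : Function.Injective (toBilin (chartForm σ.form z y)).toLinearMap := by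
    rw [← LinearMap.ker_eq_bot, LinearMap.ker_eq_bot']
    intro v hv
    have h0 : derivE (E := E4) (F := E4) (extChartAt (𝓡 4) z).symm y v = 0 := by
      refine σ.eq_zero_of_formE ((extChartAt (𝓡 4) z).symm y) fun w => ?_
      have h1 := chartForm_apply z σ y v (derivE (E := E4) (F := E4) (extChartAt (𝓡 4) z)
        ((extChartAt (𝓡 4) z).symm y) w)
      have h2 := derivE_symm_chart z ((extChartAt (𝓡 4) z).map_target hy) w
      rw [(extChartAt (𝓡 4) z).right_inv hy] at h2
      rw [h2] at h1
      rw [← h1]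
      exact DFunLike.congr_fun hv _
    have h3 := derivE_chart_symm z hy v
    rw [h0, map_zero] at h3
    exact h3.symm
  have hfin : Module.finrank ℝ E4 = Module.finrank ℝ (E4 →L[ℝ] ℝ) := by
    rw [← (LinearMap.toContinuousLinearMap (𝕜 := ℝ) (E := E4) (F' := ℝ)).finrank_eq]
    exact (Subspace.dual_finrank_eq (K := ℝ) (V := E4)).symm
  exact ⟨(LinearEquiv.ofInjectiveOfFinrankEq _ hinj hfin).toContinuousLinearEquiv, by
    ext v w; rfl⟩

/-- In coordinates the field is `Ω⁻¹(-dg)`, and inversion of operators is smooth near an invertible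
one. -/
theorem contDiffOn_chartField (σ : SymplecticForm M) {g : M → ℝ}
    (hg : ContMDiff (𝓡 4) 𝓘(ℝ, ℝ) ∞ g) :
    ContDiffOn ℝ ∞ (σ.chartField g z) (extChartAt (𝓡 4) z).target := by
  have hopen := isOpen_extChartAt_target (I := 𝓡 4) z
  have h1 : ContDiffOn ℝ ∞ (fun y => (toBilin (chartForm σ.form z y)).inverse
      (-fderiv ℝ (g ∘ (extChartAt (𝓡 4) z).symm) y)) (extChartAt (𝓡 4) z).target := by
    intro y hy
    refine ContDiffAt.contDiffWithinAt ?_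
    have hB : ContDiffAt ℝ ∞ (fun y => toBilin (chartForm σ.form z y)) y := by
      have h := (σ.smooth z).contDiffAt (hopen.mem_nhds hy)
      have h' : ContDiff ℝ ∞ (toBilin (E := E4)) := by fun_prop
      exact h'.contDiffAt.comp y h
    obtain ⟨A, hA⟩ := isInvertible_toBilin_chartForm z σ hy
    have hinv : ContDiffAt ℝ ∞ ContinuousLinearMap.inverse (toBilin (chartForm σ.form z y)) := by
      rw [← hA]
      exact contDiffAt_map_inverse A
    have hd : ContDiffAt ℝ ∞ (fderiv ℝ (g ∘ (extChartAt (𝓡 4) z).symm)) y :=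
      ((contDiffOn_comp_symm z hg).contDiffAt (hopen.mem_nhds hy)).fderiv_right (by simp)
    exact (hinv.comp y hB).clm_apply hd.neg
  refine h1.congr fun y hy => ?_
  have h2 : toBilin (chartForm σ.form z y) (σ.chartField g z y) =
      -fderiv ℝ (g ∘ (extChartAt (𝓡 4) z).symm) y := by
    ext w
    exact chartForm_chartField z σ hg hy w
  rw [← h2, (isInvertible_toBilin_chartForm z σ hy).inverse_apply_eq.2 rfl]

/-- The trivialization of the tangent bundle at `z` sends the field to `σ.chartField g z`. Class
`C¹` is enough for the uniqueness of integral curves. -/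
theorem contMDiff_hamVec (σ : SymplecticForm M) {g : M → ℝ}
    (hg : ContMDiff (𝓡 4) 𝓘(ℝ, ℝ) ∞ g) :
    ContMDiff (𝓡 4) (𝓡 4).tangent 1
      (fun x => (⟨x, σ.hamVec g x⟩ : TangentBundle (𝓡 4) M)) := by
  intro z
  rw [Bundle.contMDiffAt_section]
  have h1 : ContMDiffAt (𝓡 4) 𝓘(ℝ, E4) 1
      (fun x => σ.chartField g z (extChartAt (𝓡 4) z x)) z := by
    have hc : ContDiffAt ℝ 1 (σ.chartField g z) (extChartAt (𝓡 4) z z) :=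
      ((contDiffOn_chartField z σ hg).contDiffAt ((isOpen_extChartAt_target z).mem_nhds
        (mem_extChartAt_target z))).of_le (by simp)
    exact hc.contMDiffAt.comp z (contMDiffAt_extChartAt (n := 1))
  refine h1.congr_of_eventuallyEq ?_
  filter_upwards [extChartAt_source_mem_nhds (I := 𝓡 4) z] with x hx
  have hx' : x ∈ (chartAt E4 z).source := by rwa [← extChartAt_source (I := 𝓡 4)]
  have h2 := DFunLike.congr_fun
    (TangentBundle.continuousLinearMapAt_trivializationAt (I := 𝓡 4) hx') (σ.hamVec g x)
  rw [SymplecticForm.chartField, (extChartAt (𝓡 4) z).left_inv hx]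
  refine Eq.trans ?_ h2
  rw [Bundle.Trivialization.continuousLinearMapAt_apply_of_mem]
  exact hx'

end Chart

end HeatMonodromy
end

/-! ### Local Hamiltonian flows on the manifold. -/

noncomputable section

namespace HeatMonodromy

open Set

section LocalFlow

variable {M : Type*} [TopologicalSpace M] [ChartedSpace E4 M] [IsManifold (𝓡 4) ∞ M]

/-- The local flow of a Hamiltonian vector field is `C¹` and preserves the symplectic form. -/
theorem exists_local_flow (σ : SymplecticForm M) {g : M → ℝ}
    (hg : ContMDiff (𝓡 4) 𝓘(ℝ, ℝ) ∞ g) (z : M) :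
    ∃ ε > 0, ∃ N : Set M, IsOpen N ∧ z ∈ N ∧ ∃ Φ : ℝ × M → M,
      (∀ x ∈ N, Φ (0, x) = x) ∧
      (∀ x ∈ N, IsMIntegralCurveOn (fun t => Φ (t, x)) (σ.hamVec g) (Ioo (-ε) ε)) ∧
      ContMDiffOn (𝓘(ℝ, ℝ).prod (𝓡 4)) (𝓡 4) 1 Φ (Ioo (-ε) ε ×ˢ N) ∧
      ∀ x ∈ N, ∀ t ∈ Ioo (-ε) ε, ∀ ξ η : E4,
        σ.formE (Φ (t, x)) ![derivE (fun x => Φ (t, x)) x ξ, derivE (fun x => Φ (t, x)) x η] =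
          σ.formE x ![ξ, η] := by
  let e := extChartAt (𝓡 4) z
  have hO : IsOpen e.target := isOpen_extChartAt_target z
  -- Two derivatives are kept because preservation of the form rests on the variational equation of
  -- a `C²` flow.
  have hX2 : ContDiffOn ℝ (2 : ℕ) (σ.chartField g z) e.target :=
    (contDiffOn_chartField z σ hg).of_le (WithTop.coe_le_coe.2 le_top)
  obtain ⟨φ, ε, hε, N, hN, hzN, hNO, hφ, hφ0, hflow⟩ :=
    exists_contDiffOn_flow two_ne_zero hO hX2 (mem_extChartAt_target z)
  have hN' : IsOpen (e.source ∩ e ⁻¹' N) :=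
    (continuousOn_extChartAt z).isOpen_inter_preimage (isOpen_extChartAt_source z) hN
  have hopen : IsOpen (Ioo (-ε) ε ×ˢ N) := isOpen_Ioo.prod hN
  refine ⟨ε, hε, e.source ∩ e ⁻¹' N, hN', ⟨mem_extChartAt_source z, hzN⟩,
    fun q => e.symm (φ (q.1, e q.2)), ?_, ?_, ?_, ?_⟩
  · rintro x ⟨hx, hxN⟩
    simp only [hφ0 _ hxN]
    exact e.left_inv hx
  · rintro x ⟨hx, hxN⟩ t ht
    obtain ⟨htO, htd⟩ := hflow _ hxN t ht
    have h1 : HasMFDerivAt 𝓘(ℝ, E4) (𝓡 4) e.symm (φ (t, e x))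
        (mfderiv 𝓘(ℝ, E4) (𝓡 4) e.symm (φ (t, e x))) :=
      (mdifferentiableAt_symm z htO).hasMFDerivAt
    have h2 := htd.hasFDerivAt.hasMFDerivAt
    have h3 := HasMFDerivAt.comp t h1 h2
    refine HasMFDerivAt.hasMFDerivWithinAt (h3.congr_mfderiv ?_)
    ext
    have h4 := derivE_symm_chart z (e.map_target htO) (σ.hamE g (e.symm (φ (t, e x))))
    change derivE (E := E4) (F := E4) e.symm (φ (t, e x))
      ((1 : ℝ) • σ.chartField g z (φ (t, e x))) = (1 : ℝ) • σ.hamE g (e.symm (φ (t, e x)))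
    rw [one_smul, one_smul]
    change derivE (E := E4) (F := E4) e.symm (e (e.symm (φ (t, e x)))) _ = _ at h4
    rwa [e.right_inv htO] at h4
  · have h1 : ContMDiffOn (𝓘(ℝ, ℝ).prod (𝓡 4)) 𝓘(ℝ, ℝ × E4) 1
        (fun q : ℝ × M => (q.1, e q.2)) (Ioo (-ε) ε ×ˢ (e.source ∩ e ⁻¹' N)) := by
      refine contMDiffOn_fst.prodMk_space ?_
      have h : ContMDiffOn (𝓡 4) 𝓘(ℝ, E4) 1 e e.source := by
        have := contMDiffOn_extChartAt (I := 𝓡 4) (n := 1) (x := z)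
        rwa [← extChartAt_source (I := 𝓡 4)] at this
      exact h.comp contMDiffOn_snd fun q hq => hq.2.1
    have h2 : ContMDiffOn 𝓘(ℝ, ℝ × E4) 𝓘(ℝ, E4) 1 φ (Ioo (-ε) ε ×ˢ N) :=
      (hφ.of_le (by norm_num)).contMDiffOn
    have h3 : ContMDiffOn 𝓘(ℝ, E4) (𝓡 4) 1 e.symm e.target := contMDiffOn_extChartAt_symm z
    exact (h3.comp h2 fun q hq => (hflow q.2 hq.2 q.1 hq.1).1).comp h1
      fun q hq => ⟨hq.1, hq.2.2⟩
  · rintro x ⟨hx, hxN⟩ t ht ξ η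
    have htO := (hflow _ hxN t ht).1
    have hd : DifferentiableAt ℝ φ (t, e x) :=
      (hφ.contDiffAt (x := (t, e x)) (hopen.mem_nhds ⟨ht, hxN⟩)).differentiableAt two_ne_zero
    have h1 : ∀ ζ : E4, derivE (E := E4) (F := E4) (fun x => e.symm (φ (t, e x))) x ζ =
        derivE (E := E4) (F := E4) e.symm (φ (t, e x))
          (fderiv ℝ φ (t, e x) (0, derivE (E := E4) (F := E4) e x ζ)) := by
      intro ζ
      have h2 := hd.hasFDerivAt.comp (e x) (hasFDerivAt_prodMk_right t (e x))
      have h3 := HasMFDerivAt.comp x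
        (HasMFDerivAt.comp (e x) (mdifferentiableAt_symm z htO).hasMFDerivAt h2.hasMFDerivAt)
        (mdifferentiableAt_chart z hx).hasMFDerivAt
      have h4 := DFunLike.congr_fun h3.mfderiv ζ
      exact h4
    simp only [h1]
    have h5 := chartForm_apply z σ (φ (t, e x))
      (fderiv ℝ φ (t, e x) (0, derivE (E := E4) (F := E4) e x ξ))
      (fderiv ℝ φ (t, e x) (0, derivE (E := E4) (F := E4) e x η))
    have h6 := flow_preserves_form hO ((σ.smooth z).differentiableOn (by simp)) (σ.closed z)
      (hX2.differentiableOn two_ne_zero)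
      ((contDiffOn_comp_symm z hg).of_le (WithTop.coe_le_coe.2 le_top))
      (fun y hy w => chartForm_chartField z σ hg hy w) hN hφ hφ0 hflow hxN ht
      (derivE (E := E4) (F := E4) e x ξ) (derivE (E := E4) (F := E4) e x η)
    exact (h5.symm.trans h6).trans (chartForm_chart z σ hx ξ η)

end LocalFlow

end HeatMonodromy
end

/-! ### Completeness of the Hamiltonian flows. -/

noncomputable section

namespace HeatMonodromy

open Set Function

section InvariantSet

variable {E : Type*} [NormedAddCommGroup E] [NormedSpace ℝ E]
  {H : Type*} [TopologicalSpace H] {I : ModelWithCorners ℝ E H}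
  {M : Type*} [TopologicalSpace M] [ChartedSpace H M] [IsManifold I 1 M] [T2Space M]
  [BoundarylessManifold I M]

theorem exists_pos_le_of_finset {ι : Type*} (t : Finset ι) {ε : ι → ℝ} (hε : ∀ i, 0 < ε i) :
    ∃ δ > 0, ∀ i ∈ t, δ ≤ ε i := by
  classical
  induction t using Finset.induction_on with
  | empty => exact ⟨1, one_pos, by simp⟩
  | insert a s _ ih =>
    obtain ⟨δ, hδ, h⟩ := ih
    refine ⟨min δ (ε a), lt_min hδ (hε a), fun z hz => ?_⟩
    rcases Finset.mem_insert.1 hz with rfl | hz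
    · exact min_le_right _ _
    · exact (min_le_left _ _).trans (h z hz)

/-- A vector field whose integral curves stay in an invariant set, and exist there for a uniform
time, has global integral curves through the points of this set. -/
theorem exists_isMIntegralCurve_of_invariant {v : (x : M) → TangentSpace I x}
    (hv : ContMDiff I I.tangent 1 (fun x => (⟨x, v x⟩ : TangentBundle I M))) {L : Set M}
    (hL : ∀ (γ : ℝ → M) (a : ℝ), IsMIntegralCurveOn γ v (Ioo (-a) a) → γ 0 ∈ L →
      ∀ t ∈ Ioo (-a) a, γ t ∈ L)
    {ε : ℝ} (hε : 0 < ε)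
    (h : ∀ x ∈ L, ∃ γ : ℝ → M, γ 0 = x ∧ IsMIntegralCurveOn γ v (Ioo (-ε) ε))
    {x : M} (hx : x ∈ L) : ∃ γ : ℝ → M, γ 0 = x ∧ IsMIntegralCurve γ v := by
  -- If the half-lengths of existence were bounded with supremum `asup`, the curve could be
  -- restarted at times `±(asup - ε / 2)`, where it is still in `L` by invariance. It would then
  -- live up to half-length `asup + ε / 2`.
  let s := {a | ∃ γ, γ 0 = x ∧ IsMIntegralCurveOn γ v (Ioo (-a) a)}
  suffices hbdd : ¬BddAbove s by
    rw [not_bddAbove_iff] at hbdd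
    rw [exists_isMIntegralCurve_iff_exists_isMIntegralCurveOn_Ioo hv]
    intro a
    obtain ⟨y, ⟨γ, hγ1, hγ2⟩, hlt⟩ := hbdd a
    exact ⟨γ, hγ1, hγ2.mono <| Ioo_subset_Ioo (neg_le_neg hlt.le) hlt.le⟩
  intro hbdd
  set asup := sSup s with hasup
  obtain ⟨a, ha, hlt⟩ := Real.add_neg_lt_sSup (⟨ε, h x hx⟩ : Set.Nonempty s) (ε := -(ε / 2))
    (by rw [neg_lt, neg_zero]; exact half_pos hε)
  rw [← hasup, ← sub_eq_add_neg] at hlt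
  obtain ⟨γ, h0, hγ⟩ := ha
  have hεle : ε ≤ asup := le_csSup hbdd (h x hx)
  have hinv := hL γ a hγ (by rw [h0]; exact hx)
  obtain ⟨γ1_aux, h1_aux, hγ1⟩ := h (γ (-(asup - ε / 2)))
    (hinv _ ⟨by linarith, by linarith⟩)
  rw [← isMIntegralCurveOn_comp_add (dt := asup - ε / 2)] at hγ1
  set γ1 := γ1_aux ∘ (· + (asup - ε / 2)) with γ1_def
  have heq1 : γ1 (-(asup - ε / 2)) = γ (-(asup - ε / 2)) := by simp [γ1_def, h1_aux]
  obtain ⟨γ2_aux, h2_aux, hγ2⟩ := h (γ (asup - ε / 2))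
    (hinv _ ⟨by linarith, by linarith⟩)
  rw [← isMIntegralCurveOn_comp_sub (dt := asup - ε / 2)] at hγ2
  set γ2 := γ2_aux ∘ (· - (asup - ε / 2)) with γ2_def
  have heq2 : γ2 (asup - ε / 2) = γ (asup - ε / 2) := by simp [γ2_def, h2_aux]
  simp_rw [Set.mem_Ioo, ← sub_lt_iff_lt_add, ← lt_sub_iff_add_lt, ← Set.mem_Ioo] at hγ1
  simp_rw [Set.mem_Ioo, lt_sub_iff_add_lt, sub_lt_iff_lt_add, ← Set.mem_Ioo] at hγ2
  set γ_ext : ℝ → M := piecewise (Ioo (-(asup + ε / 2)) a)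
    (piecewise (Ioo (-a) a) γ γ1) γ2 with γ_ext_def
  have heq_ext : γ_ext 0 = x := by
    rw [γ_ext_def, piecewise, if_pos ⟨by linarith, by linarith⟩, piecewise,
      if_pos ⟨by linarith, by linarith⟩, h0]
  suffices hext : IsMIntegralCurveOn γ_ext v (Ioo (-(asup + ε / 2)) (asup + ε / 2)) from
    (not_lt.mpr <| le_csSup hbdd ⟨γ_ext, heq_ext, hext⟩) <| lt_add_of_pos_right asup (half_pos hε)
  apply (isMIntegralCurveOn_piecewise (t₀ := asup - ε / 2) hv _ hγ2
      ⟨⟨by linarith, hlt⟩, ⟨by linarith, by linarith⟩⟩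
      (by rw [piecewise, if_pos ⟨by linarith, hlt⟩, ← heq2])).mono
    (Ioo_subset_Ioo_union_Ioo le_rfl (by linarith) (by linarith))
  exact (isMIntegralCurveOn_piecewise (t₀ := -(asup - ε / 2)) hv hγ hγ1
      ⟨⟨neg_lt_neg hlt, by linarith⟩, ⟨by linarith, by linarith⟩⟩ heq1.symm).mono
    (union_comm _ _ ▸ Ioo_subset_Ioo_union_Ioo (by linarith) (by linarith) le_rfl)

end InvariantSet

namespace IntegrableSystem

variable {M : Type*} [TopologicalSpace M] [ChartedSpace E4 M] (S : IntegrableSystem M)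

/-- The two integrals of the system. -/
def integral : Fin 2 → M → ℝ := ![S.h, S.K]

theorem contMDiff_integral (i : Fin 2) : ContMDiff (𝓡 4) 𝓘(ℝ, ℝ) ∞ (S.integral i) := by
  fin_cases i
  · exact S.smooth_h
  · exact S.smooth_K

theorem f_eq_iff (x y : M) : S.f x = S.f y ↔ ∀ i, S.integral i x = S.integral i y := by
  simp [f, integral, Fin.forall_fin_two]

/-- The Hamiltonian vector field of an integral, with values in the model space. -/
def ham (i : Fin 2) (x : M) : E4 := S.σ.hamE (S.integral i) x

theorem formE_ham (i : Fin 2) (x : M) (w : E4) :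
    S.σ.formE x ![S.ham i x, w] = -derivE (S.integral i) x w := S.σ.formE_hamE _ x w

theorem formE_ham_ham (i j : Fin 2) (x : M) : S.σ.formE x ![S.ham i x, S.ham j x] = 0 := by
  have h01 : S.σ.formE x ![S.ham 0 x, S.ham 1 x] = 0 := S.commute x
  fin_cases i <;> fin_cases j
  · have := S.σ.formE_swap x (S.ham 0 x) (S.ham 0 x)
    change S.σ.formE x ![S.ham 0 x, S.ham 0 x] = 0
    linarith
  · exact h01
  · have := S.σ.formE_swap x (S.ham 1 x) (S.ham 0 x)
    change S.σ.formE x ![S.ham 1 x, S.ham 0 x] = 0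
    linarith
  · have := S.σ.formE_swap x (S.ham 1 x) (S.ham 1 x)
    change S.σ.formE x ![S.ham 1 x, S.ham 1 x] = 0
    linarith

theorem derivE_integral_ham (i j : Fin 2) (x : M) :
    derivE (F := ℝ) (S.integral j) x (S.ham i x) = 0 := by
  have := S.formE_ham j x (S.ham i x)
  rw [S.formE_ham_ham] at this
  linarith

/-- Poisson commutation makes both derivatives along the curve vanish. This is the invariance of the
levels on which completeness rests. -/
theorem f_eq_of_curveOn {i : Fin 2} {γ : ℝ → M} {a : ℝ}
    (hγ : IsMIntegralCurveOn γ (S.σ.hamVec (S.integral i)) (Ioo (-a) a)) {t : ℝ}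
    (ht : t ∈ Ioo (-a) a) : S.f (γ t) = S.f (γ 0) := by
  rw [f_eq_iff]
  intro j
  have hd : ∀ s ∈ Ioo (-a) a, HasDerivAt (S.integral j ∘ γ) 0 s := by
    intro s hs
    have h1 := (hγ s hs).hasMFDerivAt (Ioo_mem_nhds hs.1 hs.2)
    have h2 := ((S.contMDiff_integral j).mdifferentiable (by simp) (γ s)).hasMFDerivAt
    have h3 : HasFDerivAt (S.integral j ∘ γ) (mfderiv (𝓡 4) 𝓘(ℝ, ℝ) (S.integral j) (γ s) ∘L
        ((1 : ℝ →L[ℝ] ℝ).smulRight (S.ham i (γ s))) : ℝ →L[ℝ] ℝ) s :=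
      (HasMFDerivAt.comp s h2 h1).hasFDerivAt
    refine h3.hasDerivAt.congr_deriv ?_
    have h4 := S.derivE_integral_ham i j (γ s)
    change derivE (F := ℝ) (S.integral j) (γ s) ((1 : ℝ) • S.ham i (γ s)) = 0
    rw [one_smul, h4]
  have h0 : (0 : ℝ) ∈ Ioo (-a) a := ⟨by linarith [ht.1, ht.2], by linarith [ht.1, ht.2]⟩
  exact (convex_Ioo (-a) a).is_const_of_fderivWithin_eq_zero (𝕜 := ℝ) (f := S.integral j ∘ γ)
    (fun s hs => (hd s hs).differentiableAt.differentiableWithinAt)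
    (fun s hs => by
      rw [fderivWithin_of_isOpen isOpen_Ioo hs]
      ext
      simpa using (hd s hs).deriv) ht h0

variable [IsManifold (𝓡 4) ∞ M] [T2Space M]

/-- A compact level is covered by finitely many flow boxes, so there is a common time of existence
on it, and integral curves do not leave the level. -/
theorem exists_curve (i : Fin 2) (x : M) : ∃ γ : ℝ → M, γ 0 = x ∧
    IsMIntegralCurve γ (S.σ.hamVec (S.integral i)) := by
  choose ε hε N hN hzN Φ hΦ0 hΦ _ _ using exists_local_flow S.σ (S.contMDiff_integral i)
  obtain ⟨t, -, ht⟩ := (S.compact_levels (S.f x)).elim_nhds_subcover N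
    fun z _ => (hN z).mem_nhds (hzN z)
  obtain ⟨δ, hδ, hδt⟩ := exists_pos_le_of_finset t hε
  refine exists_isMIntegralCurve_of_invariant (L := {y | S.f y = S.f x})
    (contMDiff_hamVec S.σ (S.contMDiff_integral i))
    (fun γ a hγ h0 t ht => (S.f_eq_of_curveOn hγ ht).trans h0) hδ (fun y hy => ?_) rfl
  obtain ⟨z, hz, hyz⟩ := mem_iUnion₂.1 (ht hy)
  exact ⟨fun t => Φ z (t, y), hΦ0 z y hyz, (hΦ z y hyz).mono
    (Ioo_subset_Ioo (neg_le_neg (hδt z hz)) (hδt z hz))⟩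

end IntegrableSystem

end HeatMonodromy
end

/-! ### The commuting flows and the action of the plane. -/

noncomputable section

namespace HeatMonodromy

open Set Function

section

variable {M : Type*} [TopologicalSpace M] [ChartedSpace E4 M]

theorem derivE_comp {φ ψ : M → M} {x : M} (hψ : MDifferentiableAt (𝓡 4) (𝓡 4) ψ (φ x))
    (hφ : MDifferentiableAt (𝓡 4) (𝓡 4) φ x) (v : E4) :
    derivE (E := E4) (F := E4) (fun x => ψ (φ x)) x v =
      derivE (E := E4) (F := E4) ψ (φ x) (derivE (E := E4) (F := E4) φ x v) :=
  DFunLike.congr_fun (mfderiv_comp x hψ hφ) v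

end

namespace IntegrableSystem

variable {M : Type*} [TopologicalSpace M] [ChartedSpace E4 M] (S : IntegrableSystem M)

/-- The infinitesimal action of the plane. -/
def infAct (x : M) : ℝ × ℝ →L[ℝ] E4 :=
  (ContinuousLinearMap.fst ℝ ℝ ℝ).smulRight (S.ham 0 x) +
    (ContinuousLinearMap.snd ℝ ℝ ℝ).smulRight (S.ham 1 x)

theorem infAct_apply (x : M) (w : ℝ × ℝ) :
    S.infAct x w = w.1 • S.ham 0 x + w.2 • S.ham 1 x := rfl

variable [IsManifold (𝓡 4) ∞ M]

theorem contMDiff_field (a : ℝ × ℝ) : ContMDiff (𝓡 4) (𝓡 4).tangent 1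
    (fun x => (⟨x, S.field a x⟩ : TangentBundle (𝓡 4) M)) := by
  have h0 := contMDiff_hamVec S.σ S.smooth_h
  have h1 := contMDiff_hamVec S.σ S.smooth_K
  exact (ContMDiff.const_smul_section h0).add_section (ContMDiff.const_smul_section h1)

variable [T2Space M]

/-- The flow of the Hamiltonian vector field of one of the two integrals. -/
def flow (i : Fin 2) (t : ℝ) (x : M) : M := Classical.choose (S.exists_curve i x) t

theorem flow_zero (i : Fin 2) (x : M) : S.flow i 0 x = x :=
  (Classical.choose_spec (S.exists_curve i x)).1

theorem isMIntegralCurve_flow (i : Fin 2) (x : M) :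
    IsMIntegralCurve (fun t => S.flow i t x) (S.σ.hamVec (S.integral i)) :=
  (Classical.choose_spec (S.exists_curve i x)).2

theorem eq_flow {i : Fin 2} {γ : ℝ → M} (hγ : IsMIntegralCurve γ (S.σ.hamVec (S.integral i)))
    (t : ℝ) : γ t = S.flow i t (γ 0) := by
  have h := isMIntegralCurve_Ioo_eq_of_contMDiff_boundaryless (t₀ := 0)
    (contMDiff_hamVec S.σ (S.contMDiff_integral i)) hγ (S.isMIntegralCurve_flow i (γ 0))
    (S.flow_zero i (γ 0)).symm
  exact congrFun h t

theorem flow_add (i : Fin 2) (s t : ℝ) (x : M) :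
    S.flow i (s + t) x = S.flow i s (S.flow i t x) := by
  have h := S.eq_flow ((S.isMIntegralCurve_flow i x).comp_add t) s
  simpa using h

theorem f_flow (i : Fin 2) (t : ℝ) (x : M) : S.f (S.flow i t x) = S.f x := by
  have h := S.f_eq_of_curveOn (a := |t| + 1) ((S.isMIntegralCurve_flow i x).isMIntegralCurveOn _)
    (t := t) ⟨by linarith [neg_abs_le t], by linarith [le_abs_self t]⟩
  rwa [S.flow_zero] at h

/-- Near `(t, x)` the flow is `C¹`, and its differential at `x` preserves the symplectic form. -/
def FlowRegularAt (i : Fin 2) (t : ℝ) (x : M) : Prop :=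
  ContMDiffAt (𝓘(ℝ, ℝ).prod (𝓡 4)) (𝓡 4) 1 (fun q : ℝ × M => S.flow i q.1 q.2) (t, x) ∧
  ∀ ξ η : E4, S.σ.formE (S.flow i t x) ![derivE (S.flow i t) x ξ, derivE (S.flow i t) x η] =
    S.σ.formE x ![ξ, η]

variable {S}

theorem FlowRegularAt.contMDiffAt {i : Fin 2} {t : ℝ} {x : M} (h : S.FlowRegularAt i t x) :
    ContMDiffAt (𝓡 4) (𝓡 4) 1 (S.flow i t) x :=
  ContMDiffAt.comp x h.1 (contMDiffAt_const.prodMk contMDiffAt_id)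

/-- The group law writes the flow near time `s + t` as the flow near time `s` after the fixed
time-`t` map, and both regularity and preservation of the form compose. -/
theorem FlowRegularAt.add {i : Fin 2} {s t : ℝ} {x : M} (hs : S.FlowRegularAt i s (S.flow i t x))
    (ht : S.FlowRegularAt i t x) : S.FlowRegularAt i (s + t) x := by
  have hfun : S.flow i (s + t) = fun y => S.flow i s (S.flow i t y) := funext (S.flow_add i s t)
  constructor
  · have h1 : ContMDiffAt (𝓘(ℝ, ℝ).prod (𝓡 4)) ((𝓘(ℝ, ℝ).prod (𝓡 4))) 1
        (fun q : ℝ × M => (q.1 - t, S.flow i t q.2)) (s + t, x) :=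
      (contMDiffAt_fst.sub contMDiffAt_const).prodMk
        (ContMDiffAt.comp (g := S.flow i t) (f := Prod.snd) (s + t, x) ht.contMDiffAt
          contMDiffAt_snd)
    have h2 : ContMDiffAt (𝓘(ℝ, ℝ).prod (𝓡 4)) (𝓡 4) 1 (fun q : ℝ × M => S.flow i q.1 q.2)
        (s + t - t, S.flow i t x) := by rw [add_sub_cancel_right]; exact hs.1
    refine (ContMDiffAt.comp (s + t, x) h2 h1).congr_of_eventuallyEq (.of_forall fun q => ?_)
    simp [← S.flow_add]
  · intro ξ η
    have hc := fun v => derivE_comp (hs.contMDiffAt.mdifferentiableAt one_ne_zero)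
      (ht.contMDiffAt.mdifferentiableAt one_ne_zero) v
    rw [hfun, hc, hc, hs.2, ht.2]

variable (S)

/-- Uniqueness of integral curves identifies the pointwise chosen global flow with the local flow of
`exists_local_flow`. -/
theorem exists_flowRegularAt (i : Fin 2) (z : M) : ∃ ε > 0, ∃ N : Set M, IsOpen N ∧ z ∈ N ∧
    ∀ x ∈ N, ∀ t ∈ Ioo (-ε) ε, S.FlowRegularAt i t x := by
  obtain ⟨ε, hε, N, hN, hzN, Φ, hΦ0, hΦ, hsm, hform⟩ :=
    exists_local_flow S.σ (S.contMDiff_integral i) z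
  have heq : ∀ x ∈ N, ∀ t ∈ Ioo (-ε) ε, S.flow i t x = Φ (t, x) := by
    intro x hx t ht
    exact isMIntegralCurveOn_Ioo_eqOn_of_contMDiff_boundaryless (t₀ := 0) (by simpa using hε)
      (contMDiff_hamVec S.σ (S.contMDiff_integral i))
      ((S.isMIntegralCurve_flow i x).isMIntegralCurveOn _) (hΦ x hx)
      ((S.flow_zero i x).trans (hΦ0 x hx).symm) ht
  refine ⟨ε, hε, N, hN, hzN, fun x hx t ht => ⟨?_, fun ξ η => ?_⟩⟩
  · have hnhds : Ioo (-ε) ε ×ˢ N ∈ 𝓝 (t, x) := (isOpen_Ioo.prod hN).mem_nhds ⟨ht, hx⟩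
    refine (hsm.contMDiffAt hnhds).congr_of_eventuallyEq ?_
    filter_upwards [hnhds] with q hq
    exact heq q.2 hq.2 q.1 hq.1
  · have hd : derivE (E := E4) (F := E4) (S.flow i t) x = derivE (fun x => Φ (t, x)) x := by
      refine Filter.EventuallyEq.mfderiv_eq ?_
      filter_upwards [hN.mem_nhds hx] with y hy
      exact heq y hy t ht
    rw [hd, heq x hx t ht]
    exact hform x hx t ht ξ η

/-- On the compact level of `x` regularity holds for a uniform time `δ`, so time `t` is reached by
`n` steps shorter than `δ`. -/
theorem flowRegularAt (i : Fin 2) (t : ℝ) (x : M) : S.FlowRegularAt i t x := by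
  choose ε hε N hN hzN hreg using S.exists_flowRegularAt i
  obtain ⟨s, -, hs⟩ := (S.compact_levels (S.f x)).elim_nhds_subcover N
    fun z _ => (hN z).mem_nhds (hzN z)
  obtain ⟨δ, hδ, hδs⟩ := exists_pos_le_of_finset s hε
  have hloc : ∀ y, S.f y = S.f x → ∀ r ∈ Ioo (-δ) δ, S.FlowRegularAt i r y := by
    intro y hy r hr
    obtain ⟨z, hz, hyz⟩ := mem_iUnion₂.1 (hs hy)
    exact hreg z y hyz r ⟨by linarith [hr.1, hδs z hz], by linarith [hr.2, hδs z hz]⟩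
  have hall : ∀ n : ℕ, ∀ r ∈ Ioo (-δ) δ, S.FlowRegularAt i (n * r) x := by
    intro n r hr
    induction n with
    | zero => simpa using hloc x rfl 0 (by simpa using hδ)
    | succ n ih =>
      have h := (hloc _ (S.f_flow i (n * r) x) r hr).add ih
      convert h using 1
      push_cast
      ring
  obtain ⟨n, hn⟩ := exists_nat_gt (|t| / δ)
  have hn0 : (0 : ℝ) < n := (div_nonneg (abs_nonneg t) hδ.le).trans_lt hn
  have h := hall n (t / n) (by
    rw [mem_Ioo, ← abs_lt, abs_div, abs_of_pos hn0, div_lt_iff₀ hn0]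
    rwa [div_lt_iff₀ hδ, mul_comm] at hn)
  rwa [mul_div_cancel₀ _ hn0.ne'] at h

theorem contMDiff_flow (i : Fin 2) : ContMDiff (𝓘(ℝ, ℝ).prod (𝓡 4)) (𝓡 4) 1
    (fun q : ℝ × M => S.flow i q.1 q.2) := fun q => (S.flowRegularAt i q.1 q.2).1

theorem contMDiff_flow_right (i : Fin 2) (t : ℝ) : ContMDiff (𝓡 4) (𝓡 4) 1 (S.flow i t) :=
  fun x => (S.flowRegularAt i t x).contMDiffAt

theorem mdifferentiable_flow_right (i : Fin 2) (t : ℝ) :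
    MDifferentiable (𝓡 4) (𝓡 4) (S.flow i t) :=
  (S.contMDiff_flow_right i t).mdifferentiable one_ne_zero

theorem formE_flow (i : Fin 2) (t : ℝ) (x : M) (ξ η : E4) :
    S.σ.formE (S.flow i t x) ![derivE (S.flow i t) x ξ, derivE (S.flow i t) x η] =
      S.σ.formE x ![ξ, η] := (S.flowRegularAt i t x).2 ξ η

theorem surjective_derivE_flow (i : Fin 2) (t : ℝ) (x : M) :
    Function.Surjective (derivE (E := E4) (F := E4) (S.flow i t) x) := by
  have hinj : Function.Injective (derivE (E := E4) (F := E4) (S.flow i t) x).toLinearMap := by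
    rw [← LinearMap.ker_eq_bot, LinearMap.ker_eq_bot']
    intro v hv
    refine S.σ.eq_zero_of_formE x fun w => ?_
    rw [← S.formE_flow i t x v w]
    have hv' : derivE (E := E4) (F := E4) (S.flow i t) x v = 0 := hv
    rw [hv']
    exact ((toBilin (S.σ.formE (S.flow i t x))).map_zero₂ _)
  exact LinearMap.injective_iff_surjective.1 hinj

/-- The flow of one integral preserves the Hamiltonian vector field of the other. -/
theorem derivE_flow_ham (i j : Fin 2) (t : ℝ) (x : M) :
    derivE (S.flow i t) x (S.ham j x) = S.ham j (S.flow i t x) := by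
  -- A Hamiltonian field is determined by the form and its function, and the flow preserves both.
  refine S.σ.eq_of_formE (S.flow i t x) fun w => ?_
  obtain ⟨η, rfl⟩ := S.surjective_derivE_flow i t x w
  rw [S.formE_flow, S.formE_ham, S.formE_ham]
  have h1 : (fun y => S.integral j (S.flow i t y)) = S.integral j :=
    funext fun y => (S.f_eq_iff _ _).1 (S.f_flow i t y) j
  have h2 := DFunLike.congr_fun (mfderiv_comp x
    ((S.contMDiff_integral j).mdifferentiable (by simp) (S.flow i t x))
    (S.mdifferentiable_flow_right i t x)) η
  have h3 : derivE (F := ℝ) (fun y => S.integral j (S.flow i t y)) x η =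
    derivE (F := ℝ) (S.integral j) (S.flow i t x)
      (derivE (E := E4) (F := E4) (S.flow i t) x η) := h2
  rw [h1] at h3
  rw [h3]

/-- By `derivE_flow_ham` the time-`s` map of one flow carries integral curves of the other field to
integral curves of that field; uniqueness concludes. -/
theorem flow_comm (i j : Fin 2) (s t : ℝ) (x : M) :
    S.flow i s (S.flow j t x) = S.flow j t (S.flow i s x) := by
  have h : IsMIntegralCurve (fun r => S.flow i s (S.flow j r x)) (S.σ.hamVec (S.integral j)) := by
    intro r
    have h1 := HasMFDerivAt.comp r (S.mdifferentiable_flow_right i s (S.flow j r x)).hasMFDerivAt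
      (S.isMIntegralCurve_flow j x r)
    refine h1.congr_mfderiv ?_
    ext
    change derivE (S.flow i s) (S.flow j r x) ((1 : ℝ) • S.ham j (S.flow j r x)) =
      (1 : ℝ) • S.ham j (S.flow i s (S.flow j r x))
    rw [one_smul, one_smul, S.derivE_flow_ham]
  have h2 := S.eq_flow h t
  simpa [S.flow_zero] using h2

/-- The action of the plane generated by the two commuting Hamiltonian flows. -/
def act (a : ℝ × ℝ) (x : M) : M := S.flow 0 a.1 (S.flow 1 a.2 x)

theorem act_zero (x : M) : S.act 0 x = x := by simp [act, S.flow_zero]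

theorem act_add (a b : ℝ × ℝ) (x : M) : S.act (a + b) x = S.act a (S.act b x) := by
  simp only [act, Prod.fst_add, Prod.snd_add, S.flow_add]
  rw [S.flow_comm 1 0]

theorem f_act (a : ℝ × ℝ) (x : M) : S.f (S.act a x) = S.f x := by
  simp only [act, S.f_flow]

theorem act_neg_act (a : ℝ × ℝ) (x : M) : S.act (-a) (S.act a x) = x := by
  rw [← S.act_add, neg_add_cancel, S.act_zero]

theorem contMDiff_act : ContMDiff (𝓘(ℝ, ℝ × ℝ).prod (𝓡 4)) (𝓡 4) 1
    (fun q : (ℝ × ℝ) × M => S.act q.1 q.2) := by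
  have h1 : ContMDiff (𝓘(ℝ, ℝ × ℝ).prod (𝓡 4)) 𝓘(ℝ, ℝ) 1 (fun q : (ℝ × ℝ) × M => q.1.1) :=
    contDiff_fst.contMDiff.comp contMDiff_fst
  have h2 : ContMDiff (𝓘(ℝ, ℝ × ℝ).prod (𝓡 4)) 𝓘(ℝ, ℝ) 1 (fun q : (ℝ × ℝ) × M => q.1.2) :=
    contDiff_snd.contMDiff.comp contMDiff_fst
  exact (S.contMDiff_flow 0).comp
    (h1.prodMk ((S.contMDiff_flow 1).comp (h2.prodMk contMDiff_snd)))

theorem continuous_act : Continuous (fun q : (ℝ × ℝ) × M => S.act q.1 q.2) :=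
  S.contMDiff_act.continuous

theorem contMDiff_act_left (x : M) : ContMDiff 𝓘(ℝ, ℝ × ℝ) (𝓡 4) 1 (fun a => S.act a x) :=
  S.contMDiff_act.comp (contMDiff_id.prodMk contMDiff_const)

theorem contMDiff_act_right (a : ℝ × ℝ) : ContMDiff (𝓡 4) (𝓡 4) 1 (S.act a) :=
  S.contMDiff_act.comp (contMDiff_const.prodMk contMDiff_id)

theorem formE_act (a : ℝ × ℝ) (x : M) (ξ η : E4) :
    S.σ.formE (S.act a x) ![derivE (S.act a) x ξ, derivE (S.act a) x η] =
      S.σ.formE x ![ξ, η] := by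
  have hc := fun v => derivE_comp (S.mdifferentiable_flow_right 0 a.1 (S.flow 1 a.2 x))
    (S.mdifferentiable_flow_right 1 a.2 x) v
  have h : S.act a = fun y => S.flow 0 a.1 (S.flow 1 a.2 y) := rfl
  rw [h, hc, hc, S.formE_flow, S.formE_flow]

theorem hasMFDerivAt_act_zero (x : M) :
    HasMFDerivAt 𝓘(ℝ, ℝ × ℝ) (𝓡 4) (fun a => S.act a x) 0
      (show ℝ × ℝ →L[ℝ] E4 from S.infAct x) := by
  have h0 := ((S.contMDiff_act_left x).mdifferentiable one_ne_zero 0).hasMFDerivAt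
  let L : ℝ × ℝ →L[ℝ] E4 := mfderiv 𝓘(ℝ, ℝ × ℝ) (𝓡 4) (fun a => S.act a x) 0
  have hx : S.act 0 x = x := S.act_zero x
  have h1 : L (1, 0) = S.ham 0 x := by
    have hl : HasMFDerivAt 𝓘(ℝ, ℝ) 𝓘(ℝ, ℝ × ℝ) (fun t : ℝ => ((t, 0) : ℝ × ℝ)) 0
        (ContinuousLinearMap.inl ℝ ℝ ℝ) :=
      (ContinuousLinearMap.inl ℝ ℝ ℝ).hasFDerivAt.hasMFDerivAt
    have h2 := HasMFDerivAt.comp (f := fun t : ℝ => ((t, 0) : ℝ × ℝ)) (0 : ℝ) h0 hl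
    have h3 := S.isMIntegralCurve_flow 0 x 0
    have h4 : (fun a => S.act a x) ∘ (fun t : ℝ => ((t, 0) : ℝ × ℝ)) =
      fun t => S.flow 0 t x := by
      ext t
      simp [act, S.flow_zero]
    rw [h4] at h2
    have h5 := DFunLike.congr_fun (hasMFDerivAt_unique h2 h3) (1 : ℝ)
    have h6 : L (1, 0) = (1 : ℝ) • S.ham 0 (S.flow 0 0 x) := h5
    rw [h6, one_smul, S.flow_zero]
  have h2 : L (0, 1) = S.ham 1 x := by
    have hl : HasMFDerivAt 𝓘(ℝ, ℝ) 𝓘(ℝ, ℝ × ℝ) (fun t : ℝ => ((0, t) : ℝ × ℝ)) 0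
        (ContinuousLinearMap.inr ℝ ℝ ℝ) :=
      (ContinuousLinearMap.inr ℝ ℝ ℝ).hasFDerivAt.hasMFDerivAt
    have h2 := HasMFDerivAt.comp (f := fun t : ℝ => ((0, t) : ℝ × ℝ)) (0 : ℝ) h0 hl
    have h3 := S.isMIntegralCurve_flow 1 x 0
    have h4 : (fun a => S.act a x) ∘ (fun t : ℝ => ((0, t) : ℝ × ℝ)) =
      fun t => S.flow 1 t x := by
      ext t
      simp [act, S.flow_zero]
    rw [h4] at h2
    have h5 := DFunLike.congr_fun (hasMFDerivAt_unique h2 h3) (1 : ℝ)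
    have h6 : L (0, 1) = (1 : ℝ) • S.ham 1 (S.flow 1 0 x) := h5
    rw [h6, one_smul, S.flow_zero]
  have h3 : L = S.infAct x := by
    ext w
    · simpa [infAct_apply] using congrFun (congrArg WithLp.ofLp h1) w
    · simpa [infAct_apply] using congrFun (congrArg WithLp.ofLp h2) w
  exact h0.congr_mfderiv h3

theorem hasMFDerivAt_act (a : ℝ × ℝ) (x : M) :
    HasMFDerivAt 𝓘(ℝ, ℝ × ℝ) (𝓡 4) (fun a => S.act a x) a
      (show ℝ × ℝ →L[ℝ] E4 from S.infAct (S.act a x)) := by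
  have h1 : HasMFDerivAt 𝓘(ℝ, ℝ × ℝ) 𝓘(ℝ, ℝ × ℝ) (fun b : ℝ × ℝ => b - a) a
      (ContinuousLinearMap.id ℝ (ℝ × ℝ)) := ((hasFDerivAt_id a).sub_const a).hasMFDerivAt
  have h2 : HasMFDerivAt 𝓘(ℝ, ℝ × ℝ) (𝓡 4) (fun b => S.act b (S.act a x)) (a - a)
      (show ℝ × ℝ →L[ℝ] E4 from S.infAct (S.act a x)) := by
    rw [sub_self]
    exact S.hasMFDerivAt_act_zero _
  have h3 := HasMFDerivAt.comp (f := fun b : ℝ × ℝ => b - a) a h2 h1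
  have h4 : (fun b => S.act b (S.act a x)) ∘ (fun b : ℝ × ℝ => b - a) = fun b => S.act b x := by
    ext b
    simp [← S.act_add]
  rw [h4] at h3
  exact h3

theorem isMIntegralCurve_act (a : ℝ × ℝ) (x : M) :
    IsMIntegralCurve (fun t : ℝ => S.act (t • a) x) (S.field a) := by
  intro t
  have h1 : HasMFDerivAt 𝓘(ℝ, ℝ) 𝓘(ℝ, ℝ × ℝ) (fun t : ℝ => t • a) t
      ((1 : ℝ →L[ℝ] ℝ).smulRight a) :=
    ((hasDerivAt_id t).smul_const a).hasFDerivAt.hasMFDerivAt.congr_mfderiv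
      (by rw [one_smul]; rfl)
  refine (HasMFDerivAt.comp t (S.hasMFDerivAt_act (t • a) x) h1).congr_mfderiv ?_
  ext
  change S.infAct (S.act (t • a) x) ((1 : ℝ) • a) = (1 : ℝ) • S.infAct (S.act (t • a) x) a
  rw [one_smul, one_smul]

theorem eq_act {a : ℝ × ℝ} {γ : ℝ → M} (hγ : IsMIntegralCurve γ (S.field a)) (t : ℝ) :
    γ t = S.act (t • a) (γ 0) := by
  have h := isMIntegralCurve_Ioo_eq_of_contMDiff_boundaryless (t₀ := 0)
    (S.contMDiff_field a) hγ (S.isMIntegralCurve_act a (γ 0)) (by simp [S.act_zero])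
  exact congrFun h t

/-- Since `t ↦ S.act (t • a) x` is the only integral curve of `S.field a` starting at `x`,
periodicity of a flow becomes a fixed-point condition for the action. -/
theorem isPeriod_iff (b a : ℝ × ℝ) : S.IsPeriod b a ↔ ∀ x, S.f x = b → S.act a x = x := by
  refine forall₂_congr fun x _ => ⟨?_, fun h => ?_⟩
  · rintro ⟨c, hc, h0, h1⟩
    have h := S.eq_act hc 1
    rw [h0, h1, one_smul] at h
    exact h.symm
  · exact ⟨_, S.isMIntegralCurve_act a x, by simp [S.act_zero], by simpa using h⟩

end IntegrableSystem

end HeatMonodromy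
end

/-! ### Local sections of the energy-momentum map and local freeness of the action. -/

noncomputable section

namespace HeatMonodromy

open Set Function Filter

namespace IntegrableSystem

variable {M : Type*} [TopologicalSpace M] [ChartedSpace E4 M] (S : IntegrableSystem M)

theorem contMDiff_f : ContMDiff (𝓡 4) 𝓘(ℝ, ℝ × ℝ) ∞ S.f := S.smooth_h.prodMk_space S.smooth_K

theorem continuous_f : Continuous S.f := S.contMDiff_f.continuous

theorem mdifferentiable_f : MDifferentiable (𝓡 4) 𝓘(ℝ, ℝ × ℝ) S.f :=
  S.contMDiff_f.mdifferentiable (by simp)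

/-- The differential of the energy-momentum map. -/
def df (x : M) : E4 →L[ℝ] ℝ × ℝ := derivE S.f x

theorem df_apply (x : M) (v : E4) :
    S.df x v = (derivE (F := ℝ) S.h x v, derivE (F := ℝ) S.K x v) := by
  have h1 : HasMFDerivAt (𝓡 4) 𝓘(ℝ, ℝ × ℝ) S.f x (S.df x) := (S.mdifferentiable_f x).hasMFDerivAt
  have h2 := HasMFDerivAt.comp x (hasFDerivAt_fst (𝕜 := ℝ) (p := S.f x)).hasMFDerivAt h1
  have h3 := HasMFDerivAt.comp x (hasFDerivAt_snd (𝕜 := ℝ) (p := S.f x)).hasMFDerivAt h1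
  exact Prod.ext (DFunLike.congr_fun h2.mfderiv v).symm (DFunLike.congr_fun h3.mfderiv v).symm

theorem isRegularPoint_iff (x : M) :
    IsRegularPoint S.h S.K x ↔ Function.Surjective (S.df x) := by
  have h : (S.df x : E4 → ℝ × ℝ) = fun v : E4 => (dif S.h x v, dif S.K x v) :=
    funext (S.df_apply x)
  rw [h]
  rfl

theorem formE_infAct (x : M) (a : ℝ × ℝ) (w : E4) :
    S.σ.formE x ![S.infAct x a, w] = -(a.1 * (S.df x w).1 + a.2 * (S.df x w).2) := by
  have h0 : S.σ.formE x ![S.ham 0 x, w] = -derivE (F := ℝ) S.h x w := S.formE_ham 0 x w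
  have h1 : S.σ.formE x ![S.ham 1 x, w] = -derivE (F := ℝ) S.K x w := S.formE_ham 1 x w
  rw [← toBilin_apply] at *
  rw [infAct_apply, S.df_apply, map_add, map_smul, map_smul, add_apply, smul_apply, smul_apply,
    h0, h1]
  simp
  ring

theorem formE_infAct_infAct (x : M) (a b : ℝ × ℝ) :
    S.σ.formE x ![S.infAct x a, S.infAct x b] = 0 := by
  have h : S.df x (S.infAct x b) = 0 := by
    rw [S.df_apply, infAct_apply]
    have h0 := fun i => S.derivE_integral_ham i 0 x
    have h1 := fun i => S.derivE_integral_ham i 1 x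
    change ∀ i, derivE (F := ℝ) S.h x (S.ham i x) = 0 at h0
    change ∀ i, derivE (F := ℝ) S.K x (S.ham i x) = 0 at h1
    simp [h0, h1]
  rw [S.formE_infAct, h]
  simp

/-- At a regular point there is `η` with `S.df x η = a`, and the form pairs `S.infAct x a` with `η`
to `-(a.1² + a.2²)`. -/
theorem eq_zero_of_infAct {x : M} (hx : IsRegularPoint S.h S.K x) {a : ℝ × ℝ}
    (ha : S.infAct x a = 0) : a = 0 := by
  obtain ⟨η, hη⟩ := (S.isRegularPoint_iff x).1 hx a
  have h := S.formE_infAct x a η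
  rw [ha, hη] at h
  have h0 : S.σ.formE x ![0, η] = 0 := (toBilin (S.σ.formE x)).map_zero₂ η
  rw [h0] at h
  exact Prod.ext (mul_self_eq_zero.1 (by nlinarith [mul_self_nonneg a.1, mul_self_nonneg a.2]))
    (mul_self_eq_zero.1 (by nlinarith [mul_self_nonneg a.1, mul_self_nonneg a.2]))

/-- A `C¹` section of the energy-momentum map, near a point of the plane. -/
def IsSectionAt (s : ℝ × ℝ → M) (b : ℝ × ℝ) : Prop :=
  ContMDiffAt 𝓘(ℝ, ℝ × ℝ) (𝓡 4) 1 s b ∧ ∀ᶠ c in 𝓝 b, S.f (s c) = c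

variable {S} in
theorem IsSectionAt.f_eq {s : ℝ × ℝ → M} {b : ℝ × ℝ} (h : S.IsSectionAt s b) : S.f (s b) = b :=
  h.2.self_of_nhds

variable {S} in
theorem IsSectionAt.df_mfderiv {s : ℝ × ℝ → M} {b : ℝ × ℝ} (h : S.IsSectionAt s b) (v : ℝ × ℝ) :
    S.df (s b) (derivE (E := ℝ × ℝ) (F := E4) s b v) = v := by
  have h1 := HasMFDerivAt.comp b (S.mdifferentiable_f (s b)).hasMFDerivAt
    (h.1.mdifferentiableAt one_ne_zero).hasMFDerivAt
  have h2 : HasMFDerivAt 𝓘(ℝ, ℝ × ℝ) 𝓘(ℝ, ℝ × ℝ) (S.f ∘ s) b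
      (ContinuousLinearMap.id ℝ (ℝ × ℝ)) :=
    ((hasFDerivAt_id b).congr_of_eventuallyEq h.2).hasMFDerivAt
  exact DFunLike.congr_fun (hasMFDerivAt_unique h1 h2) v

variable {S} in
theorem IsSectionAt.isRegularPoint {s : ℝ × ℝ → M} {b : ℝ × ℝ} (h : S.IsSectionAt s b) :
    IsRegularPoint S.h S.K (s b) :=
  (S.isRegularPoint_iff _).2 fun v => ⟨_, h.df_mfderiv v⟩

variable [IsManifold (𝓡 4) ∞ M]

variable {S} in
theorem IsSectionAt.eventually {s : ℝ × ℝ → M} {b : ℝ × ℝ} (h : S.IsSectionAt s b) :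
    ∀ᶠ c in 𝓝 b, S.IsSectionAt s c :=
  (contMDiffAt_iff_contMDiffAt_nhds (by simp) |>.1 h.1).and h.2.eventually_nhds

/-- Restricting `f`, read in a chart, to the image of a right inverse `R` of its differential gives
a map `k` of the plane whose derivative at `0` is the identity. The section is the local inverse of
`k` followed by `R`. -/
theorem exists_section {x : M} (hx : IsRegularPoint S.h S.K x) :
    ∃ s : ℝ × ℝ → M, S.IsSectionAt s (S.f x) ∧ s (S.f x) = x := by
  let e := extChartAt (𝓡 4) x
  have hxe : e.symm (e x) = x := e.left_inv (mem_extChartAt_source x)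
  let A : E4 →L[ℝ] ℝ × ℝ := fderiv ℝ (S.f ∘ e.symm) (e x)
  have hFs : ContDiffOn ℝ ∞ (S.f ∘ e.symm) e.target :=
    contMDiffOn_iff_contDiffOn.1 (S.contMDiff_f.comp_contMDiffOn (contMDiffOn_extChartAt_symm x))
  have hF : ContDiffAt ℝ 1 (S.f ∘ e.symm) (e x) :=
    (hFs.contDiffAt ((isOpen_extChartAt_target x).mem_nhds (mem_extChartAt_target x))).of_le
      (by simp)
  have hA : ∀ w, A (derivE (E := E4) (F := E4) e x w) = S.df x w := by
    intro w
    have h1 : A = (S.df (e.symm (e x))).comp (derivE (E := E4) (F := E4) e.symm (e x)) := by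
      have h2 := mfderiv_comp (e x) (S.mdifferentiable_f (e.symm (e x)))
        (mdifferentiableAt_symm x (mem_extChartAt_target x))
      rw [mfderiv_eq_fderiv] at h2
      exact h2
    rw [h1, hxe]
    exact congrArg (S.df x) (derivE_symm_chart x (mem_extChartAt_source x) w)
  have hAsurj : Function.Surjective A := by
    intro v
    obtain ⟨w, hw⟩ := (S.isRegularPoint_iff x).1 hx v
    exact ⟨_, (hA w).trans hw⟩
  obtain ⟨R, hR⟩ := A.exists_rightInverse_of_surjective (LinearMap.range_eq_top.2 hAsurj)
  have hRA : ∀ v, A (R v) = v := DFunLike.congr_fun hR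
  let k : ℝ × ℝ → ℝ × ℝ := fun v => S.f (e.symm (e x + R v))
  have hk : ContDiffAt ℝ 1 k 0 := by
    have h1 : ContDiffAt ℝ 1 (fun v => e x + R v) 0 := by fun_prop
    have h2 : ContDiffAt ℝ 1 (S.f ∘ e.symm) (e x + R 0) := by simpa using hF
    exact ContDiffAt.comp (0 : ℝ × ℝ) h2 h1
  have hk' : HasFDerivAt k ((ContinuousLinearEquiv.refl ℝ (ℝ × ℝ) : (ℝ × ℝ) →L[ℝ] ℝ × ℝ)) 0 := by
    have h1 : HasFDerivAt (fun v => e x + R v) R 0 := R.hasFDerivAt.const_add _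
    have h2 : HasFDerivAt (S.f ∘ e.symm) A (e x + R 0) := by
      simpa using (hF.differentiableAt one_ne_zero).hasFDerivAt
    refine (HasFDerivAt.comp (0 : ℝ × ℝ) h2 h1).congr_fderiv ?_
    rw [hR]
    rfl
  have hk0 : k 0 = S.f x := by simp [k, hxe]
  let κ := hk.localInverse hk' one_ne_zero
  have hκ : ContDiffAt ℝ 1 κ (S.f x) := by
    rw [← hk0]
    exact hk.to_localInverse hk' one_ne_zero
  have hκ0 : κ (S.f x) = 0 := by
    rw [← hk0]
    exact hk.localInverse_apply_image hk' one_ne_zero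
  have hκk : ∀ᶠ b in 𝓝 (S.f x), k (κ b) = b := by
    rw [← hk0]
    exact (hk.hasStrictFDerivAt' hk' one_ne_zero).eventually_right_inverse
  refine ⟨fun b => e.symm (e x + R (κ b)), ⟨?_, hκk⟩, by simp [hκ0, hxe]⟩
  have h1 : ContDiffAt ℝ 1 (fun b => e x + R (κ b)) (S.f x) := by fun_prop
  have h2 : ContMDiffAt 𝓘(ℝ, E4) (𝓡 4) 1 e.symm (e x + R (κ (S.f x))) := by
    rw [hκ0, map_zero, add_zero]
    exact (contMDiffOn_extChartAt_symm x).contMDiffAt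
      ((isOpen_extChartAt_target x).mem_nhds (mem_extChartAt_target x))
  exact ContMDiffAt.comp (S.f x) h2 h1.contMDiffAt

variable [T2Space M]

variable {S}

/-- The map `(a, b) ↦ (p + a) • s b` is a local diffeomorphism, if `p` fixes `s b₀`. -/
theorem IsSectionAt.exists_hasStrictFDerivAt {s : ℝ × ℝ → M} {b₀ p : ℝ × ℝ}
    (hs : S.IsSectionAt s b₀) (hp : S.act p (s b₀) = s b₀) :
    let G := fun q : (ℝ × ℝ) × (ℝ × ℝ) => extChartAt (𝓡 4) (s b₀) (S.act (p + q.1) (s q.2))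
    ContDiffAt ℝ 1 G (0, b₀) ∧ ∃ G' : ((ℝ × ℝ) × (ℝ × ℝ)) ≃L[ℝ] E4,
      HasFDerivAt G (G' : ((ℝ × ℝ) × (ℝ × ℝ)) →L[ℝ] E4) (0, b₀) := by
  intro G
  set x := s b₀ with hx
  let e := extChartAt (𝓡 4) x
  have hxe : e.symm (e x) = x := e.left_inv (mem_extChartAt_source x)
  let H : (ℝ × ℝ) × (ℝ × ℝ) → M := fun q => S.act (p + q.1) (s q.2)
  have hH0 : H (0, b₀) = x := by simp only [H, add_zero, ← hx, hp]
  have hH : ContMDiffAt 𝓘(ℝ, (ℝ × ℝ) × (ℝ × ℝ)) (𝓡 4) 1 H (0, b₀) := by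
    have h1 : ContMDiffAt 𝓘(ℝ, (ℝ × ℝ) × (ℝ × ℝ)) 𝓘(ℝ, ℝ × ℝ) 1
        (fun q : (ℝ × ℝ) × (ℝ × ℝ) => p + q.1) (0, b₀) :=
      (contDiff_const.add contDiff_fst).contMDiff.contMDiffAt
    have h2 : ContMDiffAt 𝓘(ℝ, (ℝ × ℝ) × (ℝ × ℝ)) (𝓡 4) 1
        (fun q : (ℝ × ℝ) × (ℝ × ℝ) => s q.2) (0, b₀) :=
      ContMDiffAt.comp (g := s) (0, b₀) hs.1 contDiff_snd.contMDiff.contMDiffAt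
    exact S.contMDiff_act.contMDiffAt.comp (0, b₀) (h1.prodMk h2)
  have hG : ContDiffAt ℝ 1 G (0, b₀) := by
    rw [← contMDiffAt_iff_contDiffAt]
    have h3 : ContMDiffAt (𝓡 4) 𝓘(ℝ, E4) 1 e (H (0, b₀)) := by
      rw [hH0]
      exact contMDiffAt_extChartAt
    exact h3.comp (0, b₀) hH
  refine ⟨hG, ?_⟩
  have hd := (hG.differentiableAt one_ne_zero).hasFDerivAt
  have hG0 : G (0, b₀) = e x := congrArg e hH0
  -- `f` is invariant under the action and inverts `s`, so `f` read in the chart, composed with `G`,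
  -- is the second projection. The kernel therefore lies in the first factor.
  have hsnd : ∀ w v, fderiv ℝ G (0, b₀) (w, v) = 0 → v = 0 := by
    intro w v hwv
    have hF : HasFDerivAt (S.f ∘ e.symm) (fderiv ℝ (S.f ∘ e.symm) (e x)) (G (0, b₀)) := by
      rw [hG0]
      have hFs : ContDiffOn ℝ ∞ (S.f ∘ e.symm) e.target :=
        contMDiffOn_iff_contDiffOn.1
          (S.contMDiff_f.comp_contMDiffOn (contMDiffOn_extChartAt_symm x))
      exact ((hFs.contDiffAt ((isOpen_extChartAt_target x).mem_nhds
        (mem_extChartAt_target x))).differentiableAt (by simp)).hasFDerivAt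
    have h1 := HasFDerivAt.comp (0, b₀) hF hd
    have h2 : HasFDerivAt ((S.f ∘ e.symm) ∘ G)
        (ContinuousLinearMap.snd ℝ (ℝ × ℝ) (ℝ × ℝ)) (0, b₀) := by
      refine hasFDerivAt_snd.congr_of_eventuallyEq ?_
      have hev1 : ∀ᶠ q in 𝓝 ((0 : ℝ × ℝ), b₀), H q ∈ e.source := by
        refine hH.continuousAt.eventually_mem ?_
        rw [hH0]
        exact extChartAt_source_mem_nhds x
      have hev2 : ∀ᶠ q in 𝓝 ((0 : ℝ × ℝ), b₀), S.f (s q.2) = q.2 :=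
        (continuous_snd.tendsto ((0 : ℝ × ℝ), b₀)).eventually hs.2
      filter_upwards [hev1, hev2] with q hq1 hq2
      change S.f (e.symm (e (H q))) = q.2
      rw [e.left_inv hq1]
      exact (S.f_act _ _).trans hq2
    have h3 := DFunLike.congr_fun (h1.unique h2) (w, v)
    rw [ContinuousLinearMap.comp_apply, hwv, map_zero] at h3
    exact h3.symm
  -- As `p` fixes `s b₀`, the differential along the first factor is the infinitesimal action, which
  -- is injective at a regular point.
  have hfst : ∀ w, fderiv ℝ G (0, b₀) (w, 0) = 0 → w = 0 := by
    intro w hw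
    have hd' : HasFDerivAt G (fderiv ℝ G (0, b₀))
      ((fun a : ℝ × ℝ => (a, b₀)) 0) := hd
    have h1 := HasFDerivAt.comp (f := fun a : ℝ × ℝ => (a, b₀)) (0 : ℝ × ℝ) hd'
      (hasFDerivAt_prodMk_left (𝕜 := ℝ) (0 : ℝ × ℝ) b₀)
    have hax : ∀ a, S.act (p + a) x = S.act a x := by
      intro a
      rw [add_comm, S.act_add, hp]
    have h0 : S.act 0 x = x := S.act_zero x
    have h2 : HasMFDerivAt 𝓘(ℝ, ℝ × ℝ) 𝓘(ℝ, E4) (G ∘ fun a : ℝ × ℝ => (a, b₀)) 0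
        ((derivE (E := E4) (F := E4) e x).comp (S.infAct x)) := by
      have he : HasMFDerivAt (𝓡 4) 𝓘(ℝ, E4) e (S.act 0 x) (derivE (E := E4) (F := E4) e x) := by
        rw [h0]
        exact (mdifferentiableAt_chart x (mem_extChartAt_source x)).hasMFDerivAt
      have h3 := HasMFDerivAt.comp (0 : ℝ × ℝ) he (S.hasMFDerivAt_act_zero x)
      refine h3.congr_of_eventuallyEq (.of_forall fun a => ?_)
      exact congrArg e (hax a)
    have h3 := DFunLike.congr_fun (h1.unique h2.hasFDerivAt) w
    have h4 : derivE (E := E4) (F := E4) e x (S.infAct x w) = 0 := h3.symm.trans hw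
    have h5 := derivE_symm_chart x (mem_extChartAt_source x) (S.infAct x w)
    change derivE (E := E4) (F := E4) e.symm (e x) (derivE (E := E4) (F := E4) e x _) = _ at h5
    rw [h4, map_zero] at h5
    exact S.eq_zero_of_infAct hs.isRegularPoint h5.symm
  have hinj : Function.Injective (fderiv ℝ G (0, b₀)).toLinearMap := by
    rw [← LinearMap.ker_eq_bot, LinearMap.ker_eq_bot']
    rintro ⟨w, v⟩ hwv
    obtain rfl := hsnd w v hwv
    obtain rfl := hfst w hwv
    rfl
  have hfin : Module.finrank ℝ ((ℝ × ℝ) × (ℝ × ℝ)) = Module.finrank ℝ E4 := by simp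
  exact ⟨(LinearEquiv.ofInjectiveOfFinrankEq _ hinj hfin).toContinuousLinearEquiv,
    hd.congr_fderiv (ContinuousLinearMap.ext fun _ => rfl)⟩

end IntegrableSystem

end HeatMonodromy
end

/-! ### Orbits over regular values and the period lattice. -/

noncomputable section

namespace HeatMonodromy

open Set Function Filter

namespace IntegrableSystem

variable {M : Type*} [TopologicalSpace M] [ChartedSpace E4 M] {S : IntegrableSystem M}
  [IsManifold (𝓡 4) ∞ M] [T2Space M]

theorem IsSectionAt.continuousAt_act {s : ℝ × ℝ → M} {b₀ : ℝ × ℝ} (hs : S.IsSectionAt s b₀)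
    (a : ℝ × ℝ) : ContinuousAt (fun q : (ℝ × ℝ) × (ℝ × ℝ) => S.act q.1 (s q.2)) (a, b₀) := by
  have h : ContinuousAt (fun q : (ℝ × ℝ) × (ℝ × ℝ) => s q.2) (a, b₀) :=
    ContinuousAt.comp (g := s) (f := Prod.snd) hs.1.continuousAt continuousAt_snd
  exact S.continuous_act.continuousAt.comp (continuousAt_fst.prodMk h)

theorem IsSectionAt.eventually_good {s : ℝ × ℝ → M} {b₀ p : ℝ × ℝ} (hs : S.IsSectionAt s b₀)
    (hp : S.act p (s b₀) = s b₀) : ∀ᶠ q in 𝓝 ((0 : ℝ × ℝ), b₀),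
      S.act (p + q.1) (s q.2) ∈ (extChartAt (𝓡 4) (s b₀)).source ∧ S.f (s q.2) = q.2 := by
  have h1 : ContinuousAt (fun q : (ℝ × ℝ) × (ℝ × ℝ) => S.act (p + q.1) (s q.2)) (0, b₀) := by
    have h := hs.continuousAt_act (p + 0)
    exact ContinuousAt.comp (f := fun q : (ℝ × ℝ) × (ℝ × ℝ) => (p + q.1, q.2)) (x := (0, b₀)) h
      (by fun_prop)
  refine (h1.eventually_mem ?_).and ((continuous_snd.tendsto ((0 : ℝ × ℝ), b₀)).eventually hs.2)
  simp only [add_zero, hp]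
  exact extChartAt_source_mem_nhds _

/-- The points near `s b₀` are obtained from the section by the action of small vectors. -/
theorem IsSectionAt.eventually_exists_act {s : ℝ × ℝ → M} {b₀ : ℝ × ℝ} (hs : S.IsSectionAt s b₀)
    {ε : ℝ} (hε : 0 < ε) : ∀ᶠ y in 𝓝 (s b₀), ∃ a, ‖a‖ < ε ∧ S.act a (s (S.f y)) = y := by
  obtain ⟨hG, G', hG'⟩ := hs.exists_hasStrictFDerivAt (S.act_zero _)
  have hstrict := hG.hasStrictFDerivAt' hG' one_ne_zero
  have hgood := hs.eventually_good (S.act_zero _)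
  have hsmall : ∀ᶠ q in 𝓝 ((0 : ℝ × ℝ), b₀), ‖q.1‖ < ε := by
    have h : Continuous fun q : (ℝ × ℝ) × (ℝ × ℝ) => ‖q.1‖ := by fun_prop
    exact h.continuousAt.eventually_lt continuousAt_const (by simpa using hε)
  have himage := image_mem_map (m := fun q : (ℝ × ℝ) × (ℝ × ℝ) =>
    extChartAt (𝓡 4) (s b₀) (S.act (0 + q.1) (s q.2))) (hgood.and hsmall)
  rw [hstrict.map_nhds_eq_of_equiv] at himage
  simp only [add_zero, S.act_zero] at himage
  filter_upwards [(continuousAt_extChartAt (I := 𝓡 4) (s b₀)).eventually himage,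
    extChartAt_source_mem_nhds (I := 𝓡 4) (s b₀)] with y hy hys
  obtain ⟨q, ⟨⟨hq1, hq2⟩, hq3⟩, hqy⟩ := hy
  have hqy' := (extChartAt (𝓡 4) (s b₀)).injOn hq1 hys hqy
  rw [zero_add] at hqy'
  refine ⟨q.1, hq3, ?_⟩
  rw [← hqy', S.f_act, hq2]

/-- The action is locally free, uniformly along a section. -/
theorem IsSectionAt.eventually_eq_zero {s : ℝ × ℝ → M} {b₀ : ℝ × ℝ} (hs : S.IsSectionAt s b₀) :
    ∀ᶠ q in 𝓝 ((0 : ℝ × ℝ), b₀), S.act q.1 (s q.2) = s q.2 → q.1 = 0 := by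
  obtain ⟨hG, G', hG'⟩ := hs.exists_hasStrictFDerivAt (S.act_zero _)
  have hstrict := hG.hasStrictFDerivAt' hG' one_ne_zero
  have h1 : ∀ᶠ q in 𝓝 ((0 : ℝ × ℝ), b₀), q ∈ (hstrict.toOpenPartialHomeomorph _).source :=
    (hstrict.toOpenPartialHomeomorph _).open_source.mem_nhds
      hstrict.mem_toOpenPartialHomeomorph_source
  have hc : Continuous (fun q : (ℝ × ℝ) × (ℝ × ℝ) => ((0 : ℝ × ℝ), q.2)) := by fun_prop
  have h2 := (hc.tendsto (0, b₀)).eventually h1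
  filter_upwards [h1, h2] with q hq1 hq2 hq
  -- If `q.1` fixes `s q.2`, then `q` and `(0, q.2)` have the same image under a map injective near
  -- `(0, b₀)`.
  have h3 := (hstrict.toOpenPartialHomeomorph _).injOn hq1 hq2 (by
    simp only [HasStrictFDerivAt.toOpenPartialHomeomorph_coe, zero_add, hq, S.act_zero])
  exact congrArg Prod.fst h3

/-- Periods can be continued to nearby orbits. -/
theorem IsSectionAt.exists_period {s : ℝ × ℝ → M} {b₀ p₀ : ℝ × ℝ} (hs : S.IsSectionAt s b₀)
    (hp₀ : S.act p₀ (s b₀) = s b₀) : ∃ p : ℝ × ℝ → ℝ × ℝ, ContDiffAt ℝ 1 p b₀ ∧ p b₀ = p₀ ∧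
      ∀ᶠ b in 𝓝 b₀, S.act (p b) (s b) = s b := by
  obtain ⟨hG, G', hG'⟩ := hs.exists_hasStrictFDerivAt hp₀
  set G := fun q : (ℝ × ℝ) × (ℝ × ℝ) => extChartAt (𝓡 4) (s b₀) (S.act (p₀ + q.1) (s q.2))
  let k : ℝ × ℝ → E4 := fun b => extChartAt (𝓡 4) (s b₀) (s b)
  have hk : ContDiffAt ℝ 1 k b₀ := by
    rw [← contMDiffAt_iff_contDiffAt]
    exact ContMDiffAt.comp b₀ (contMDiffAt_extChartAt (n := 1)) hs.1
  have hk0 : k b₀ = G (0, b₀) := by simp [k, G, hp₀]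
  let ψ := hG.localInverse hG' one_ne_zero
  have hψ : ContDiffAt ℝ 1 ψ (k b₀) := by
    rw [hk0]
    exact hG.to_localInverse hG' one_ne_zero
  have hψ0 : ψ (k b₀) = (0, b₀) := by
    rw [hk0]
    exact hG.localInverse_apply_image hG' one_ne_zero
  have hψG : ∀ᶠ y in 𝓝 (k b₀), G (ψ y) = y := by
    rw [hk0]
    exact (hG.hasStrictFDerivAt' hG' one_ne_zero).eventually_right_inverse
  have hψk : ContDiffAt ℝ 1 (fun b => ψ (k b)) b₀ := ContDiffAt.comp b₀ hψ hk
  have hgood := hs.eventually_good hp₀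
  rw [← hψ0] at hgood
  -- The local inverse solves `S.act (p₀ + a) (s c) = s b` for `(a, c)`; comparing the values of `f`
  -- then forces `c = b`.
  refine ⟨fun b => p₀ + (ψ (k b)).1, contDiffAt_const.add hψk.fst, by simp [hψ0], ?_⟩
  filter_upwards [hk.continuousAt.eventually hψG, hψk.continuousAt.eventually hgood,
    hs.1.continuousAt.eventually_mem (extChartAt_source_mem_nhds (I := 𝓡 4) (s b₀)), hs.2]
    with b hb1 hb2 hb3 hb4
  have h1 := (extChartAt (𝓡 4) (s b₀)).injOn hb2.1 hb3 hb1
  have h2 : (ψ (k b)).2 = b := by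
    rw [← hb2.2, ← S.f_act (p₀ + (ψ (k b)).1), h1, hb4]
  rwa [h2] at h1

theorem act_act_comm (a c : ℝ × ℝ) (x : M) : S.act a (S.act c x) = S.act c (S.act a x) := by
  rw [← S.act_add, ← S.act_add, add_comm]

theorem act_eq_self_iff_of_act {a c : ℝ × ℝ} {x : M} :
    S.act a (S.act c x) = S.act c x ↔ S.act a x = x := by
  constructor
  · intro h
    rw [act_act_comm] at h
    rw [← S.act_neg_act c (S.act a x), h, S.act_neg_act]
  · intro h
    rw [act_act_comm, h]

theorem isRegularPoint_act {x : M} (hx : IsRegularPoint S.h S.K x) (a : ℝ × ℝ) :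
    IsRegularPoint S.h S.K (S.act a x) := by
  rw [S.isRegularPoint_iff] at hx ⊢
  intro v
  obtain ⟨w, rfl⟩ := hx v
  have h1 := mfderiv_comp x (S.mdifferentiable_f (S.act a x))
    ((S.contMDiff_act_right a).mdifferentiable one_ne_zero x)
  have h2 : S.f ∘ S.act a = S.f := funext (S.f_act a)
  rw [h2] at h1
  exact ⟨_, (DFunLike.congr_fun h1 w).symm⟩

/-- Points near a regular point on the same level are in its orbit. -/
theorem eventually_mem_orbit {x : M} (hx : IsRegularPoint S.h S.K x) {ε : ℝ} (hε : 0 < ε) :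
    ∀ᶠ y in 𝓝 x, S.f y = S.f x → ∃ a, ‖a‖ < ε ∧ S.act a x = y := by
  obtain ⟨s, hs, hsx⟩ := S.exists_section hx
  have h := hs.eventually_exists_act hε
  rw [hsx] at h
  filter_upwards [h] with y hy hf
  rwa [hf, hsx] at hy

/-- A closed orbit of regular points is the whole level. -/
theorem exists_act_eq_of_isClosed {x : M} (hx : IsRegularPoint S.h S.K x)
    (hcl : IsClosed (range fun a => S.act a x)) {y : M} (hy : S.f y = S.f x) :
    ∃ a, S.act a x = y := by
  classical
  -- The indicator of the orbit is continuous on the level: the orbit is open there by local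
  -- transitivity and closed by hypothesis. Connectedness of the level concludes.
  let g : M → Bool := fun z => decide (z ∈ range fun a => S.act a x)
  have hg : ContinuousOn g {z | S.f z = S.f x} := by
    intro z hz
    by_cases hzx : z ∈ range fun a => S.act a x
    · obtain ⟨c, rfl⟩ := hzx
      refine (continuousWithinAt_const (b := true)).congr_of_eventuallyEq_of_mem ?_ hz
      filter_upwards [mem_nhdsWithin_of_mem_nhds
        (eventually_mem_orbit (isRegularPoint_act hx c) one_pos), self_mem_nhdsWithin] with y h1 h2
      obtain ⟨a, -, rfl⟩ := h1 (h2.trans hz.symm)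
      exact decide_eq_true ⟨a + c, S.act_add a c x⟩
    · refine (continuousWithinAt_const (b := false)).congr_of_eventuallyEq_of_mem ?_ hz
      filter_upwards [mem_nhdsWithin_of_mem_nhds (hcl.isOpen_compl.mem_nhds hzx)] with y h1
      exact decide_eq_false h1
  have h := (S.connected_levels (S.f x)).constant hg hy (show S.f x = S.f x from rfl)
  have h2 : g x = true := decide_eq_true ⟨0, S.act_zero x⟩
  rw [h2] at h
  exact of_decide_eq_true h

/-- A limit point `y` of the orbit is on the same regular level, so the orbit of `y` contains a
neighbourhood of `y` in the level and meets the orbit of `x`. -/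
theorem isClosed_orbit {b : ℝ × ℝ} (hb : b ∈ S.base) {x : M} (hx : S.f x = b) :
    IsClosed (range fun a => S.act a x) := by
  refine isClosed_of_closure_subset fun y hy => ?_
  have hsub : (range fun a => S.act a x) ⊆ {z | S.f z = b} := by
    rintro _ ⟨a, rfl⟩
    exact (S.f_act a x).trans hx
  have hyb : S.f y = b :=
    closure_minimal hsub (isClosed_singleton.preimage S.continuous_f) hy
  obtain ⟨z, h1, h2⟩ := mem_closure_iff_nhds.1 hy _ (eventually_mem_orbit (hb.2 y hyb) one_pos)
  obtain ⟨a, -, rfl⟩ := h1 ((hsub h2).trans hyb.symm)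
  obtain ⟨c, hc⟩ := h2
  refine ⟨-a + c, ?_⟩
  change S.act c x = S.act a y at hc
  change S.act (-a + c) x = y
  rw [S.act_add, hc, S.act_neg_act]

theorem exists_act_eq {b : ℝ × ℝ} (hb : b ∈ S.base) {x y : M} (hx : S.f x = b) (hy : S.f y = b) :
    ∃ a, S.act a x = y :=
  exists_act_eq_of_isClosed (hb.2 x hx) (isClosed_orbit hb hx) (hy.trans hx.symm)

/-- The action on the level is transitive and commutative, so a vector that fixes one point fixes
all. -/
theorem isPeriod_iff_act_eq {b : ℝ × ℝ} (hb : b ∈ S.base) {x : M} (hx : S.f x = b) (a : ℝ × ℝ) :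
    S.IsPeriod b a ↔ S.act a x = x := by
  rw [S.isPeriod_iff]
  refine ⟨fun h => h x hx, fun h y hy => ?_⟩
  obtain ⟨c, rfl⟩ := exists_act_eq hb hx hy
  exact act_eq_self_iff_of_act.2 h

/-- Local transitivity and compactness of the level. The bound expresses that the stabilizer is
cocompact. -/
theorem exists_bounded_act_eq {b : ℝ × ℝ} (hb : b ∈ S.base) {x : M} (hx : S.f x = b) :
    ∃ R, ∀ y, S.f y = b → ∃ a, ‖a‖ ≤ R ∧ S.act a x = y := by
  refine IsCompact.induction_on (p := fun s => ∃ R, ∀ y ∈ s, ∃ a, ‖a‖ ≤ R ∧ S.act a x = y)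
    (S.compact_levels b) ⟨0, by simp⟩ ?_ ?_ ?_
  · rintro s t hst ⟨R, hR⟩
    exact ⟨R, fun y hy => hR y (hst hy)⟩
  · rintro s t ⟨R, hR⟩ ⟨R', hR'⟩
    refine ⟨max R R', fun y hy => ?_⟩
    rcases hy with hy | hy
    · obtain ⟨a, ha, h⟩ := hR y hy
      exact ⟨a, ha.trans (le_max_left _ _), h⟩
    · obtain ⟨a, ha, h⟩ := hR' y hy
      exact ⟨a, ha.trans (le_max_right _ _), h⟩
  · intro y hy
    obtain ⟨c, rfl⟩ := exists_act_eq hb hx hy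
    refine ⟨_, inter_mem self_mem_nhdsWithin (mem_nhdsWithin_of_mem_nhds
      (eventually_mem_orbit (hb.2 _ hy) one_pos)), 1 + ‖c‖, ?_⟩
    rintro z ⟨hz, hz2⟩
    obtain ⟨a, ha, rfl⟩ := hz2 (Eq.trans hz hy.symm)
    exact ⟨a + c, (norm_add_le _ _).trans (by linarith), S.act_add a c x⟩

/-- The period lattice, as the stabilizer of a point. -/
def stab (S : IntegrableSystem M) (x : M) : Submodule ℤ (ℝ × ℝ) :=
  AddSubgroup.toIntSubmodule
    { carrier := {a | S.act a x = x}
      zero_mem' := S.act_zero x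
      add_mem' := fun {a b} ha hb => by
        change S.act (a + b) x = x
        rw [S.act_add, show S.act b x = x from hb, show S.act a x = x from ha]
      neg_mem' := fun {a} ha => by
        change S.act (-a) x = x
        nth_rw 1 [← show S.act a x = x from ha]
        exact S.act_neg_act a x }

theorem mem_stab {a : ℝ × ℝ} {x : M} : a ∈ S.stab x ↔ S.act a x = x := Iff.rfl

theorem discreteTopology_stab {x : M} (hx : IsRegularPoint S.h S.K x) :
    DiscreteTopology (S.stab x) := by
  obtain ⟨s, hs, hsx⟩ := S.exists_section hx
  have h1 : ∀ᶠ a in 𝓝 (0 : ℝ × ℝ), S.act a x = x → a = 0 := by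
    have hc : Continuous (fun a : ℝ × ℝ => (a, S.f x)) := by fun_prop
    have h2 := (hc.tendsto 0).eventually hs.eventually_eq_zero
    simpa [hsx] using h2
  refine discreteTopology_of_isOpen_singleton_zero ?_
  refine isOpen_singleton_iff_nhds_eq_pure _ |>.2 (le_antisymm ?_ (pure_le_nhds _))
  rw [le_pure_iff, nhds_subtype_eq_comap]
  refine ⟨_, h1, ?_⟩
  rintro ⟨a, ha⟩ h
  exact Subtype.ext (h ha)

/-- Otherwise a nonzero linear form vanishes on the stabilizer. Modulo the stabilizer every vector
has norm at most `R`, so this form would be bounded on a line where it is not zero. -/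
theorem span_stab {b : ℝ × ℝ} (hb : b ∈ S.base) {x : M} (hx : S.f x = b) :
    Submodule.span ℝ (S.stab x : Set (ℝ × ℝ)) = ⊤ := by
  by_contra hne
  obtain ⟨ℓ, hℓ, hle⟩ := Submodule.exists_le_ker_of_lt_top _ (lt_top_iff_ne_top.2 hne)
  obtain ⟨R, hR⟩ := exists_bounded_act_eq hb hx
  obtain ⟨v, hv⟩ : ∃ v, ℓ v ≠ 0 := by
    by_contra! h
    exact hℓ (LinearMap.ext h)
  let L := LinearMap.toContinuousLinearMap ℓ
  have hbound : ∀ t : ℝ, |t * ℓ v| ≤ ‖L‖ * R := by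
    intro t
    obtain ⟨a, ha, h⟩ := hR (S.act (t • v) x) ((S.f_act _ x).trans hx)
    have h1 : t • v - a ∈ S.stab x := by
      rw [mem_stab, sub_eq_neg_add, S.act_add, ← h, S.act_neg_act]
    have h2 : ℓ (t • v - a) = 0 := hle (Submodule.subset_span h1)
    rw [map_sub, map_smul, sub_eq_zero, smul_eq_mul] at h2
    rw [h2]
    exact (L.le_opNorm a).trans (mul_le_mul_of_nonneg_left ha (norm_nonneg _))
  have h := hbound ((‖L‖ * R + 1) / ℓ v)
  rw [div_mul_cancel₀ _ hv] at h
  linarith [le_abs_self (‖L‖ * R + 1)]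

/-- The stabilizer of a point over the base is a lattice. -/
theorem exists_basis_stab {b : ℝ × ℝ} (hb : b ∈ S.base) {x : M} (hx : S.f x = b) :
    ∃ g : Fin 2 → ℝ × ℝ, LinearIndependent ℝ g ∧
      ∀ a, S.act a x = x ↔ ∃ n : Fin 2 → ℤ, a = ∑ i, (n i : ℝ) • g i := by
  have := discreteTopology_stab (hb.2 x hx)
  have : IsZLattice ℝ (S.stab x) := ⟨span_stab hb hx⟩
  have hfree := ZLattice.module_free ℝ (S.stab x)
  have hfin := ZLattice.module_finite ℝ (S.stab x)
  have hrank : Module.finrank ℤ (S.stab x) = 2 := by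
    rw [ZLattice.rank ℝ (S.stab x)]
    simp
  let B := Module.finBasisOfFinrankEq ℤ (S.stab x) hrank
  refine ⟨fun i => B i, ?_, fun a => ?_⟩
  · have h := (B.ofZLatticeBasis ℝ (S.stab x)).linearIndependent
    have h2 : (fun i => (B i : ℝ × ℝ)) = B.ofZLatticeBasis ℝ (S.stab x) := by
      ext i : 1
      simp
    rw [h2]
    exact h
  · rw [← mem_stab]
    constructor
    · intro ha
      refine ⟨fun i => B.repr ⟨a, ha⟩ i, ?_⟩
      have h := congrArg Subtype.val (B.sum_repr ⟨a, ha⟩)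
      simp only [Fin.sum_univ_two, Submodule.coe_add, Submodule.coe_smul] at h ⊢
      simp only [Int.cast_smul_eq_zsmul]
      exact h.symm
    · rintro ⟨n, rfl⟩
      simp only [Int.cast_smul_eq_zsmul]
      exact Submodule.sum_mem _ fun i _ => Submodule.smul_mem _ _ (B i).2

end IntegrableSystem

end HeatMonodromy
end

/-! ### Continuation of periods, action variables, and the return map in terms of periods. -/

noncomputable section

namespace HeatMonodromy

open Set Function Filter

/-- The determinant of two vectors of the plane. -/
def det2 (u v : ℝ × ℝ) : ℝ := u.1 * v.2 - u.2 * v.1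

theorem linearIndependent_iff_det2 (g : Fin 2 → ℝ × ℝ) :
    LinearIndependent ℝ g ↔ det2 (g 0) (g 1) ≠ 0 := by
  have hg : g = ![g 0, g 1] := by
    ext i : 1
    fin_cases i <;> rfl
  rw [hg, LinearIndependent.pair_iff]
  simp only [Matrix.cons_val_zero, Matrix.cons_val_one, det2]
  constructor
  · intro h hdet
    have h1 := h (g 1).2 (-(g 0).2) (Prod.ext (by simp; linarith) (by simp; ring))
    have h2 := h (g 1).1 (-(g 0).1) (Prod.ext (by simp; ring) (by simp; linarith))
    have h3 : g 0 = 0 := Prod.ext (neg_eq_zero.1 h2.2) (neg_eq_zero.1 h1.2)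
    exact one_ne_zero (h 1 0 (by simp [h3])).1
  · intro hdet s t hst
    have h1 : s * (g 0).1 + t * (g 1).1 = 0 := congrArg Prod.fst hst
    have h2 : s * (g 0).2 + t * (g 1).2 = 0 := congrArg Prod.snd hst
    constructor
    · refine (mul_eq_zero.1 (?_ : s * _ = 0)).resolve_right hdet
      linear_combination (g 1).2 * h1 - (g 1).1 * h2
    · refine (mul_eq_zero.1 (?_ : t * _ = 0)).resolve_right hdet
      linear_combination (g 0).1 * h2 - (g 0).2 * h1

theorem eq_comb_of_det2_ne_zero {u v : ℝ × ℝ} (h : det2 u v ≠ 0) (a : ℝ × ℝ) :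
    a = (det2 a v / det2 u v) • u + (det2 u a / det2 u v) • v := by
  simp only [det2] at *
  ext
  · simp only [Prod.fst_add, Prod.smul_fst, smul_eq_mul]
    rw [div_mul_eq_mul_div, div_mul_eq_mul_div, ← add_div, eq_div_iff h]
    ring
  · simp only [Prod.snd_add, Prod.smul_snd, smul_eq_mul]
    rw [div_mul_eq_mul_div, div_mul_eq_mul_div, ← add_div, eq_div_iff h]
    ring

theorem det2_comb (c : ℝ × ℝ) (u v : ℝ × ℝ) :
    det2 (c.1 • u + c.2 • v) v = c.1 * det2 u v ∧ det2 u (c.1 • u + c.2 • v) = c.2 * det2 u v := by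
  simp only [det2, Prod.fst_add, Prod.smul_fst, smul_eq_mul, Prod.snd_add, Prod.smul_snd]
  constructor <;> ring

theorem comb_injective {u v : ℝ × ℝ} (h : det2 u v ≠ 0) {c d : ℝ × ℝ}
    (hcd : c.1 • u + c.2 • v = d.1 • u + d.2 • v) : c = d := by
  have h1 := (det2_comb c u v)
  rw [hcd, (det2_comb d u v).1, (det2_comb d u v).2] at h1
  exact Prod.ext (mul_right_cancel₀ h h1.1.symm) (mul_right_cancel₀ h h1.2.symm)

/-- A fundamental domain, up to its boundary, of the integer lattice of the plane. -/
def unitBox : Set (ℝ × ℝ) := Icc (-(1 / 2)) (1 / 2) ×ˢ Icc (-(1 / 2)) (1 / 2)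

theorem exists_box_decomposition {u v : ℝ × ℝ} (h : det2 u v ≠ 0) (a : ℝ × ℝ) :
    ∃ c ∈ unitBox, ∃ n : Fin 2 → ℤ,
      a = (c.1 • u + c.2 • v) + ((n 0 : ℝ) • u + (n 1 : ℝ) • v) := by
  have key : ∀ x : ℝ, x - round x ∈ Icc (-(1 / 2) : ℝ) (1 / 2) := fun x => by
    rw [mem_Icc, ← abs_le]
    exact abs_sub_round x
  refine ⟨(det2 a v / det2 u v - round (det2 a v / det2 u v),
    det2 u a / det2 u v - round (det2 u a / det2 u v)), ⟨key _, key _⟩,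
    ![round (det2 a v / det2 u v), round (det2 u a / det2 u v)], ?_⟩
  conv_lhs => rw [eq_comb_of_det2_ne_zero h a]
  simp only [Matrix.cons_val_zero, Matrix.cons_val_one, sub_smul]
  abel

theorem eq_zero_of_mem_unitBox {c : ℝ × ℝ} (hc : c ∈ unitBox) {n : Fin 2 → ℤ}
    (h : c = ((n 0 : ℝ), (n 1 : ℝ))) : c = 0 := by
  have key : ∀ m : ℤ, (m : ℝ) ∈ Icc (-(1 / 2) : ℝ) (1 / 2) → m = 0 := by
    intro m hm
    have h1 : (-1 : ℝ) < m := by linarith [hm.1]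
    have h2 : (m : ℝ) < 1 := by linarith [hm.2]
    have h1' : (-1 : ℤ) < m := by exact_mod_cast h1
    have h2' : m < (1 : ℤ) := by exact_mod_cast h2
    omega
  subst h
  rw [key _ hc.1, key _ hc.2]
  simp

namespace IntegrableSystem

variable {M : Type*} [TopologicalSpace M] [ChartedSpace E4 M] {S : IntegrableSystem M}
  [IsManifold (𝓡 4) ∞ M] [T2Space M]

theorem act_intComb {x : M} {u v : ℝ × ℝ} (hu : S.act u x = x) (hv : S.act v x = x)
    (n : Fin 2 → ℤ) : S.act ((n 0 : ℝ) • u + (n 1 : ℝ) • v) x = x := by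
  rw [← mem_stab] at *
  rw [Int.cast_smul_eq_zsmul, Int.cast_smul_eq_zsmul]
  exact Submodule.add_mem _ (Submodule.smul_mem _ _ hu) (Submodule.smul_mem _ _ hv)

/-- An orbit with two independent periods is compact. -/
theorem isCompact_orbit {x : M} {u v : ℝ × ℝ} (hu : S.act u x = x) (hv : S.act v x = x)
    (h : det2 u v ≠ 0) : IsCompact (range fun a => S.act a x) := by
  have hK : IsCompact unitBox := isCompact_Icc.prod isCompact_Icc
  have hc : Continuous fun c : ℝ × ℝ => S.act (c.1 • u + c.2 • v) x :=
    S.continuous_act.comp (by fun_prop : Continuous fun c : ℝ × ℝ => (c.1 • u + c.2 • v, x))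
  convert hK.image hc using 1
  refine subset_antisymm ?_ ?_
  · rintro _ ⟨a, rfl⟩
    obtain ⟨c, hc, n, rfl⟩ := exists_box_decomposition h a
    refine ⟨c, hc, ?_⟩
    simp only [S.act_add _ ((n 0 : ℝ) • u + (n 1 : ℝ) • v), act_intComb hu hv]
  · rintro _ ⟨c, -, rfl⟩
    exact ⟨_, rfl⟩

/-- Two independent periods make the orbit of `s b` compact, hence closed, hence the whole level,
and regularity is constant along an orbit. -/
theorem IsSectionAt.mem_base {s : ℝ × ℝ → M} {b : ℝ × ℝ} (hs : S.IsSectionAt s b)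
    {u v : ℝ × ℝ} (hu : S.act u (s b) = s b) (hv : S.act v (s b) = s b) (h : det2 u v ≠ 0) :
    b ∈ S.base := by
  refine ⟨⟨s b, hs.f_eq⟩, fun x hx => ?_⟩
  obtain ⟨a, rfl⟩ := exists_act_eq_of_isClosed hs.isRegularPoint
    (isCompact_orbit hu hv h).isClosed (hx.trans hs.f_eq.symm)
  exact isRegularPoint_act hs.isRegularPoint a

/-- The periods, as functions on the base, are closed one-forms. -/
theorem IsSectionAt.period_symmetric {s : ℝ × ℝ → M} {b : ℝ × ℝ} (hs : S.IsSectionAt s b)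
    {p : ℝ × ℝ → ℝ × ℝ} {p' : ℝ × ℝ →L[ℝ] ℝ × ℝ} (hp : HasFDerivAt p p' b)
    (h : ∀ᶠ c in 𝓝 b, S.act (p c) (s c) = s c) (v w : ℝ × ℝ) :
    (p' v).1 * w.1 + (p' v).2 * w.2 = (p' w).1 * v.1 + (p' w).2 * v.2 := by
  have hfix : S.act (p b) (s b) = s b := h.self_of_nhds
  have hD := (S.contMDiff_act.mdifferentiable one_ne_zero (p b, s b)).hasMFDerivAt
  let D : (ℝ × ℝ) × E4 →L[ℝ] E4 := mfderiv (𝓘(ℝ, ℝ × ℝ).prod (𝓡 4)) (𝓡 4)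
    (fun q : (ℝ × ℝ) × M => S.act q.1 q.2) (p b, s b)
  let s' : ℝ × ℝ →L[ℝ] E4 := derivE (E := ℝ × ℝ) (F := E4) s b
  have hs' := (hs.1.mdifferentiableAt one_ne_zero).hasMFDerivAt
  -- The derivative of the identity `S.act (p c) (s c) = s c`. Splitting `D` into its partial
  -- derivatives `h2` and `h3` then gives `h4`.
  have h1 : ∀ v, D (p' v, s' v) = s' v := by
    intro v
    have h2 := HasMFDerivAt.comp b hD (hp.hasMFDerivAt.prodMk hs')
    have h3 := h2.congr_of_eventuallyEq (f₁ := s) (by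
      filter_upwards [h] with c hc
      exact hc.symm)
    exact DFunLike.congr_fun (hasMFDerivAt_unique h3 hs') v
  have h2 : ∀ a, D (a, 0) = S.infAct (s b) a := by
    intro a
    have hl := HasMFDerivAt.comp (f := fun a : ℝ × ℝ => (a, s b)) (p b) hD
      ((hasMFDerivAt_id (I := 𝓘(ℝ, ℝ × ℝ)) (p b)).prodMk (hasMFDerivAt_const (s b) (p b)))
    have hr := S.hasMFDerivAt_act (p b) (s b)
    rw [hfix] at hr
    exact DFunLike.congr_fun (hasMFDerivAt_unique hl hr) a
  have h3 : ∀ u, D (0, u) = derivE (E := E4) (F := E4) (S.act (p b)) (s b) u := by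
    intro u
    have hl := HasMFDerivAt.comp (f := fun x : M => (p b, x)) (s b) hD
      ((hasMFDerivAt_const (I := 𝓡 4) (p b) (s b)).prodMk (hasMFDerivAt_id (s b)))
    exact (DFunLike.congr_fun hl.mfderiv u).symm
  have h4 : ∀ v, derivE (E := E4) (F := E4) (S.act (p b)) (s b) (s' v) =
      s' v - S.infAct (s b) (p' v) := by
    intro v
    rw [eq_sub_iff_add_eq, ← h3, ← h2, ← map_add]
    simpa using h1 v
  -- The symplectic map `S.act (p b)` sends `s' v` to `s' v - S.infAct (s b) (p' v)`. When the form
  -- is expanded, the term with two `infAct` vanishes by commutation, and the cross terms give the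
  -- asserted symmetry.
  have h5 := S.formE_act (p b) (s b) (s' v) (s' w)
  rw [h4, h4, hfix] at h5
  have hdf : ∀ v, S.df (s b) (s' v) = v := hs.df_mfderiv
  have h6 := S.formE_infAct (s b) (p' v) (s' w)
  have h7 := S.formE_infAct (s b) (p' w) (s' v)
  have h8 := S.formE_infAct_infAct (s b) (p' v) (p' w)
  have h9 := S.σ.formE_swap (s b) (s' v) (S.infAct (s b) (p' w))
  rw [hdf] at h6 h7
  rw [← toBilin_apply] at h5 h6 h7 h8 h9
  rw [← toBilin_apply] at h5 h9
  simp only [map_sub, sub_apply] at h5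
  linarith

/-- Near a point of the base, a basis of the period lattice can be chosen as a `C¹` function. -/
theorem exists_local_periods {b₀ : ℝ × ℝ} (hb₀ : b₀ ∈ S.base) :
    ∃ (s : ℝ × ℝ → M) (p : Fin 2 → ℝ × ℝ → ℝ × ℝ), ∀ᶠ b in 𝓝 b₀,
      S.IsSectionAt s b ∧ (∀ i, ContDiffAt ℝ 1 (p i) b) ∧
      (∀ i, ∀ᶠ c in 𝓝 b, S.act (p i c) (s c) = s c) ∧ det2 (p 0 b) (p 1 b) ≠ 0 ∧ b ∈ S.base ∧
      ∀ a, S.IsPeriod b a ↔ ∃ n : Fin 2 → ℤ, a = ∑ i, (n i : ℝ) • p i b := by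
  obtain ⟨x, hx⟩ := hb₀.1
  obtain ⟨s, hs, hsx⟩ := S.exists_section (hb₀.2 x hx)
  rw [hx] at hs hsx
  obtain ⟨g, hg, hgper⟩ := exists_basis_stab hb₀ hx
  rw [linearIndependent_iff_det2] at hg
  have hgi : ∀ i, S.act (g i) (s b₀) = s b₀ := by
    intro i
    rw [hsx, hgper]
    exact ⟨Pi.single i 1, by fin_cases i <;> simp⟩
  choose p hp hp0 hpact using fun i => hs.exists_period (hgi i)
  have hdet : ∀ᶠ b in 𝓝 b₀, det2 (p 0 b) (p 1 b) ≠ 0 := by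
    have h0 := (hp 0).continuousAt
    have h1 := (hp 1).continuousAt
    have hc : ContinuousAt (fun b => det2 (p 0 b) (p 1 b)) b₀ := by
      unfold det2
      fun_prop
    refine hc.eventually_ne ?_
    rwa [hp0, hp0]
  -- This ensures that the continued periods generate the whole lattice and not a proper sublattice.
  -- Near `c = 0` it is local freeness; any other `c` in the box is no period over `b₀`, an open
  -- condition. Compactness of the box makes it uniform.
  have hbox : ∀ᶠ b in 𝓝 b₀, ∀ c ∈ unitBox,
      S.act (c.1 • p 0 b + c.2 • p 1 b) (s b) = s b → c.1 • p 0 b + c.2 • p 1 b = 0 := by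
    have hK : IsCompact unitBox := isCompact_Icc.prod isCompact_Icc
    refine hK.eventually_forall_of_forall_eventually fun c hc => ?_
    have hcont : ContinuousAt (fun z : (ℝ × ℝ) × (ℝ × ℝ) =>
        (z.2.1 • p 0 z.1 + z.2.2 • p 1 z.1, z.1)) (b₀, c) := by
      have h0 : ContinuousAt (fun z : (ℝ × ℝ) × (ℝ × ℝ) => p 0 z.1) (b₀, c) :=
        ContinuousAt.comp (f := Prod.fst) (hp 0).continuousAt continuousAt_fst
      have h1 : ContinuousAt (fun z : (ℝ × ℝ) × (ℝ × ℝ) => p 1 z.1) (b₀, c) :=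
        ContinuousAt.comp (f := Prod.fst) (hp 1).continuousAt continuousAt_fst
      fun_prop
    by_cases hc0 : c = 0
    · subst hc0
      have h1 := hs.eventually_eq_zero
      have h2 : ((0 : ℝ × ℝ).1 • p 0 b₀ + (0 : ℝ × ℝ).2 • p 1 b₀, b₀) = ((0 : ℝ × ℝ), b₀) := by
        simp
      rw [← h2] at h1
      exact hcont.eventually h1
    · have h1 : ContinuousAt (fun z : (ℝ × ℝ) × (ℝ × ℝ) =>
          S.act (z.2.1 • p 0 z.1 + z.2.2 • p 1 z.1) (s z.1)) (b₀, c) :=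
        ContinuousAt.comp (g := fun q : (ℝ × ℝ) × (ℝ × ℝ) => S.act q.1 (s q.2))
          (f := fun z : (ℝ × ℝ) × (ℝ × ℝ) => (z.2.1 • p 0 z.1 + z.2.2 • p 1 z.1, z.1))
          (hs.continuousAt_act _) hcont
      have h2 : ContinuousAt (fun z : (ℝ × ℝ) × (ℝ × ℝ) => s z.1) (b₀, c) :=
        ContinuousAt.comp (f := Prod.fst) (g := s) hs.1.continuousAt continuousAt_fst
      have hne : S.act (c.1 • p 0 b₀ + c.2 • p 1 b₀) (s b₀) ≠ s b₀ := by
        intro h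
        rw [hp0, hp0, hsx, hgper] at h
        obtain ⟨n, hn⟩ := h
        rw [Fin.sum_univ_two] at hn
        exact hc0 (eq_zero_of_mem_unitBox hc
          (comb_injective (d := ((n 0 : ℝ), (n 1 : ℝ))) hg hn))
      have h3 : ∀ᶠ z in 𝓝 (b₀, c),
          S.act (z.2.1 • p 0 z.1 + z.2.2 • p 1 z.1) (s z.1) ≠ s z.1 :=
        (h1.ne_iff_eventually_ne h2).1 hne
      filter_upwards [h3] with z hz h
      exact absurd h hz
  refine ⟨s, p, ?_⟩
  have hp1 : ∀ᶠ b in 𝓝 b₀, ∀ i, ContDiffAt ℝ 1 (p i) b :=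
    eventually_all.2 fun i => (hp i).eventually (by simp)
  have hact : ∀ᶠ b in 𝓝 b₀, ∀ i, ∀ᶠ c in 𝓝 b, S.act (p i c) (s c) = s c :=
    eventually_all.2 fun i => (hpact i).eventually_nhds
  filter_upwards [hs.eventually, hp1, hact, hdet, hbox] with b h1 h2 h3 h4 h5
  have h3' := fun i => (h3 i).self_of_nhds
  have hb := h1.mem_base (h3' 0) (h3' 1) h4
  refine ⟨h1, h2, h3, h4, hb, fun a => ?_⟩
  rw [isPeriod_iff_act_eq hb h1.f_eq]
  constructor
  · intro ha
    obtain ⟨c, hc, n, rfl⟩ := exists_box_decomposition h4 a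
    rw [S.act_add, act_intComb (h3' 0) (h3' 1)] at ha
    refine ⟨n, ?_⟩
    rw [h5 c hc ha, zero_add, Fin.sum_univ_two]
  · rintro ⟨n, rfl⟩
    rw [Fin.sum_univ_two]
    exact act_intComb (h3' 0) (h3' 1) n

/-- Action variables exist near each point of the base. -/
theorem exists_isActionPair {b₀ : ℝ × ℝ} (hb₀ : b₀ ∈ S.base) :
    ∃ r > 0, ∃ I : Fin 2 → ℝ × ℝ → ℝ, S.IsActionPair (Metric.ball b₀ r) I := by
  obtain ⟨s, p, h⟩ := exists_local_periods hb₀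
  obtain ⟨r, hr, hball⟩ := Metric.eventually_nhds_iff_ball.1 h
  let Ω : Fin 2 → ℝ × ℝ → ℝ × ℝ →L[ℝ] ℝ := fun i b =>
    (p i b).1 • ContinuousLinearMap.fst ℝ ℝ ℝ + (p i b).2 • ContinuousLinearMap.snd ℝ ℝ ℝ
  have hΩ : ∀ i, ∃ F : ℝ × ℝ → ℝ, ∀ b ∈ Metric.ball b₀ r, HasFDerivAt F (Ω i b) b := by
    intro i
    have hd : ∀ b ∈ Metric.ball b₀ r, HasFDerivAt (Ω i)
        (((ContinuousLinearMap.fst ℝ ℝ ℝ).comp (fderiv ℝ (p i) b)).smulRight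
          (ContinuousLinearMap.fst ℝ ℝ ℝ) +
        ((ContinuousLinearMap.snd ℝ ℝ ℝ).comp (fderiv ℝ (p i) b)).smulRight
          (ContinuousLinearMap.snd ℝ ℝ ℝ)) b := by
      intro b hb
      have h1 := (((hball b hb).2.1 i).differentiableAt one_ne_zero).hasFDerivAt
      exact (h1.fst.smul_const (ContinuousLinearMap.fst ℝ ℝ ℝ)).add
        (h1.snd.smul_const (ContinuousLinearMap.snd ℝ ℝ ℝ))
    -- Poincaré lemma on a ball, with closedness supplied by `period_symmetric`.
    refine (convex_ball b₀ r).exists_forall_hasFDerivAt_of_fderiv_symmetric Metric.isOpen_ball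
      (fun b hb => (hd b hb).differentiableAt.differentiableWithinAt) fun b hb v w => ?_
    rw [(hd b hb).fderiv]
    have h1 := (((hball b hb).2.1 i).differentiableAt one_ne_zero).hasFDerivAt
    exact (hball b hb).1.period_symmetric h1 ((hball b hb).2.2.1 i) v w
  choose I hI using hΩ
  have hgrad : ∀ b ∈ Metric.ball b₀ r, ∀ i, grad (I i) b = p i b := by
    intro b hb i
    rw [grad, (hI i b hb).fderiv]
    simp [Ω]
  refine ⟨r, hr, I, Metric.isOpen_ball, fun b hb => (hball b hb).2.2.2.2.1, fun i => ?_,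
    fun b hb => ?_⟩
  · have h0 : ContDiffOn ℝ (0 + 1) (I i) (Metric.ball b₀ r) := by
      rw [contDiffOn_succ_iff_fderiv_of_isOpen Metric.isOpen_ball]
      refine ⟨fun b hb => (hI i b hb).differentiableAt.differentiableWithinAt, by simp, ?_⟩
      rw [contDiffOn_zero]
      have hc : ContinuousOn (Ω i) (Metric.ball b₀ r) := by
        have h1 : ContinuousOn (p i) (Metric.ball b₀ r) := fun b hb =>
          ((hball b hb).2.1 i).continuousAt.continuousWithinAt
        fun_prop
      exact hc.congr fun b hb => (hI i b hb).fderiv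
    rwa [zero_add] at h0
  · rw [linearIndependent_iff_det2]
    simp only [hgrad b hb]
    exact ⟨(hball b hb).2.2.2.1, (hball b hb).2.2.2.2.2⟩

/-- The curve of `X_h` at time `t` meets the orbit `γ₁` at parameter `s` exactly when `secondCycle α
b s t` fixes the starting point. The return map thus becomes arithmetic in the period lattice. -/
theorem isReturn_iff {b : ℝ × ℝ} (hb : b ∈ S.base) (α : ℝ × ℝ → ℝ × ℝ) (Θ T : ℝ) :
    S.IsReturn α b Θ T ↔ 0 < T ∧ S.IsPeriod b (secondCycle α b Θ T) ∧
      ∀ t, 0 < t → t < T → ∀ s, ¬S.IsPeriod b (secondCycle α b s t) := by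
  have key : ∀ x, S.f x = b → ∀ t s, S.IsPeriod b (secondCycle α b s t) ↔
      S.act (t • (1, 0)) x = S.act (s • α b) x := by
    intro x hx t s
    rw [isPeriod_iff_act_eq hb hx, secondCycle, sub_eq_neg_add, S.act_add]
    constructor
    · intro h
      conv_rhs => rw [← h]
      rw [← S.act_add, add_neg_cancel, S.act_zero]
    · intro h
      rw [h, S.act_neg_act]
  refine and_congr_right fun hT => ⟨fun h => ?_, fun h x hx => ?_⟩
  · obtain ⟨x, hx⟩ := hb.1
    obtain ⟨c, d, hc, hc0, hd, hd0, hcd, hne⟩ := h x hx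
    have hc' := S.eq_act hc
    have hd' := S.eq_act hd
    rw [hc0] at hc'
    rw [hd0] at hd'
    refine ⟨(key x hx _ _).2 ?_, fun t ht0 ht s hs => hne t ht0 ht s ?_⟩
    · rw [← hc', hcd, hd']
    · rw [hc', hd']
      exact (key x hx _ _).1 hs
  · refine ⟨_, _, S.isMIntegralCurve_act (1, 0) x, by simp [S.act_zero],
      S.isMIntegralCurve_act (α b) x, by simp [S.act_zero], (key x hx _ _).1 h.1, ?_⟩
    intro t ht0 ht s hs
    exact h.2 t ht0 ht s ((key x hx _ _).2 hs)

end IntegrableSystem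

end HeatMonodromy
end

/-! ### Level two theta functions: heat equation and translation formulas. -/

noncomputable section

namespace HeatMonodromy

open Set Filter Complex

section Theta

/-- Level two is the Jacobi series at modulus `τ / 2` restricted to frequencies of the parity of
`j`, so the Gaussian estimates for `jacobiTheta₂_term` apply. -/
theorem theta_two (j : Fin 2) (τ z : ℂ) :
    theta 2 j τ z = ∑' n : ℤ, jacobiTheta₂_term (2 * n + (j : ℕ)) z (τ / 2) := by
  refine tsum_congr fun n => ?_
  rw [jacobiTheta₂_term]
  push_cast
  ring_nf

/-- The iterated derivatives with respect to `z` of the theta functions of level two. -/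
def thetaDeriv (k : ℕ) (j : Fin 2) (τ z : ℂ) : ℂ :=
  ∑' n : ℤ, (2 * Real.pi * I * ((2 * n + (j : ℕ) : ℤ) : ℂ)) ^ k *
    jacobiTheta₂_term (2 * n + (j : ℕ)) z (τ / 2)

theorem thetaDeriv_zero (j : Fin 2) (τ z : ℂ) : thetaDeriv 0 j τ z = theta 2 j τ z := by
  simp [thetaDeriv, theta_two]

theorem summable_thetaBound (j : Fin 2) (k : ℕ) (S : ℝ) {T : ℝ} (hT : 0 < T) :
    Summable fun n : ℤ => (|(2 * n + (j : ℕ) : ℤ)| ^ k : ℝ) *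
      Real.exp (-Real.pi * (T * ((2 * n + (j : ℕ) : ℤ) : ℝ) ^ 2 -
        2 * S * |(2 * n + (j : ℕ) : ℤ)|)) :=
  (summable_pow_mul_jacobiTheta₂_term_bound S hT k).comp_injective
    (i := fun n : ℤ => 2 * n + (j : ℕ)) fun m n h => by simpa using h

theorem hasDerivAt_term_fst (N : ℤ) (z τ : ℂ) :
    HasDerivAt (fun z => jacobiTheta₂_term N z τ)
      (2 * Real.pi * I * N * jacobiTheta₂_term N z τ) z := by
  have h : HasDerivAt (fun z : ℂ => 2 * Real.pi * I * N * z + Real.pi * I * N ^ 2 * τ)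
      (2 * Real.pi * I * N) z := by
    simpa using ((hasDerivAt_id z).const_mul (2 * Real.pi * I * N)).add_const
      (Real.pi * I * N ^ 2 * τ)
  refine h.cexp.congr_deriv ?_
  rw [jacobiTheta₂_term, mul_comm]

theorem hasDerivAt_term_snd (N : ℤ) (z τ : ℂ) :
    HasDerivAt (fun τ => jacobiTheta₂_term N z (τ / 2))
      (Real.pi * I * N ^ 2 / 2 * jacobiTheta₂_term N z (τ / 2)) τ := by
  have h : HasDerivAt (fun τ : ℂ => 2 * Real.pi * I * N * z + Real.pi * I * N ^ 2 * (τ / 2))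
      (Real.pi * I * N ^ 2 / 2) τ := by
    have h1 := (((hasDerivAt_id τ).div_const 2).const_mul (Real.pi * I * N ^ 2 : ℂ)).const_add
      (2 * Real.pi * I * N * z)
    refine h1.congr_deriv ?_
    ring
  refine h.cexp.congr_deriv ?_
  rw [jacobiTheta₂_term, mul_comm]

theorem norm_two_pi_I_mul (N : ℤ) : ‖2 * Real.pi * I * (N : ℂ)‖ = 2 * Real.pi * |N| := by
  simp [abs_of_pos Real.pi_pos]

/-- Termwise differentiation, justified by a summable bound uniform on a horizontal strip around
`z`. -/
theorem hasDerivAt_thetaDeriv (k : ℕ) (j : Fin 2) {τ : ℂ} (hτ : τ ∈ upperHalf) (z : ℂ) :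
    HasDerivAt (thetaDeriv k j τ) (thetaDeriv (k + 1) j τ z) z := by
  have hτ2 : 0 < (τ / 2).im := by
    have h : 0 < τ.im := hτ
    simpa using h
  let U : Set ℂ := {w | |w.im| < |z.im| + 1}
  have hU : IsOpen U := isOpen_lt (by fun_prop) continuous_const
  have hz : z ∈ U := by simp [U]
  let F : ℤ → ℂ → ℂ := fun n w => (2 * Real.pi * I * ((2 * n + (j : ℕ) : ℤ) : ℂ)) ^ k *
    jacobiTheta₂_term (2 * n + (j : ℕ)) w (τ / 2)
  have hF : ∀ n w, HasDerivAt (F n) ((2 * Real.pi * I * ((2 * n + (j : ℕ) : ℤ) : ℂ)) ^ (k + 1) *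
      jacobiTheta₂_term (2 * n + (j : ℕ)) w (τ / 2)) w := by
    intro n w
    refine ((hasDerivAt_term_fst _ w (τ / 2)).const_mul _).congr_deriv ?_
    ring
  have hsum := (summable_thetaBound j k (|z.im| + 1) hτ2).mul_left ((2 * Real.pi) ^ k)
  have hbound : ∀ n w, w ∈ U → ‖F n w‖ ≤ (2 * Real.pi) ^ k *
      ((|(2 * n + (j : ℕ) : ℤ)| ^ k : ℝ) * Real.exp (-Real.pi * ((τ / 2).im *
        ((2 * n + (j : ℕ) : ℤ) : ℝ) ^ 2 - 2 * (|z.im| + 1) * |(2 * n + (j : ℕ) : ℤ)|))) := by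
    intro n w hw
    rw [norm_mul, norm_pow, norm_two_pi_I_mul, mul_pow, mul_assoc]
    have h := norm_jacobiTheta₂_term_le hτ2 (le_of_lt hw) le_rfl (2 * n + (j : ℕ))
    gcongr
  have hd : ∀ n, DifferentiableOn ℂ (F n) U := fun n w _ =>
    (hF n w).differentiableAt.differentiableWithinAt
  have h1 := differentiableOn_tsum_of_summable_norm hsum hd hU hbound
  have h2 := hasSum_deriv_of_summable_norm hsum hd hU hbound hz
  have h3 := (h1.differentiableAt (hU.mem_nhds hz)).hasDerivAt
  rw [← h2.tsum_eq] at h3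
  refine h3.congr_deriv (tsum_congr fun n => (hF n z).deriv)

theorem iteratedDeriv_two_theta (j : Fin 2) {τ : ℂ} (hτ : τ ∈ upperHalf) (z : ℂ) :
    iteratedDeriv 2 (theta 2 j τ) z = thetaDeriv 2 j τ z := by
  have h0 : theta 2 j τ = thetaDeriv 0 j τ := funext fun z => (thetaDeriv_zero j τ z).symm
  have h1 : deriv (thetaDeriv 0 j τ) = thetaDeriv 1 j τ := funext fun z =>
    (hasDerivAt_thetaDeriv 0 j hτ z).deriv
  rw [iteratedDeriv_succ, iteratedDeriv_one, h0, h1, (hasDerivAt_thetaDeriv 1 j hτ z).deriv]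

theorem contDiff_theta (j : Fin 2) {τ : ℂ} (hτ : τ ∈ upperHalf) :
    ContDiff ℂ 2 (theta 2 j τ) := by
  have h0 : theta 2 j τ = thetaDeriv 0 j τ := funext fun z => (thetaDeriv_zero j τ z).symm
  rw [h0]
  have hd : Differentiable ℂ (thetaDeriv 0 j τ) := fun z =>
    (hasDerivAt_thetaDeriv 0 j hτ z).differentiableAt
  exact hd.contDiff

/-- The theta functions of level two satisfy the heat equation. -/
theorem hasDerivAt_theta (j : Fin 2) {τ : ℂ} (hτ : τ ∈ upperHalf) (z : ℂ) :
    HasDerivAt (fun τ' => theta 2 j τ' z)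
      (-(I / (8 * Real.pi)) * iteratedDeriv 2 (theta 2 j τ) z) τ := by
  have hτ0 : 0 < τ.im := hτ
  let U : Set ℂ := {w | τ.im / 2 < w.im}
  have hU : IsOpen U := isOpen_lt continuous_const (by fun_prop)
  have hτU : τ ∈ U := by
    change τ.im / 2 < τ.im
    linarith
  let F : ℤ → ℂ → ℂ := fun n w => jacobiTheta₂_term (2 * n + (j : ℕ)) z (w / 2)
  have hF : ∀ n w, HasDerivAt (F n) (Real.pi * I * ((2 * n + (j : ℕ) : ℤ) : ℂ) ^ 2 / 2 *
      jacobiTheta₂_term (2 * n + (j : ℕ)) z (w / 2)) w := fun n w => hasDerivAt_term_snd _ z w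
  have hsum := summable_thetaBound j 0 |z.im| (T := τ.im / 4) (by linarith)
  have hbound : ∀ n w, w ∈ U → ‖F n w‖ ≤
      ((|(2 * n + (j : ℕ) : ℤ)| ^ 0 : ℝ) * Real.exp (-Real.pi * (τ.im / 4 *
        ((2 * n + (j : ℕ) : ℤ) : ℝ) ^ 2 - 2 * |z.im| * |(2 * n + (j : ℕ) : ℤ)|))) := by
    intro n w hw
    rw [pow_zero, one_mul]
    refine norm_jacobiTheta₂_term_le (by linarith) le_rfl ?_ _
    have h : τ.im / 2 < w.im := hw
    have h2 : (w / 2).im = w.im / 2 := by simp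
    rw [h2]
    linarith
  have hd : ∀ n, DifferentiableOn ℂ (F n) U := fun n w _ =>
    (hF n w).differentiableAt.differentiableWithinAt
  have h1 := differentiableOn_tsum_of_summable_norm hsum hd hU hbound
  have h2 := hasSum_deriv_of_summable_norm hsum hd hU hbound hτU
  have h3 := (h1.differentiableAt (hU.mem_nhds hτU)).hasDerivAt
  rw [← h2.tsum_eq] at h3
  have h4 : (fun τ' => theta 2 j τ' z) = fun w => ∑' n, F n w :=
    funext fun w => theta_two j w z
  rw [h4]
  refine h3.congr_deriv ?_
  rw [iteratedDeriv_two_theta j hτ, thetaDeriv, ← tsum_mul_left]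
  -- With `N = 2n + j`, the heat equation for one term is `πi N² / 2 = -(i / 8π) (2πi N)²`.
  refine tsum_congr fun n => ?_
  rw [(hF n τ).deriv, ← mul_assoc]
  congr 1
  have hpi : (Real.pi : ℂ) ≠ 0 := by exact_mod_cast Real.pi_ne_zero
  field_simp
  rw [I_sq]
  ring

/-- The shift multiplies the term of frequency `N` by `(-1) ^ N`. It serves to separate the two
theta functions by parity. -/
theorem theta_add_half (j : Fin 2) (τ z : ℂ) :
    theta 2 j τ (z + 1 / 2) = (-1) ^ (j : ℕ) * theta 2 j τ z := by
  rw [theta_two, theta_two, ← tsum_mul_left]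
  refine tsum_congr fun n => ?_
  have h : 2 * Real.pi * I * ((2 * n + (j : ℕ) : ℤ) : ℂ) * (z + 1 / 2) +
      Real.pi * I * ((2 * n + (j : ℕ) : ℤ) : ℂ) ^ 2 * (τ / 2) =
      ((j : ℕ) * (Real.pi * I) + (n : ℤ) * (2 * Real.pi * I)) +
      (2 * Real.pi * I * ((2 * n + (j : ℕ) : ℤ) : ℂ) * z +
      Real.pi * I * ((2 * n + (j : ℕ) : ℤ) : ℂ) ^ 2 * (τ / 2)) := by
    push_cast
    ring
  rw [jacobiTheta₂_term, h, Complex.exp_add, Complex.exp_add, Complex.exp_int_mul_two_pi_mul_I,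
    mul_one, Complex.exp_nat_mul, Complex.exp_pi_mul_I]
  rfl

/-- The exponent of frequency `N = 2n + j` changes by `πi m N² / 2`, and `N² ≡ j` modulo `4` because
`j² = j`. All of `Q` comes from this. -/
theorem theta_add_int (j : Fin 2) (τ z : ℂ) (m : ℤ) :
    theta 2 j (τ + m) z = Complex.exp (I * (Real.pi / 2) * ((j : ℕ) * m)) * theta 2 j τ z := by
  rw [theta_two, theta_two, ← tsum_mul_left]
  refine tsum_congr fun n => ?_
  have hj : ((j : ℕ) : ℂ) ^ 2 = (j : ℕ) := by fin_cases j <;> simp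
  have h : 2 * Real.pi * I * ((2 * n + (j : ℕ) : ℤ) : ℂ) * z +
      Real.pi * I * ((2 * n + (j : ℕ) : ℤ) : ℂ) ^ 2 * ((τ + m) / 2) =
      (I * (Real.pi / 2) * ((j : ℕ) * m) +
        ((n ^ 2 * m + n * (j : ℕ) * m : ℤ) : ℂ) * (2 * Real.pi * I)) +
      (2 * Real.pi * I * ((2 * n + (j : ℕ) : ℤ) : ℂ) * z +
      Real.pi * I * ((2 * n + (j : ℕ) : ℤ) : ℂ) ^ 2 * (τ / 2)) := by
    push_cast
    linear_combination (Real.pi * I * m / 2) * hj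
  rw [jacobiTheta₂_term, h, Complex.exp_add, Complex.exp_add, Complex.exp_int_mul_two_pi_mul_I,
    mul_one]
  rfl

end Theta

end HeatMonodromy
end

/-! ### Flat sections of the theta bundle and the displacement homomorphism. -/

noncomputable section

namespace HeatMonodromy

open Set Filter Complex

/-- The Fourier coefficient of frequency `j` is `exp(πi j² τ / 2) ≠ 0`. The factor in `F` moves this
frequency to `0`, so that the coefficient is the mean over `[0, 1]`. -/
theorem exists_theta_ne_zero (j : Fin 2) {τ : ℂ} (hτ : τ ∈ upperHalf) :
    ∃ z, theta 2 j τ z ≠ 0 := by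
  by_contra! hz
  have hτ2 : 0 < (τ / 2).im := by
    have h : 0 < τ.im := hτ
    simpa using h
  let F : ℤ → ℝ → ℂ := fun n x => jacobiTheta₂_term (2 * n + (j : ℕ)) x (τ / 2) *
    Complex.exp (-(2 * Real.pi * I * (j : ℕ)) * x)
  have hFeq : ∀ n x, F n x = Complex.exp (Real.pi * I * ((2 * n + (j : ℕ) : ℤ) : ℂ) ^ 2 * (τ / 2)) *
      Complex.exp (((2 * n : ℤ) * (2 * Real.pi * I)) * x) := by
    intro n x
    simp only [F, jacobiTheta₂_term]
    rw [← Complex.exp_add, ← Complex.exp_add]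
    congr 1
    push_cast
    ring
  have hcont : ∀ n, Continuous (F n) := by
    intro n
    have h : F n = _ := funext (hFeq n)
    rw [h]
    fun_prop
  have hnorm : ∀ (n : ℤ) (x : ℝ), ‖F n x‖ = ‖jacobiTheta₂_term (2 * n + (j : ℕ)) 0 (τ / 2)‖ := by
    intro n x
    have h : ‖Complex.exp (((2 * n : ℤ) * (2 * Real.pi * I)) * x)‖ = 1 := by
      have h1 : ((2 * n : ℤ) * (2 * Real.pi * I)) * (x : ℂ) =
        ((2 * n * (2 * Real.pi) * x : ℝ) : ℂ) * I := by
        push_cast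
        ring
      rw [h1, Complex.norm_exp_ofReal_mul_I]
    rw [hFeq, norm_mul, h, mul_one, jacobiTheta₂_term]
    simp
  have hsum : Summable fun n : ℤ => ‖jacobiTheta₂_term (2 * n + (j : ℕ)) 0 (τ / 2)‖ :=
    ((summable_jacobiTheta₂_term_iff 0 (τ / 2)).2 hτ2).norm.comp_injective
      (i := fun n : ℤ => 2 * n + (j : ℕ)) fun m n h => by simpa using h
  have hint := intervalIntegral.hasSum_integral_of_dominated_convergence
    (μ := MeasureTheory.volume) (a := 0) (b := 1) (F := F) (f := fun _ => 0)
    (fun n _ => ‖jacobiTheta₂_term (2 * n + (j : ℕ)) 0 (τ / 2)‖)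
    (fun n => (hcont n).aestronglyMeasurable)
    (fun n => .of_forall fun x _ => (hnorm n x).le) (.of_forall fun x _ => hsum)
    (intervalIntegrable_const) (.of_forall fun x _ => by
      have h1 : Summable fun n => F n x := Summable.of_norm (by simpa only [hnorm] using hsum)
      have h2 : ∑' n, F n x = 0 := by
        have h3 := hz x
        rw [theta_two] at h3
        simp only [F]
        rw [tsum_mul_right, h3, zero_mul]
      rw [← h2]
      exact h1.hasSum)
  rw [intervalIntegral.integral_zero] at hint
  have hzero : ∀ n : ℤ, n ≠ 0 → ∫ x in (0 : ℝ)..1, F n x = 0 := by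
    intro n hn
    have hc : ((2 * n : ℤ) : ℂ) * (2 * Real.pi * I) ≠ 0 := by
      have h : ((2 * n : ℤ) : ℂ) ≠ 0 := by
        rw [Int.cast_ne_zero]
        omega
      exact mul_ne_zero h Complex.two_pi_I_ne_zero
    simp only [hFeq]
    rw [intervalIntegral.integral_const_mul, integral_exp_mul_complex hc]
    rw [Complex.ofReal_one, mul_one, Complex.exp_int_mul_two_pi_mul_I]
    simp
  have h0 := hint.unique (hasSum_single 0 hzero)
  have h1 : ∫ x in (0 : ℝ)..1, F 0 x =
      Complex.exp (Real.pi * I * ((j : ℕ) : ℂ) ^ 2 * (τ / 2)) := by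
    simp [hFeq]
  rw [h1] at h0
  exact Complex.exp_ne_zero _ h0.symm

theorem mem_thetaSpace {τ : ℂ} {g : ℂ → ℂ} (hg : g ∈ thetaSpace 2 τ) :
    ∃ c : Fin 2 → ℂ, g = ∑ j, c j • theta 2 j τ := by
  obtain ⟨c, hc⟩ := (Submodule.mem_span_range_iff_exists_fun ℂ).1 hg
  exact ⟨c, hc.symm⟩

theorem sum_theta_apply (c : Fin 2 → ℂ) (τ z : ℂ) :
    (∑ j, c j • theta 2 j τ) z = ∑ j, c j * theta 2 j τ z := by
  simp

theorem neg_one_pow_mul_add (i j : Fin 2) :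
    (1 : ℂ) + (-1) ^ (i : ℕ) * (-1) ^ (j : ℕ) = if i = j then 2 else 0 := by
  fin_cases i <;> fin_cases j <;> norm_num

/-- The even and odd parts of a combination of theta functions, under the half-period shift. -/
theorem sum_theta_shift (c : Fin 2 → ℂ) (i : Fin 2) (τ z : ℂ) :
    (∑ j, c j • theta 2 j τ) z + (-1) ^ (i : ℕ) * (∑ j, c j • theta 2 j τ) (z + 1 / 2) =
      2 * c i * theta 2 i τ z := by
  simp only [sum_theta_apply, theta_add_half, Finset.mul_sum, ← Finset.sum_add_distrib]
  rw [Finset.sum_eq_single i]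
  · have h := neg_one_pow_mul_add i i
    rw [if_pos rfl] at h
    linear_combination c i * theta 2 i τ z * h
  · intro j _ hj
    have h := neg_one_pow_mul_add i j
    rw [if_neg hj.symm] at h
    linear_combination c j * theta 2 j τ z * h
  · simp

theorem sum_theta_injective {τ : ℂ} (hτ : τ ∈ upperHalf) {c d : Fin 2 → ℂ}
    (h : ∑ j, c j • theta 2 j τ = ∑ j, d j • theta 2 j τ) : c = d := by
  ext i
  obtain ⟨z, hz⟩ := exists_theta_ne_zero i hτ
  have h1 := sum_theta_shift c i τ z
  rw [h, sum_theta_shift] at h1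
  have h2 := mul_right_cancel₀ hz h1
  exact (mul_left_cancel₀ two_ne_zero h2).symm

theorem isOpen_upperHalf : IsOpen upperHalf := isOpen_lt continuous_const Complex.continuous_im

theorem hasFDerivAt_theta (j : Fin 2) {τ : ℂ} (hτ : τ ∈ upperHalf) (z : ℂ) :
    HasFDerivAt (𝕜 := ℝ) (fun τ' => theta 2 j τ' z)
      ((ContinuousLinearMap.toSpanSingleton ℂ
        (-(I / (8 * Real.pi)) * iteratedDeriv 2 (theta 2 j τ) z)).restrictScalars ℝ) τ :=
  (hasDerivAt_theta j hτ z).hasFDerivAt.restrictScalars ℝ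

theorem iteratedDeriv_sum_theta (c : Fin 2 → ℂ) {τ : ℂ} (hτ : τ ∈ upperHalf) (z : ℂ) :
    iteratedDeriv 2 (∑ j, c j • theta 2 j τ) z =
      ∑ j, c j * iteratedDeriv 2 (theta 2 j τ) z := by
  rw [Fin.sum_univ_two, Fin.sum_univ_two, iteratedDeriv_add, iteratedDeriv_const_smul_field,
    iteratedDeriv_const_smul_field]
  · rfl
  · exact ((contDiff_theta 0 hτ).const_smul (c 0)).contDiffAt
  · exact ((contDiff_theta 1 hτ).const_smul (c 1)).contDiffAt

/-- The heat derivative of a combination of theta functions with variable coefficients. -/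
theorem heatDeriv_sum_theta {s : ℂ → ℂ → ℂ} {τ : ℂ} (hτ : τ ∈ upperHalf) {c : Fin 2 → ℂ → ℂ}
    (hc : ∀ j, DifferentiableAt ℝ (c j) τ) (hs : ∀ᶠ τ' in 𝓝 τ, s τ' = ∑ j, c j τ' • theta 2 j τ')
    (v z : ℂ) : heatDeriv 2 s τ v z = ∑ j, fderiv ℝ (c j) τ v * theta 2 j τ z := by
  have h1 : HasFDerivAt (𝕜 := ℝ) (fun τ' => ∑ j, c j τ' * theta 2 j τ' z)
      (∑ j, (c j τ • ((ContinuousLinearMap.toSpanSingleton ℂ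
        (-(I / (8 * Real.pi)) * iteratedDeriv 2 (theta 2 j τ) z)).restrictScalars ℝ) +
          theta 2 j τ z • fderiv ℝ (c j) τ)) τ :=
    HasFDerivAt.fun_sum fun j _ => (hc j).hasFDerivAt.mul (hasFDerivAt_theta j hτ z)
  have h2 := h1.congr_of_eventuallyEq (f₁ := fun τ' => s τ' z) (by
    filter_upwards [hs] with τ' h
    rw [h, sum_theta_apply])
  rw [heatDeriv, h2.fderiv, hs.self_of_nhds, iteratedDeriv_sum_theta _ hτ]
  -- Each theta function solves the heat equation, so the terms in which the coefficients are not
  -- differentiated cancel.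
  simp only [Fin.sum_univ_two, add_apply, smul_apply, smul_eq_mul,
    ContinuousLinearMap.coe_restrictScalars', ContinuousLinearMap.toSpanSingleton_apply]
  push_cast
  ring

theorem thetaFlat_sum_theta {O : Set ℂ} (hO : O ⊆ upperHalf) (c : Fin 2 → ℂ) :
    ThetaFlat 2 O (fun τ => ∑ j, c j • theta 2 j τ) := by
  intro τ hτ
  refine ⟨?_, fun z => ?_, fun v => ?_⟩
  · exact Submodule.sum_mem _ fun j _ =>
      Submodule.smul_mem _ _ (Submodule.subset_span (mem_range_self j))
  · simp only [sum_theta_apply]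
    have h := fun j => (hasFDerivAt_theta j (hO hτ) z).differentiableAt
    fun_prop (disch := assumption)
  · ext z
    rw [heatDeriv_sum_theta (hO hτ) (c := fun j _ => c j) (fun j => by fun_prop)
      (.of_forall fun _ => rfl)]
    simp

/-- The coefficients of a covariantly constant section have vanishing derivative. -/
theorem ThetaFlat.hasFDerivAt_coeff {O : Set ℂ} (hO : IsOpen O) (hO' : O ⊆ upperHalf)
    {s : ℂ → ℂ → ℂ} (hs : ThetaFlat 2 O s) {c : Fin 2 → ℂ → ℂ}
    (hc : ∀ τ ∈ O, s τ = ∑ j, c j τ • theta 2 j τ) {τ : ℂ} (hτ : τ ∈ O) (i : Fin 2) :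
    HasFDerivAt (𝕜 := ℝ) (c i) 0 τ := by
  have hd : ∀ j, DifferentiableAt ℝ (c j) τ := by
    intro j
    obtain ⟨z, hz⟩ := exists_theta_ne_zero j (hO' hτ)
    have hθ := (hasFDerivAt_theta j (hO' hτ) z).differentiableAt
    -- The coefficients are only given pointwise. The half-period shift expresses them through
    -- values of `s`, which shows that they are differentiable.
    have h1 : ∀ᶠ τ' in 𝓝 τ, c j τ' =
        (s τ' z + (-1) ^ (j : ℕ) * s τ' (z + 1 / 2)) / (2 * theta 2 j τ' z) := by
      filter_upwards [hO.mem_nhds hτ, hθ.continuousAt.eventually_ne hz] with τ' hτ' hne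
      rw [hc τ' hτ', sum_theta_shift, eq_div_iff (mul_ne_zero two_ne_zero hne)]
      ring
    refine DifferentiableAt.congr_of_eventuallyEq ?_ h1
    have hs1 := (hs τ hτ).2.1 z
    have hs2 := (hs τ hτ).2.1 (z + 1 / 2)
    simp only [div_eq_mul_inv]
    exact (hs1.add (hs2.const_mul _)).mul
      ((hθ.const_mul 2).fun_inv (mul_ne_zero two_ne_zero hz))
  have h2 : ∀ v, (fun j => fderiv ℝ (c j) τ v) = 0 := by
    intro v
    refine sum_theta_injective (hO' hτ) ?_
    ext z
    have h3 := heatDeriv_sum_theta (hO' hτ) hd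
      (by filter_upwards [hO.mem_nhds hτ] with τ' h using hc τ' h) v z
    rw [(hs τ hτ).2.2 v] at h3
    simpa [sum_theta_apply] using h3.symm
  have h4 : fderiv ℝ (c i) τ = 0 := by
    ext v : 1
    exact congrFun (h2 v) i
  rw [← h4]
  exact (hd i).hasFDerivAt

/-- A covariantly constant section has constant coefficients on each connected open set. -/
theorem ThetaFlat.exists_coeff {O : Set ℂ} (hO : IsOpen O) (hO' : O ⊆ upperHalf)
    (hconn : IsPreconnected O) {s : ℂ → ℂ → ℂ} (hs : ThetaFlat 2 O s) :
    ∃ c : Fin 2 → ℂ, ∀ τ ∈ O, s τ = ∑ j, c j • theta 2 j τ := by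
  choose! c hc using fun τ (hτ : τ ∈ O) => mem_thetaSpace (hs τ hτ).1
  have hd := fun τ (hτ : τ ∈ O) i => hs.hasFDerivAt_coeff hO hO' (c := fun j τ => c τ j) hc hτ i
  choose a ha using fun i => hO.exists_is_const_of_fderiv_eq_zero hconn
    (fun τ hτ => (hd τ hτ i).differentiableAt.differentiableWithinAt)
    (fun τ hτ => (hd τ hτ i).fderiv)
  refine ⟨a, fun τ hτ => ?_⟩
  rw [hc τ hτ]
  exact Finset.sum_congr rfl fun j _ => by rw [← ha j τ hτ]

theorem ThetaFlat.eventually_eq {O : Set ℂ} (hO : IsOpen O) (hO' : O ⊆ upperHalf)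
    {s : ℂ → ℂ → ℂ} (hs : ThetaFlat 2 O s) {τ₀ : ℂ} (hτ₀ : τ₀ ∈ O) :
    ∃ c : Fin 2 → ℂ, ∀ᶠ τ in 𝓝 τ₀, s τ = ∑ j, c j • theta 2 j τ := by
  obtain ⟨r, hr, hball⟩ := Metric.isOpen_iff.1 hO τ₀ hτ₀
  have hs' : ThetaFlat 2 (Metric.ball τ₀ r) s := fun τ hτ => hs τ (hball hτ)
  obtain ⟨c, hc⟩ := hs'.exists_coeff Metric.isOpen_ball (hball.trans hO')
    (convex_ball τ₀ r).isPreconnected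
  exact ⟨c, by filter_upwards [Metric.ball_mem_nhds τ₀ hr] with τ h using hc τ h⟩

theorem isPreconnected_upperHalf : IsPreconnected upperHalf :=
  (convex_halfSpace_im_gt 0).isPreconnected

/-- The matrix of the displacement by an integer. -/
def shiftMatrix (m : ℤ) : GL (Fin 2) ℂ :=
  Matrix.GeneralLinearGroup.mkOfDetNeZero
    !![1, 0; 0, Complex.exp (I * (Real.pi / 2) * m)] (by simp [Matrix.det_fin_two_of])

theorem coe_shiftMatrix (m : ℤ) : (shiftMatrix m : Matrix (Fin 2) (Fin 2) ℂ) =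
    !![1, 0; 0, Complex.exp (I * (Real.pi / 2) * m)] := rfl

theorem shiftMatrix_add (m n : ℤ) : shiftMatrix (m + n) = shiftMatrix m * shiftMatrix n := by
  ext i j
  rw [Units.val_mul, coe_shiftMatrix, coe_shiftMatrix, coe_shiftMatrix]
  fin_cases i <;> fin_cases j <;> simp [mul_add, Complex.exp_add]

theorem shiftMatrix_mulVec (m : ℤ) (c : Fin 2 → ℂ) (j : Fin 2) :
    (shiftMatrix m : Matrix (Fin 2) (Fin 2) ℂ).mulVec c j =
      Complex.exp (I * (Real.pi / 2) * ((j : ℕ) * m)) * c j := by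
  rw [coe_shiftMatrix]
  fin_cases j <;> simp [Matrix.mulVec, dotProduct]

theorem sum_theta_add_int (c : Fin 2 → ℂ) (τ : ℂ) (m : ℤ) :
    ∑ j, c j • theta 2 j (τ + m) =
      ∑ j, (shiftMatrix m : Matrix (Fin 2) (Fin 2) ℂ).mulVec c j • theta 2 j τ := by
  ext z
  rw [sum_theta_apply, sum_theta_apply]
  refine Finset.sum_congr rfl fun j _ => ?_
  rw [theta_add_int, shiftMatrix_mulVec]
  ring

theorem coe_Z₀_zpow (m : ℤ) : ((Z₀ ^ m : SL(2, ℤ)) : Matrix (Fin 2) (Fin 2) ℤ) = !![1, m; 0, 1] :=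
  ModularGroup.coe_T_zpow m

/-- The parallel displacement as a homomorphism. -/
def displacement : Subgroup.zpowers Z₀ →* GL (Fin 2) ℂ :=
  MonoidHom.mk' (fun Z => shiftMatrix ((Z : SL(2, ℤ)) 0 1)) fun A B => by
    obtain ⟨_, m, rfl⟩ := A
    obtain ⟨_, n, rfl⟩ := B
    rw [← shiftMatrix_add]
    congr 1
    have h : ((Z₀ ^ m * Z₀ ^ n : SL(2, ℤ)) : Matrix (Fin 2) (Fin 2) ℤ) = !![1, m + n; 0, 1] := by
      rw [← zpow_add, coe_Z₀_zpow]
    have h1 := congrFun (congrFun h 0) 1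
    have h2 := congrFun (congrFun (coe_Z₀_zpow m) 0) 1
    have h3 := congrFun (congrFun (coe_Z₀_zpow n) 0) 1
    simp only [Matrix.of_apply, Matrix.cons_val_zero, Matrix.cons_val_one] at h1 h2 h3
    refine h1.trans ?_
    exact congrArg₂ (· + ·) h2.symm h3.symm

theorem displacement_zpow (m : ℤ) (h : Z₀ ^ m ∈ Subgroup.zpowers Z₀) :
    displacement ⟨Z₀ ^ m, h⟩ = shiftMatrix m := by
  have h2 := congrFun (congrFun (coe_Z₀_zpow m) 0) 1
  exact congrArg shiftMatrix h2

/-- A flat section over the half-plane has constant coefficients, so the displacement by `Z₀ ^ m`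
only compares the bases at `τ + m` and at `τ`. -/
theorem isThetaDisplacement_displacement (Z : Subgroup.zpowers Z₀) :
    IsThetaDisplacement (Z : SL(2, ℤ)) (displacement Z) := by
  obtain ⟨_, m, rfl⟩ := Z
  intro τ s hs c hc
  change s ((ModularGroup.T ^ m • τ : UpperHalfPlane) : ℂ) = _
  rw [ModularGroup.coe_T_zpow_smul_eq]
  obtain ⟨d, hd⟩ := hs.exists_coeff isOpen_upperHalf subset_rfl isPreconnected_upperHalf
  have hτ : (τ : ℂ) ∈ upperHalf := τ.im_pos
  have hτm : (τ : ℂ) + m ∈ upperHalf := by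
    change 0 < ((τ : ℂ) + m).im
    simpa using τ.im_pos
  rw [hd _ hτ] at hc
  obtain rfl := sum_theta_injective hτ hc
  rw [hd _ hτm, sum_theta_add_int]
  have h := displacement_zpow m (Subgroup.zpow_mem_zpowers _ _)
  change _ = ∑ j, (displacement ⟨Z₀ ^ m, _⟩ : Matrix (Fin 2) (Fin 2) ℂ).mulVec d j • theta 2 j τ
  rw [h]

theorem displacement_Z₀ : (displacement ⟨Z₀, Subgroup.mem_zpowers _⟩ : Matrix (Fin 2) (Fin 2) ℂ) =
    !![1, 0; 0, Complex.exp (I * (Real.pi / 2))] := by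
  have h : displacement ⟨Z₀, Subgroup.mem_zpowers _⟩ = shiftMatrix 1 := rfl
  rw [h, coe_shiftMatrix]
  simp

end HeatMonodromy
end

/-! ### Actions adapted to the first cycle, and the rotation number. -/

noncomputable section

namespace HeatMonodromy

open Set Function Filter

/-- An eventually integer-valued function that is continuous at a point is constant near it. -/
theorem eventually_eq_of_forall_int {X : Type*} [TopologicalSpace X] {x₀ : X} {g : X → ℝ}
    (hg : ContinuousAt g x₀) (h : ∀ᶠ x in 𝓝 x₀, ∃ n : ℤ, g x = n) :
    ∃ n : ℤ, ∀ᶠ x in 𝓝 x₀, g x = n := by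
  obtain ⟨n₀, hn₀⟩ := h.self_of_nhds
  refine ⟨n₀, ?_⟩
  filter_upwards [h, Metric.continuousAt_iff'.1 hg 1 one_pos] with x ⟨n, hn⟩ hx
  rw [hn, hn₀, Real.dist_eq, ← Int.cast_sub, ← Int.cast_abs] at hx
  have h1 : |n - n₀| < 1 := by exact_mod_cast hx
  rw [Int.abs_lt_one_iff, sub_eq_zero] at h1
  rw [hn, h1]

theorem contDiffOn_grad {I : ℝ × ℝ → ℝ} {W : Set (ℝ × ℝ)} (hW : IsOpen W)
    (hI : ContDiffOn ℝ 1 I W) : ContinuousOn (grad I) W := by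
  have h := hI.continuousOn_fderiv_of_isOpen hW le_rfl
  exact (h.clm_apply continuousOn_const).prodMk (h.clm_apply continuousOn_const)

theorem grad_intComb {I : Fin 2 → ℝ × ℝ → ℝ} {b : ℝ × ℝ} (hI : ∀ i, DifferentiableAt ℝ (I i) b)
    (c : Fin 2 → ℝ) : grad (fun b => c 0 * I 0 b + c 1 * I 1 b) b =
      c 0 • grad (I 0) b + c 1 • grad (I 1) b := by
  have h := (((hI 0).hasFDerivAt.const_mul (c 0)).add ((hI 1).hasFDerivAt.const_mul (c 1))).fderiv
  have h' : fderiv ℝ (fun b => c 0 * I 0 b + c 1 * I 1 b) b =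
    c 0 • fderiv ℝ (I 0) b + c 1 • fderiv ℝ (I 1) b := h
  simp [grad, h']

theorem continuousAt_det2 {X : Type*} [TopologicalSpace X] {u v : X → ℝ × ℝ} {x : X}
    (hu : ContinuousAt u x) (hv : ContinuousAt v x) : ContinuousAt (fun x => det2 (u x) (v x)) x := by
  unfold det2
  fun_prop

namespace IntegrableSystem

variable {M : Type*} [TopologicalSpace M] [ChartedSpace E4 M] {S : IntegrableSystem M}
  {W : Set (ℝ × ℝ)} {I : Fin 2 → ℝ × ℝ → ℝ}

theorem IsActionPair.mono (h : S.IsActionPair W I) {W' : Set (ℝ × ℝ)} (hW' : IsOpen W')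
    (hsub : W' ⊆ W) : S.IsActionPair W' I :=
  ⟨hW', hsub.trans h.2.1, fun i => (h.2.2.1 i).mono hsub, fun b hb => h.2.2.2 b (hsub hb)⟩

theorem IsActionPair.continuousAt_grad (h : S.IsActionPair W I) {b : ℝ × ℝ} (hb : b ∈ W)
    (i : Fin 2) : ContinuousAt (grad (I i)) b :=
  (contDiffOn_grad h.1 (h.2.2.1 i)).continuousAt (h.1.mem_nhds hb)

theorem IsActionPair.differentiableAt (h : S.IsActionPair W I) {b : ℝ × ℝ} (hb : b ∈ W)
    (i : Fin 2) : DifferentiableAt ℝ (I i) b :=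
  ((h.2.2.1 i).contDiffAt (h.1.mem_nhds hb)).differentiableAt one_ne_zero

theorem IsActionPair.det2_ne_zero (h : S.IsActionPair W I) {b : ℝ × ℝ} (hb : b ∈ W) :
    det2 (grad (I 0) b) (grad (I 1) b) ≠ 0 :=
  (linearIndependent_iff_det2 _).1 (h.2.2.2 b hb).1

theorem IsActionPair.isPeriod_iff (h : S.IsActionPair W I) {b : ℝ × ℝ} (hb : b ∈ W)
    (a : ℝ × ℝ) : S.IsPeriod b a ↔
      ∃ m n : ℤ, a = (m : ℝ) • grad (I 0) b + (n : ℝ) • grad (I 1) b := by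
  rw [(h.2.2.2 b hb).2]
  simp only [Fin.sum_univ_two]
  exact ⟨fun ⟨n, hn⟩ => ⟨n 0, n 1, hn⟩, fun ⟨m, n, hmn⟩ => ⟨![m, n], by simpa using hmn⟩⟩

/-- A continuous period has locally constant integer coordinates with respect to the actions. -/
theorem IsActionPair.eventually_eq_comb (h : S.IsActionPair W I) {b₀ : ℝ × ℝ} (hb₀ : b₀ ∈ W)
    {v : ℝ × ℝ → ℝ × ℝ} (hv : ContinuousAt v b₀) (hper : ∀ᶠ b in 𝓝 b₀, S.IsPeriod b (v b)) :
    ∃ m n : ℤ, ∀ᶠ b in 𝓝 b₀, v b = (m : ℝ) • grad (I 0) b + (n : ℝ) • grad (I 1) b := by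
  have h0 := h.continuousAt_grad hb₀ 0
  have h1 := h.continuousAt_grad hb₀ 1
  have hW : ∀ᶠ b in 𝓝 b₀, b ∈ W := h.1.mem_nhds hb₀
  have hD := continuousAt_det2 h0 h1
  -- By Cramer's rule the coordinates are quotients of determinants. These are continuous and
  -- integer-valued near `b₀`, hence locally constant.
  have hm : ∀ᶠ b in 𝓝 b₀, ∃ m : ℤ,
      det2 (v b) (grad (I 1) b) / det2 (grad (I 0) b) (grad (I 1) b) = m := by
    filter_upwards [hper, hW] with b hb hbW
    obtain ⟨m, n, hmn⟩ := (h.isPeriod_iff hbW _).1 hb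
    refine ⟨m, ?_⟩
    rw [hmn, (det2_comb ((m : ℝ), (n : ℝ)) _ _).1, mul_div_cancel_right₀ _ (h.det2_ne_zero hbW)]
  have hn : ∀ᶠ b in 𝓝 b₀, ∃ n : ℤ,
      det2 (grad (I 0) b) (v b) / det2 (grad (I 0) b) (grad (I 1) b) = n := by
    filter_upwards [hper, hW] with b hb hbW
    obtain ⟨m, n, hmn⟩ := (h.isPeriod_iff hbW _).1 hb
    refine ⟨n, ?_⟩
    rw [hmn, (det2_comb ((m : ℝ), (n : ℝ)) _ _).2, mul_div_cancel_right₀ _ (h.det2_ne_zero hbW)]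
  obtain ⟨m, hm⟩ := eventually_eq_of_forall_int
    ((continuousAt_det2 hv h1).div hD (h.det2_ne_zero hb₀)) hm
  obtain ⟨n, hn⟩ := eventually_eq_of_forall_int
    ((continuousAt_det2 h0 hv).div hD (h.det2_ne_zero hb₀)) hn
  refine ⟨m, n, ?_⟩
  filter_upwards [hm, hn, hW] with b hbm hbn hbW
  rw [← hbm, ← hbn]
  exact eq_comb_of_det2_ne_zero (h.det2_ne_zero hbW) (v b)

/-- A unimodular change of action variables. -/
theorem IsActionPair.unimodular (h : S.IsActionPair W I) {m₀ m₁ n₀ n₁ e : ℤ} (he : e * e = 1)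
    (hdet : m₀ * n₁ - m₁ * n₀ = e) :
    S.IsActionPair W ![fun b => m₀ * I 0 b + m₁ * I 1 b, fun b => n₀ * I 0 b + n₁ * I 1 b] ∧
    ∀ b ∈ W, grad (fun b => (m₀ : ℝ) * I 0 b + m₁ * I 1 b) b =
        (m₀ : ℝ) • grad (I 0) b + (m₁ : ℝ) • grad (I 1) b ∧
      grad (fun b => (n₀ : ℝ) * I 0 b + n₁ * I 1 b) b =
        (n₀ : ℝ) • grad (I 0) b + (n₁ : ℝ) • grad (I 1) b := by
  have hgrad : ∀ b ∈ W, ∀ c d : ℤ, grad (fun b => (c : ℝ) * I 0 b + d * I 1 b) b =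
      (c : ℝ) • grad (I 0) b + (d : ℝ) • grad (I 1) b := fun b hb c d =>
    grad_intComb (fun i => h.differentiableAt hb i) ![(c : ℝ), (d : ℝ)]
  refine ⟨⟨h.1, h.2.1, fun i => ?_, fun b hb => ⟨?_, fun a => ?_⟩⟩,
    fun b hb => ⟨hgrad b hb _ _, hgrad b hb _ _⟩⟩
  · have h0 := h.2.2.1 0
    have h1 := h.2.2.1 1
    fin_cases i
    · change ContDiffOn ℝ 1 (fun b => (m₀ : ℝ) * I 0 b + m₁ * I 1 b) W
      fun_prop
    · change ContDiffOn ℝ 1 (fun b => (n₀ : ℝ) * I 0 b + n₁ * I 1 b) W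
      fun_prop
  · rw [linearIndependent_iff_det2]
    change det2 (grad (fun b => (m₀ : ℝ) * I 0 b + m₁ * I 1 b) b)
      (grad (fun b => (n₀ : ℝ) * I 0 b + n₁ * I 1 b) b) ≠ 0
    rw [hgrad b hb, hgrad b hb]
    have h1 : det2 ((m₀ : ℝ) • grad (I 0) b + (m₁ : ℝ) • grad (I 1) b)
        ((n₀ : ℝ) • grad (I 0) b + (n₁ : ℝ) • grad (I 1) b) =
        ((m₀ * n₁ - m₁ * n₀ : ℤ) : ℝ) * det2 (grad (I 0) b) (grad (I 1) b) := by
      simp only [det2, Prod.fst_add, Prod.snd_add, Prod.smul_fst, Prod.smul_snd, smul_eq_mul]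
      push_cast
      ring
    rw [h1, hdet]
    refine mul_ne_zero (Int.cast_ne_zero.2 ?_) (h.det2_ne_zero hb)
    rintro rfl
    simp at he
  · simp only [Fin.sum_univ_two, Matrix.cons_val_zero, Matrix.cons_val_one]
    rw [hgrad b hb, hgrad b hb, h.isPeriod_iff hb]
    constructor
    · rintro ⟨k₀, k₁, rfl⟩
      -- The inverse of an integer matrix of determinant `e = ±1` is `e` times its adjugate.
      refine ⟨![e * (k₀ * n₁ - k₁ * n₀), e * (m₀ * k₁ - m₁ * k₀)], ?_⟩
      simp only [Matrix.cons_val_zero, Matrix.cons_val_one, smul_add, smul_smul]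
      have e0 : e * (k₀ * n₁ - k₁ * n₀) * m₀ + e * (m₀ * k₁ - m₁ * k₀) * n₀ = k₀ := by
        linear_combination (e * k₀) * hdet + k₀ * he
      have e1 : e * (k₀ * n₁ - k₁ * n₀) * m₁ + e * (m₀ * k₁ - m₁ * k₀) * n₁ = k₁ := by
        linear_combination (e * k₁) * hdet + k₁ * he
      have E0 := congrArg (Int.cast : ℤ → ℝ) e0
      have E1 := congrArg (Int.cast : ℤ → ℝ) e1
      refine (congrArg₂ (fun x y : ℝ => x • grad (I 0) b + y • grad (I 1) b)
        E0.symm E1.symm).trans ?_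
      push_cast
      module
    · rintro ⟨l, rfl⟩
      refine ⟨l 0 * m₀ + l 1 * n₀, l 0 * m₁ + l 1 * n₁, ?_⟩
      push_cast
      module

/-- Action variables over `W` whose differentials are the two cycles `γ₁` and `γ₂`, the second one
being determined by a continuous choice of the rotation number. -/
def IsAdapted (S : IntegrableSystem M) (α : ℝ × ℝ → ℝ × ℝ) (W : Set (ℝ × ℝ))
    (J : Fin 2 → ℝ × ℝ → ℝ) (Θ T : ℝ × ℝ → ℝ) : Prop :=
  S.IsActionPair W J ∧ ContinuousOn Θ W ∧ ContinuousOn T W ∧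
  ∀ b ∈ W, (α b).2 ≠ 0 ∧ 0 < T b ∧ grad (J 0) b = α b ∧ grad (J 1) b = secondCycle α b (Θ b) (T b)

/-- Solves for `Θ` and `T` from `v.2 = -Θ α₂` and `det2 α v = -T α₂`. The transversality of `X_h` to
`γ₁`, that is `α₂ ≠ 0`, permits the division. -/
theorem eq_secondCycle {α : ℝ × ℝ → ℝ × ℝ} {b v : ℝ × ℝ} (h : (α b).2 ≠ 0) :
    v = secondCycle α b (-(v.2 / (α b).2)) (-(det2 (α b) v / (α b).2)) := by
  simp only [secondCycle, det2]
  ext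
  · simp
    field_simp
    ring
  · simp
    field_simp

theorem det2_secondCycle (α : ℝ × ℝ → ℝ × ℝ) (b : ℝ × ℝ) (Θ T : ℝ) :
    det2 (α b) (secondCycle α b Θ T) = -(T * (α b).2) := by
  simp [det2, secondCycle]
  ring

/-- The source of the monodromy matrix, with `c` the winding number of the rotation number. -/
theorem secondCycle_sub (α : ℝ × ℝ → ℝ × ℝ) (b : ℝ × ℝ) (Θ T c : ℝ) :
    secondCycle α b (Θ + c) T = secondCycle α b Θ T - c • α b := by
  simp only [secondCycle, add_smul]
  abel

variable [IsManifold (𝓡 4) ∞ M] [T2Space M] {U : Set (ℝ × ℝ)} {α : ℝ × ℝ → ℝ × ℝ}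

/-- Near a point of `U` there are adapted action variables. -/
theorem exists_isAdapted (hU : IsOpen U) (hUB : U ⊆ S.base) (hα : S.IsFirstCycle U α)
    {b₀ : ℝ × ℝ} (hb₀ : b₀ ∈ U) :
    ∃ W J Θ T, b₀ ∈ W ∧ W ⊆ U ∧ S.IsAdapted α W J Θ T := by
  obtain ⟨r, hr, I, hI⟩ := exists_isActionPair (hUB hb₀)
  have hbW : b₀ ∈ Metric.ball b₀ r := Metric.mem_ball_self hr
  have hαc : ContinuousAt α b₀ := hα.1.continuousAt (hU.mem_nhds hb₀)
  obtain ⟨m₀, m₁, hm⟩ := hI.eventually_eq_comb hbW hαc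
    (by filter_upwards [hU.mem_nhds hb₀] with b hb using (hα.2 b hb).1)
  -- If `d` is the gcd, `d⁻¹ • α b₀` is still a period, so primitivity makes `d⁻¹` an integer.
  have hcop : Int.gcd m₀ m₁ = 1 := by
    set d := Int.gcd m₀ m₁ with hd
    have hα0 := hm.self_of_nhds
    obtain ⟨k₀, hk₀⟩ := Int.gcd_dvd_left m₀ m₁
    obtain ⟨k₁, hk₁⟩ := Int.gcd_dvd_right m₀ m₁
    rw [← hd] at hk₀ hk₁
    have hd0 : (d : ℝ) ≠ 0 := by
      intro h0
      have h0' : d = 0 := by exact_mod_cast h0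
      rw [h0'] at hk₀ hk₁
      simp only [Nat.cast_zero, zero_mul] at hk₀ hk₁
      rw [hk₀, hk₁] at hα0
      simp only [Int.cast_zero, zero_smul, add_zero] at hα0
      exact (hα.2 b₀ hb₀).2.2 (by rw [hα0]; rfl)
    obtain ⟨n, hn⟩ := (hα.2 b₀ hb₀).2.1 ((d : ℝ)⁻¹) ((hI.isPeriod_iff hbW _).2 ⟨k₀, k₁, by
      rw [hα0, hk₀, hk₁]
      push_cast
      rw [smul_add, smul_smul, smul_smul, inv_mul_cancel_left₀ hd0, inv_mul_cancel_left₀ hd0]⟩)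
    have h1 : (d : ℤ) * n = 1 := by
      have h2 : (d : ℝ) * n = 1 := by rw [← hn, mul_inv_cancel₀ hd0]
      exact_mod_cast h2
    have h3 := Int.eq_one_or_neg_one_of_mul_eq_one h1
    omega
  -- Bézout completes the row `(m₀, m₁)` by `(-v, u)` to a matrix of determinant `1`.
  obtain ⟨u, v, huv⟩ := Int.isCoprime_iff_gcd_eq_one.2 hcop
  have hα2 := (hα.2 b₀ hb₀).2.2
  have hdet0 : det2 (α b₀) ((-v : ℤ) • grad (I 0) b₀ + u • grad (I 1) b₀) =
      det2 (grad (I 0) b₀) (grad (I 1) b₀) := by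
    have huv' : (u : ℝ) * m₀ + v * m₁ = 1 := by exact_mod_cast huv
    rw [hm.self_of_nhds, ← Int.cast_smul_eq_zsmul ℝ, ← Int.cast_smul_eq_zsmul ℝ]
    simp only [det2, Prod.fst_add, Prod.snd_add, Prod.smul_fst, Prod.smul_snd, smul_eq_mul]
    push_cast
    linear_combination ((grad (I 0) b₀).1 * (grad (I 1) b₀).2 -
      (grad (I 0) b₀).2 * (grad (I 1) b₀).1) * huv'
  -- The sign of the second row is chosen so that the resulting return time is positive.
  obtain ⟨e, he, hsign⟩ : ∃ e : ℤ, e * e = 1 ∧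
      0 < -(e * det2 (grad (I 0) b₀) (grad (I 1) b₀) / (α b₀).2) := by
    have hne : det2 (grad (I 0) b₀) (grad (I 1) b₀) / (α b₀).2 ≠ 0 :=
      div_ne_zero (hI.det2_ne_zero hbW) hα2
    rcases lt_or_gt_of_ne hne with h | h
    · exact ⟨1, rfl, by rw [mul_div_assoc]; push_cast; linarith⟩
    · exact ⟨-1, rfl, by rw [mul_div_assoc]; push_cast; linarith⟩
  obtain ⟨hJ, hJgrad⟩ := hI.unimodular (m₀ := m₀) (m₁ := m₁) (n₀ := -(e * v)) (n₁ := e * u) he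
    (by linear_combination e * huv)
  set J : Fin 2 → ℝ × ℝ → ℝ := ![fun b => m₀ * I 0 b + m₁ * I 1 b,
    fun b => ((-(e * v) : ℤ) : ℝ) * I 0 b + ((e * u : ℤ) : ℝ) * I 1 b] with hJdef
  have hpos : ∀ᶠ b in 𝓝 b₀, 0 < -(det2 (α b) (grad (J 1) b) / (α b).2) := by
    have hc : ContinuousAt (fun b => -(det2 (α b) (grad (J 1) b) / (α b).2)) b₀ :=
      ((continuousAt_det2 hαc (hJ.continuousAt_grad hbW 1)).div hαc.snd hα2).neg
    refine hc.eventually (lt_mem_nhds ?_)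
    have h1 : det2 (α b₀) (grad (J 1) b₀) = e * det2 (grad (I 0) b₀) (grad (I 1) b₀) := by
      rw [← hdet0]
      have h2 : grad (J 1) b₀ = _ := (hJgrad b₀ hbW).2
      rw [h2, ← Int.cast_smul_eq_zsmul ℝ, ← Int.cast_smul_eq_zsmul ℝ]
      simp only [det2, Prod.fst_add, Prod.snd_add, Prod.smul_fst, Prod.smul_snd, smul_eq_mul]
      push_cast
      ring
    simp only [h1]
    exact hsign
  have hev := (hm.and hpos).and ((hU.eventually_mem hb₀).and
    (Metric.isOpen_ball.eventually_mem hbW))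
  obtain ⟨W, hW, hWo, hbW'⟩ := eventually_nhds_iff.1 hev
  have hsub : W ⊆ Metric.ball b₀ r := fun b hb => (hW b hb).2.2
  have hJW := hJ.mono hWo hsub
  have hαW : ContinuousOn α W := hα.1.mono fun b hb => (hW b hb).2.1
  have hα2W : ∀ b ∈ W, (α b).2 ≠ 0 := fun b hb => (hα.2 b (hW b hb).2.1).2.2
  have hgW : ContinuousOn (grad (J 1)) W := contDiffOn_grad hWo (hJW.2.2.1 1)
  refine ⟨W, J, fun b => -((grad (J 1) b).2 / (α b).2),
    fun b => -(det2 (α b) (grad (J 1) b) / (α b).2), hbW', fun b hb => (hW b hb).2.1, hJW,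
    ?_, ?_, fun b hb => ⟨hα2W b hb, (hW b hb).1.2, ?_, eq_secondCycle (hα2W b hb)⟩⟩
  · exact (hgW.snd.div hαW.snd hα2W).neg
  · refine (ContinuousOn.div ?_ hαW.snd hα2W).neg
    exact (hαW.fst.mul hgW.snd).sub (hαW.snd.mul hgW.fst)
  · exact (hJgrad b (hsub hb)).1.trans (hW b hb).1.1.symm

variable {J : Fin 2 → ℝ × ℝ → ℝ} {Θ T : ℝ × ℝ → ℝ}

/-- The first return time and the rotation number are read off from adapted actions. -/
theorem IsAdapted.isReturn_iff (h : S.IsAdapted α W J Θ T) {b : ℝ × ℝ} (hb : b ∈ W) (θ t : ℝ) :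
    S.IsReturn α b θ t ↔ t = T b ∧ ∃ k : ℤ, θ = Θ b + k := by
  obtain ⟨hα2, hT, h0, h1⟩ := h.2.2.2 b hb
  have hdet : det2 (α b) (secondCycle α b (Θ b) (T b)) ≠ 0 := by
    rw [det2_secondCycle]
    exact neg_ne_zero.2 (mul_ne_zero hT.ne' hα2)
  -- The period `m γ₁ + n γ₂` corresponds to time `n T` and rotation `n Θ - m`.
  have hper : ∀ θ t, S.IsPeriod b (secondCycle α b θ t) ↔
      ∃ m n : ℤ, t = n * T b ∧ θ = n * Θ b - m := by
    intro θ t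
    rw [h.1.isPeriod_iff hb, h0, h1]
    refine exists₂_congr fun m n => ?_
    have key : (m : ℝ) • α b + (n : ℝ) • secondCycle α b (Θ b) (T b) =
        secondCycle α b (n * Θ b - m) (n * T b) := by
      simp only [secondCycle]
      module
    rw [key]
    constructor
    · intro heq
      have h2 := congrArg (det2 (α b)) heq
      rw [det2_secondCycle, det2_secondCycle, neg_inj] at h2
      have h3 := mul_right_cancel₀ hα2 h2
      refine ⟨h3, ?_⟩
      have h4 := congrArg Prod.snd heq
      simp only [secondCycle, Prod.snd_sub, Prod.smul_snd, smul_eq_mul, mul_zero, zero_sub,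
        neg_inj] at h4
      exact mul_right_cancel₀ hα2 h4
    · rintro ⟨rfl, rfl⟩
      rfl
  rw [IntegrableSystem.isReturn_iff (h.1.2.1 hb)]
  simp only [hper]
  constructor
  · rintro ⟨ht, ⟨m, n, hn, hm⟩, hmin⟩
    have hn0 : 0 < n := by
      have : (0 : ℝ) < n := by
        rw [hn] at ht
        exact pos_of_mul_pos_left ht hT.le
      exact_mod_cast this
    -- `γ₂` itself is a return at time `T b`, so minimality of the return time excludes `n > 1`.
    have hn1 : n = 1 := by
      by_contra hne
      have hn2 : (1 : ℝ) < n := by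
        have : 1 < n := by omega
        exact_mod_cast this
      refine hmin (T b) hT ?_ (Θ b) ⟨0, 1, by simp, by simp⟩
      rw [hn]
      nlinarith
    subst hn1
    refine ⟨by simpa using hn, -m, ?_⟩
    rw [hm]
    push_cast
    ring
  · rintro ⟨rfl, k, rfl⟩
    refine ⟨hT, ⟨-k, 1, by simp, by push_cast; ring⟩, ?_⟩
    rintro t ht0 ht s ⟨m, n, rfl, -⟩
    have h1 : (0 : ℝ) < n := pos_of_mul_pos_left ht0 hT.le
    have h2 : (n : ℝ) < 1 := by
      by_contra! h3
      nlinarith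
    have h1' : (0 : ℤ) < n := by exact_mod_cast h1
    have h2' : n < (1 : ℤ) := by exact_mod_cast h2
    omega

/-- The rotation number at a given point can be prescribed. -/
theorem exists_isAdapted_of_isReturn (hU : IsOpen U) (hUB : U ⊆ S.base)
    (hα : S.IsFirstCycle U α) {b₀ : ℝ × ℝ} (hb₀ : b₀ ∈ U) {θ t : ℝ}
    (hret : S.IsReturn α b₀ θ t) :
    ∃ W J Θ T, b₀ ∈ W ∧ W ⊆ U ∧ S.IsAdapted α W J Θ T ∧ Θ b₀ = θ := by
  obtain ⟨W, J, Θ, T, hbW, hWU, h⟩ := exists_isAdapted hU hUB hα hb₀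
  obtain ⟨-, k, hk⟩ := (h.isReturn_iff hbW θ t).1 hret
  -- Replacing `γ₂` by `γ₂ - k γ₁` raises the rotation number by `k`.
  obtain ⟨hJ', hgrad⟩ := h.1.unimodular (m₀ := 1) (m₁ := 0) (n₀ := -k) (n₁ := 1) (e := 1)
    rfl (by ring)
  refine ⟨W, _, fun b => Θ b + k, T, hbW, hWU, ⟨hJ', h.2.1.add continuousOn_const, h.2.2.1,
    fun b hb => ?_⟩, hk.symm⟩
  obtain ⟨h2, hT, h0, h1⟩ := h.2.2.2 b hb
  refine ⟨h2, hT, (hgrad b hb).1.trans ?_, (hgrad b hb).2.trans ?_⟩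
  · rw [h0]
    simp
  · rw [h0, h1, secondCycle_sub]
    push_cast
    module

end IntegrableSystem

end HeatMonodromy
end

/-! ### Winding numbers, and holonomy computed in a parallel frame. -/

noncomputable section

namespace HeatMonodromy

open Set Function Filter unitInterval

section Winding

variable {X : Type*} [TopologicalSpace X]

/-- The circle-valued function `g` has a real lift along `γ` that starts at `Θ` and ends
at `Θ + n`. -/
def HasWinding (g : C(X, AddCircle (1 : ℝ))) (Θ : ℝ) (γ : C(I, X)) (n : ℤ) : Prop :=
  ∃ p : C(I, ℝ), p 0 = Θ ∧ p 1 = Θ + n ∧ ∀ t, (p t : AddCircle (1 : ℝ)) = g (γ t)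

variable {g : C(X, AddCircle (1 : ℝ))} {Θ : ℝ}

theorem coe_eq_coe_iff_int {a b : ℝ} :
    (a : AddCircle (1 : ℝ)) = (b : AddCircle (1 : ℝ)) ↔ ∃ n : ℤ, a = b + n := by
  rw [QuotientAddGroup.eq, AddSubgroup.mem_zmultiples_iff]
  constructor
  · rintro ⟨k, hk⟩
    refine ⟨-k, ?_⟩
    simp only [zsmul_eq_mul, mul_one] at hk
    push_cast
    linarith
  · rintro ⟨n, rfl⟩
    exact ⟨-n, by simp⟩

theorem exists_hasWinding {γ : C(I, X)} (hΘ : (Θ : AddCircle (1 : ℝ)) = g (γ 0))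
    (hγ : γ 1 = γ 0) : ∃ n, HasWinding g Θ γ n := by
  obtain ⟨p, hp, hp0⟩ := (AddCircle.isCoveringMap_coe (1 : ℝ)).exists_path_lifts (g.comp γ) Θ
    hΘ.symm
  have hp' : ∀ t, (p t : AddCircle (1 : ℝ)) = g (γ t) := congrFun hp
  have h1 : (p 1 : AddCircle (1 : ℝ)) = (Θ : AddCircle (1 : ℝ)) := by
    rw [hp', hγ, hΘ]
  obtain ⟨n, hn⟩ := coe_eq_coe_iff_int.1 h1
  exact ⟨n, p, hp0, hn, hp'⟩

/-- Homotopic paths with fixed ends have lifts to the covering `ℝ → ℝ/ℤ` with the same end point. -/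
theorem HasWinding.congr_homotopic {γ γ' : C(I, X)} {n n' : ℤ} (h : HasWinding g Θ γ n)
    (h' : HasWinding g Θ γ' n') (hγ : γ.HomotopicRel γ' {0, 1}) : n = n' := by
  obtain ⟨p, hp0, hp1, hp⟩ := h
  obtain ⟨p', hp0', hp1', hp'⟩ := h'
  have cov := AddCircle.isCoveringMap_coe (1 : ℝ)
  have h0 : (g.comp γ) 0 = (Θ : AddCircle (1 : ℝ)) := by rw [← hp0, hp]; rfl
  have h0' : (g.comp γ') 0 = (Θ : AddCircle (1 : ℝ)) := by rw [← hp0', hp']; rfl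
  have hhom : (g.comp γ).HomotopicRel (g.comp γ') {0, 1} := by
    obtain ⟨F⟩ := hγ
    exact ⟨F.compContinuousMap g⟩
  have h1 := cov.liftPath_apply_one_eq_of_homotopicRel hhom Θ h0 h0'
  rw [← (cov.eq_liftPath_iff' h0).2 ⟨funext hp, hp0⟩,
    ← (cov.eq_liftPath_iff' h0').2 ⟨funext hp', hp0'⟩, hp1, hp1', add_right_inj] at h1
  exact_mod_cast h1

theorem HasWinding.trans {x : X} {γ γ' : Path x x} {m n : ℤ} (h : HasWinding g Θ γ m)
    (h' : HasWinding g Θ γ' n) : HasWinding g Θ (γ.trans γ') (m + n) := by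
  obtain ⟨p, hp0, hp1, hp⟩ := h
  obtain ⟨p', hp0', hp1', hp'⟩ := h'
  let P : Path Θ (Θ + m) := ⟨p, hp0, hp1⟩
  -- The second lift is translated by `m`, to start where the first one ends.
  let P' : Path (Θ + m) (Θ + m + n) := ⟨p' + .const I (m : ℝ), by simp [hp0'], by
    simp only [ContinuousMap.toFun_eq_coe, ContinuousMap.add_apply, hp1', ContinuousMap.const_apply]
    ring⟩
  refine ⟨P.trans P', by simp, by simp [add_assoc], fun t => ?_⟩
  have hP : ∀ t, (P t : AddCircle (1 : ℝ)) = g (γ t) := hp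
  have hP' : ∀ t, (P' t : AddCircle (1 : ℝ)) = g (γ' t) := by
    intro t
    rw [← ContinuousMap.coe_coe γ', ← hp' t]
    exact coe_eq_coe_iff_int.2 ⟨m, rfl⟩
  change ((P.trans P' t : ℝ) : AddCircle (1 : ℝ)) = g (γ.trans γ' t)
  rw [Path.trans_apply, Path.trans_apply]
  split_ifs
  · exact hP _
  · exact hP' _

/-- The winding number of a circle-valued function is a homomorphism on the fundamental group. -/
theorem exists_winding (g : C(X, AddCircle (1 : ℝ))) (x₀ : X) {Θ : ℝ}
    (hΘ : (Θ : AddCircle (1 : ℝ)) = g x₀) :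
    ∃ N : FundamentalGroup X x₀ →* Multiplicative ℤ, ∀ γ : Path x₀ x₀,
      HasWinding g Θ γ (N (FundamentalGroup.fromPath (Path.Homotopic.Quotient.mk γ))).toAdd := by
  have hex : ∀ γ : Path x₀ x₀, ∃ n, HasWinding g Θ γ n := fun γ =>
    exists_hasWinding (by simpa using hΘ) (by simp)
  have hclass : ∀ q : Path.Homotopic.Quotient x₀ x₀, ∃ n, ∀ γ : Path x₀ x₀,
      Path.Homotopic.Quotient.mk γ = q → HasWinding g Θ γ n := by
    intro q
    obtain ⟨γ₀, rfl⟩ := Path.Homotopic.Quotient.mk_surjective q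
    obtain ⟨n, hn⟩ := hex γ₀
    refine ⟨n, fun γ hγ => ?_⟩
    obtain ⟨n', hn'⟩ := hex γ
    have := hn'.congr_homotopic hn (Path.Homotopic.Quotient.eq.1 hγ)
    rwa [this] at hn'
  choose N hN using hclass
  refine ⟨MonoidHom.mk' (fun q => Multiplicative.ofAdd (N q)) fun q r => ?_, fun γ => hN _ γ rfl⟩
  obtain ⟨γ, rfl⟩ := Path.Homotopic.Quotient.mk_surjective q
  obtain ⟨γ', rfl⟩ := Path.Homotopic.Quotient.mk_surjective r
  -- The product of the classes of `γ` and `γ'` is the class of `γ'.trans γ`; the order is harmless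
  -- as `ℤ` is commutative.
  have h1 := (hN _ γ' rfl).trans (hN _ γ rfl)
  have h2 := hN _ (γ'.trans γ) rfl
  have h3 := h2.congr_homotopic h1 (ContinuousMap.HomotopicRel.refl _)
  rw [← ofAdd_add]
  refine congrArg Multiplicative.ofAdd (Eq.trans ?_ (h3.trans (add_comm _ _)))
  rfl

end Winding

section Frame

variable {R F : Type*} [CommRing R] [AddCommGroup F] [Module R F]

/-- Holonomy in terms of a frame of parallel sections along a path. -/
theorem isHolonomyMatrix_of_frame {flat : Set (ℝ × ℝ) → (ℝ × ℝ → F) → Prop} {γ : I → ℝ × ℝ}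
    {e : Fin 2 → I → F} {A : Matrix (Fin 2) (Fin 2) R}
    (hli : ∀ t (c d : Fin 2 → R), ∑ i, c i • e i t = ∑ i, d i • e i t → c = d)
    (hpar : ∀ c : Fin 2 → R, ParallelAlong flat γ fun t => ∑ i, c i • e i t)
    (hloc : ∀ s, ParallelAlong flat γ s → ∀ t₀, ∃ c : Fin 2 → R,
      ∀ᶠ t in 𝓝 t₀, s t = ∑ i, c i • e i t)
    (hA : ∀ c : Fin 2 → R, ∑ i, c i • e i 1 = ∑ i, A.mulVec c i • e i 0) :
    IsHolonomyMatrix flat γ (fun i => e i 0) A := by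
  intro c d
  constructor
  · rintro ⟨s, hs, h0, h1⟩
    choose k hk using fun t₀ => (hloc s hs t₀)
    -- Independence of the frame makes the coordinates unique, so the local constants agree nearby
    -- and are constant on the whole interval.
    have hloc' : IsLocallyConstant k := by
      rw [IsLocallyConstant.iff_eventually_eq]
      intro t₀
      filter_upwards [hk t₀] with t ht
      exact hli t _ _ ((hk t).self_of_nhds.symm.trans ht)
    have hconst : k 1 = k 0 := hloc'.apply_eq_of_preconnectedSpace 1 0
    have hc : k 0 = c := hli 0 _ _ ((hk 0).self_of_nhds.symm.trans h0)
    have hs1 := (hk 1).self_of_nhds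
    rw [hconst, hc, hA, h1] at hs1
    exact hli 0 _ _ hs1
  · rintro rfl
    exact ⟨_, hpar c, rfl, hA c⟩

end Frame

end HeatMonodromy
end

/-! ### The holonomies of the canonical and of the heat connection. -/

noncomputable section

namespace HeatMonodromy

open Set Function Filter unitInterval

namespace IntegrableSystem

theorem tau_mem_upperHalf {Θ T : ℝ} (hT : 0 < T) : tau Θ T ∈ upperHalf := by
  simpa [upperHalf, tau] using hT

theorem tau_add_int (Θ T : ℝ) (k : ℤ) : tau (Θ + k) T = tau Θ T + ((-k : ℤ) : ℂ) := by
  simp only [tau]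
  push_cast
  ring

theorem neg_re_tau (Θ T : ℝ) : -(tau Θ T).re = Θ := by simp [tau]

variable {M : Type*} [TopologicalSpace M] [ChartedSpace E4 M] {S : IntegrableSystem M}
  [IsManifold (𝓡 4) ∞ M] [T2Space M] {U : Set (ℝ × ℝ)} {α : ℝ × ℝ → ℝ × ℝ}

theorem exists_isReturn (hU : IsOpen U) (hUB : U ⊆ S.base) (hα : S.IsFirstCycle U α)
    {b : ℝ × ℝ} (hb : b ∈ U) : ∃ Θ T, S.IsReturn α b Θ T := by
  obtain ⟨W, J, Θ, T, hbW, -, h⟩ := exists_isAdapted hU hUB hα hb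
  exact ⟨Θ b, T b, (h.isReturn_iff hbW _ _).2 ⟨rfl, 0, by simp⟩⟩

theorem IsReturn.unique (hU : IsOpen U) (hUB : U ⊆ S.base) (hα : S.IsFirstCycle U α)
    {b : ℝ × ℝ} (hb : b ∈ U) {Θ T Θ' T' : ℝ} (h : S.IsReturn α b Θ T)
    (h' : S.IsReturn α b Θ' T') : T' = T ∧ ∃ k : ℤ, Θ' = Θ + k := by
  obtain ⟨W, J, Θ₀, T₀, hbW, -, hJ⟩ := exists_isAdapted hU hUB hα hb
  obtain ⟨rfl, k, rfl⟩ := (hJ.isReturn_iff hbW _ _).1 h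
  obtain ⟨rfl, k', rfl⟩ := (hJ.isReturn_iff hbW _ _).1 h'
  exact ⟨rfl, k' - k, by push_cast; ring⟩

/-- The first return time, and the rotation number as a continuous circle-valued function. -/
theorem exists_rotation (hU : IsOpen U) (hUB : U ⊆ S.base) (hα : S.IsFirstCycle U α) :
    ∃ (g : C(U, AddCircle (1 : ℝ))) (T : U → ℝ), ∀ (b : U) (θ t : ℝ),
      S.IsReturn α b θ t ↔ t = T b ∧ (θ : AddCircle (1 : ℝ)) = g b := by
  choose Θ T hret using fun b : U => exists_isReturn hU hUB hα b.2
  have hiff : ∀ (b : U) (θ t : ℝ), S.IsReturn α b θ t ↔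
      t = T b ∧ (θ : AddCircle (1 : ℝ)) = (Θ b : AddCircle (1 : ℝ)) := by
    intro b θ t
    obtain ⟨W, J, Θ₀, T₀, hbW, -, h, hΘ⟩ := exists_isAdapted_of_isReturn hU hUB hα b.2 (hret b)
    rw [h.isReturn_iff hbW, coe_eq_coe_iff_int, hΘ, ((h.isReturn_iff hbW _ _).1 (hret b)).1]
  -- The numbers `Θ b` are chosen independently at each point; modulo `ℤ` they agree locally with
  -- the continuous function given by adapted actions.
  refine ⟨⟨fun b => (Θ b : AddCircle (1 : ℝ)), continuous_iff_continuousAt.2 fun b => ?_⟩, T, hiff⟩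
  obtain ⟨W, J, Θ₀, T₀, hbW, -, h⟩ := exists_isAdapted hU hUB hα b.2
  have hc : ContinuousAt (fun c : U => (Θ₀ c : AddCircle (1 : ℝ))) b := by
    have h1 : ContinuousAt Θ₀ b := h.2.1.continuousAt (h.1.1.mem_nhds hbW)
    exact (AddCircle.continuous_mk' (1 : ℝ)).continuousAt.comp
      (ContinuousAt.comp (g := Θ₀) h1 continuous_subtype_val.continuousAt)
  refine hc.congr ?_
  filter_upwards [continuous_subtype_val.continuousAt.eventually (h.1.1.mem_nhds hbW)] with c hc
  exact ((hiff c _ _).1 ((h.isReturn_iff hc _ _).2 ⟨rfl, 0, by simp⟩)).2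

/-- A continuous choice of the rotation number along a path in `U`. -/
structure IsReturnPath (S : IntegrableSystem M) (U : Set (ℝ × ℝ)) (α : ℝ × ℝ → ℝ × ℝ)
    (γ : I → ℝ × ℝ) (Θ T : I → ℝ) : Prop where
  continuous_path : Continuous γ
  mem : ∀ t, γ t ∈ U
  continuous_rotation : Continuous Θ
  isReturn : ∀ t, S.IsReturn α (γ t) (Θ t) (T t)

variable {γ : I → ℝ × ℝ} {Θ T : I → ℝ}

/-- Two continuous choices of the rotation number differ by integers, so if they agree at `t₀` they
agree near it. -/
theorem IsReturnPath.exists_isAdapted (h : IsReturnPath S U α γ Θ T) (hU : IsOpen U)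
    (hUB : U ⊆ S.base) (hα : S.IsFirstCycle U α) (t₀ : I) :
    ∃ W J Θ₀ T₀, γ t₀ ∈ W ∧ S.IsAdapted α W J Θ₀ T₀ ∧
      ∀ᶠ t in 𝓝 t₀, γ t ∈ W ∧ Θ t = Θ₀ (γ t) ∧ T t = T₀ (γ t) := by
  obtain ⟨W, J, Θ₀, T₀, hbW, -, hJ, hΘ⟩ :=
    exists_isAdapted_of_isReturn hU hUB hα (h.mem t₀) (h.isReturn t₀)
  have hW : ∀ᶠ t in 𝓝 t₀, γ t ∈ W :=
    h.continuous_path.continuousAt.eventually (hJ.1.1.mem_nhds hbW)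
  have hc : ContinuousAt (fun t => Θ t - Θ₀ (γ t)) t₀ :=
    h.continuous_rotation.continuousAt.sub (ContinuousAt.comp (g := Θ₀)
      (hJ.2.1.continuousAt (hJ.1.1.mem_nhds hbW)) h.continuous_path.continuousAt)
  obtain ⟨n, hn⟩ := eventually_eq_of_forall_int hc (by
    filter_upwards [hW] with t ht
    obtain ⟨-, k, hk⟩ := (hJ.isReturn_iff ht _ _).1 (h.isReturn t)
    exact ⟨k, by rw [hk]; ring⟩)
  have hn0 : (n : ℝ) = 0 := by
    rw [← hn.self_of_nhds, hΘ, sub_self]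
  refine ⟨W, J, Θ₀, T₀, hbW, hJ, ?_⟩
  filter_upwards [hW, hn] with t ht htn
  rw [hn0, sub_eq_zero] at htn
  exact ⟨ht, htn, ((hJ.isReturn_iff ht _ _).1 (h.isReturn t)).1⟩

/-- The cycles `γ₁` and `γ₂` along a path. -/
def cycleFrame (α : ℝ × ℝ → ℝ × ℝ) (γ : I → ℝ × ℝ) (Θ T : I → ℝ) : Fin 2 → I → ℝ × ℝ :=
  ![fun t => α (γ t), fun t => secondCycle α (γ t) (Θ t) (T t)]

theorem sum_cycleFrame (c : Fin 2 → ℝ) (t : I) : ∑ i, c i • cycleFrame α γ Θ T i t =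
    c 0 • α (γ t) + c 1 • secondCycle α (γ t) (Θ t) (T t) := by
  rw [Fin.sum_univ_two]
  rfl

theorem IsReturnPath.parallelAlong_cycleFrame (h : IsReturnPath S U α γ Θ T) (hU : IsOpen U)
    (hUB : U ⊆ S.base) (hα : S.IsFirstCycle U α) (c : Fin 2 → ℝ) :
    ParallelAlong S.CanFlat γ fun t => ∑ i, c i • cycleFrame α γ Θ T i t := by
  intro t₀
  obtain ⟨W, J, Θ₀, T₀, hbW, hJ, hev⟩ := h.exists_isAdapted hU hUB hα t₀
  refine ⟨W, fun b => ∑ i, c i • grad (J i) b, hJ.1.1, hbW, ⟨J, hJ.1, c, fun b _ => rfl⟩, ?_⟩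
  filter_upwards [hev] with t ⟨ht, hΘ, hT⟩
  obtain ⟨-, -, h0, h1⟩ := hJ.2.2.2 _ ht
  rw [sum_cycleFrame, Fin.sum_univ_two, h0, h1, hΘ, hT]

/-- The differentials of any local actions are locally constant integer combinations of the adapted
ones, so flat sections have constant coefficients in the frame of cycles. -/
theorem IsReturnPath.eventually_eq_cycleFrame (h : IsReturnPath S U α γ Θ T) (hU : IsOpen U)
    (hUB : U ⊆ S.base) (hα : S.IsFirstCycle U α) {s : I → ℝ × ℝ}
    (hs : ParallelAlong S.CanFlat γ s) (t₀ : I) :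
    ∃ c : Fin 2 → ℝ, ∀ᶠ t in 𝓝 t₀, s t = ∑ i, c i • cycleFrame α γ Θ T i t := by
  obtain ⟨W, J, Θ₀, T₀, hbW, hJ, hev⟩ := h.exists_isAdapted hU hUB hα t₀
  obtain ⟨W', ς, hW', hbW', ⟨I', hI', k, hk⟩, hs_sec⟩ := hs t₀
  have hper : ∀ i, ∀ᶠ b in 𝓝 (γ t₀), S.IsPeriod b (grad (I' i) b) := by
    intro i
    filter_upwards [hW'.mem_nhds hbW'] with b hb
    rw [(hI'.2.2.2 b hb).2]
    exact ⟨Pi.single i 1, by fin_cases i <;> simp⟩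
  choose m n hmn using fun i =>
    hJ.1.eventually_eq_comb hbW (hI'.continuousAt_grad hbW' i) (hper i)
  refine ⟨![∑ i, k i * m i, ∑ i, k i * n i], ?_⟩
  filter_upwards [hev, hs_sec, h.continuous_path.continuousAt.eventually (hmn 0),
    h.continuous_path.continuousAt.eventually (hmn 1),
    h.continuous_path.continuousAt.eventually (hW'.mem_nhds hbW')] with t ⟨ht, hΘ, hT⟩ h1 h2 h3 h4
  obtain ⟨-, -, h5, h6⟩ := hJ.2.2.2 _ ht
  rw [h1, hk _ h4, sum_cycleFrame, hΘ, hT, ← h5, ← h6, Fin.sum_univ_two, Fin.sum_univ_two,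
    Fin.sum_univ_two, h2, h3]
  simp only [Matrix.cons_val_zero, Matrix.cons_val_one]
  module

theorem IsReturnPath.return_time_eq (h : IsReturnPath S U α γ Θ T) (hU : IsOpen U)
    (hUB : U ⊆ S.base) (hα : S.IsFirstCycle U α) (hγ : γ 1 = γ 0) : T 1 = T 0 := by
  have h1 := h.isReturn 1
  rw [hγ] at h1
  exact (IsReturn.unique hU hUB hα (h.mem 0) (h.isReturn 0) h1).1

/-- The monodromy matrix of the canonical connection. -/
theorem IsReturnPath.isHolonomyMatrix_canFlat (h : IsReturnPath S U α γ Θ T) (hU : IsOpen U)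
    (hUB : U ⊆ S.base) (hα : S.IsFirstCycle U α) (hγ : γ 1 = γ 0) {n : ℤ} (hn : Θ 1 = Θ 0 + n) :
    IsHolonomyMatrix S.CanFlat γ ![α (γ 0), secondCycle α (γ 0) (Θ 0) (T 0)]
      ((!![1, -n; 0, 1] : Matrix (Fin 2) (Fin 2) ℤ).map (Int.cast : ℤ → ℝ)) := by
  have hframe : ![α (γ 0), secondCycle α (γ 0) (Θ 0) (T 0)] =
      fun i => cycleFrame α γ Θ T i 0 := by
    ext i : 1
    fin_cases i <;> rfl
  rw [hframe]
  refine isHolonomyMatrix_of_frame (fun t c d hcd => ?_)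
    (h.parallelAlong_cycleFrame hU hUB hα)
    (fun s hs => h.eventually_eq_cycleFrame hU hUB hα hs) fun c => ?_
  · rw [sum_cycleFrame, sum_cycleFrame] at hcd
    have hdet : det2 (α (γ t)) (secondCycle α (γ t) (Θ t) (T t)) ≠ 0 := by
      rw [det2_secondCycle]
      exact neg_ne_zero.2 (mul_ne_zero (h.isReturn t).1.ne' (hα.2 _ (h.mem t)).2.2)
    have h1 := comb_injective (c := (c 0, c 1)) (d := (d 0, d 1)) hdet hcd
    ext i
    fin_cases i
    · exact congrArg Prod.fst h1
    · exact congrArg Prod.snd h1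
  · rw [sum_cycleFrame, sum_cycleFrame, hγ, hn, h.return_time_eq hU hUB hα hγ, secondCycle_sub]
    simp only [Matrix.mulVec, dotProduct, Fin.sum_univ_two, Matrix.map_apply, Matrix.of_apply,
      Matrix.cons_val_zero, Matrix.cons_val_one]
    push_cast
    module

/-- The theta functions along a path. -/
def thetaFrame (Θ T : I → ℝ) (j : Fin 2) (t : I) : ℂ → ℂ := theta 2 j (tau (Θ t) (T t))

theorem IsReturnPath.parallelAlong_thetaFrame (h : IsReturnPath S U α γ Θ T) (hU : IsOpen U)
    (hUB : U ⊆ S.base) (hα : S.IsFirstCycle U α) (c : Fin 2 → ℂ) :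
    ParallelAlong (S.HeatFlat α) γ fun t => ∑ j, c j • thetaFrame Θ T j t := by
  intro t₀
  obtain ⟨W, J, Θ₀, T₀, hbW, hJ, hev⟩ := h.exists_isAdapted hU hUB hα t₀
  refine ⟨W, fun b => ∑ j, c j • theta 2 j (tau (Θ₀ b) (T₀ b)), hJ.1.1, hbW,
    ⟨fun b => tau (Θ₀ b) (T₀ b), ⟨?_, fun b hb => ⟨Θ₀ b, T₀ b, ?_, rfl⟩⟩, upperHalf,
      fun τ => ∑ j, c j • theta 2 j τ, isOpen_upperHalf, subset_rfl, fun b hb => ?_,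
      thetaFlat_sum_theta subset_rfl c, fun b _ => rfl⟩, ?_⟩
  · have h1 := hJ.2.1
    have h2 := hJ.2.2.1
    unfold tau
    exact (Complex.continuous_ofReal.comp_continuousOn h1).neg.add
      (continuousOn_const.mul (Complex.continuous_ofReal.comp_continuousOn h2))
  · exact (hJ.isReturn_iff hb _ _).2 ⟨rfl, 0, by simp⟩
  · exact tau_mem_upperHalf (hJ.2.2.2 b hb).2.1
  · filter_upwards [hev] with t ⟨ht, hΘ, hT⟩
    simp only [thetaFrame, hΘ, hT]

/-- The branch of `τ` behind the section differs from the one along the path by a locally constant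
integer, and this shift is absorbed into the coefficients. -/
theorem IsReturnPath.eventually_eq_thetaFrame (h : IsReturnPath S U α γ Θ T) (hU : IsOpen U)
    (hUB : U ⊆ S.base) (hα : S.IsFirstCycle U α) {s : I → ℂ → ℂ}
    (hs : ParallelAlong (S.HeatFlat α) γ s) (t₀ : I) :
    ∃ c : Fin 2 → ℂ, ∀ᶠ t in 𝓝 t₀, s t = ∑ j, c j • thetaFrame Θ T j t := by
  obtain ⟨W, ς, hW, hbW, ⟨τ, hτ, O, s', hO, hO', hmaps, hflat, hσ⟩, hs_sec⟩ := hs t₀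
  have hγW : ∀ᶠ t in 𝓝 t₀, γ t ∈ W :=
    h.continuous_path.continuousAt.eventually (hW.mem_nhds hbW)
  have hτc : ContinuousAt (fun t => τ (γ t)) t₀ := ContinuousAt.comp (g := τ)
    (hτ.1.continuousAt (hW.mem_nhds hbW)) h.continuous_path.continuousAt
  obtain ⟨c, hc⟩ := hflat.eventually_eq hO hO' (hmaps hbW)
  have hdiff : ∀ t, γ t ∈ W → ∃ k : ℤ, τ (γ t) = tau (Θ t) (T t) + ((-k : ℤ) : ℂ) ∧
      -(τ (γ t)).re - Θ t = k := by
    intro t ht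
    obtain ⟨Θ', T', hret, hτt⟩ := hτ.2 _ ht
    obtain ⟨rfl, k, rfl⟩ := IsReturn.unique hU hUB hα (h.mem t) (h.isReturn t) hret
    refine ⟨k, by rw [hτt, tau_add_int], ?_⟩
    rw [hτt, neg_re_tau]
    ring
  have hcont : ContinuousAt (fun t => -(τ (γ t)).re - Θ t) t₀ :=
    (Complex.continuous_re.continuousAt.comp hτc).neg.sub h.continuous_rotation.continuousAt
  obtain ⟨n, hn⟩ := eventually_eq_of_forall_int hcont (by
    filter_upwards [hγW] with t ht
    obtain ⟨k, -, hk⟩ := hdiff t ht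
    exact ⟨k, hk⟩)
  refine ⟨(shiftMatrix (-n) : Matrix (Fin 2) (Fin 2) ℂ).mulVec c, ?_⟩
  filter_upwards [hγW, hn, hτc.eventually hc, hs_sec] with t h1 h2 h3 h4
  obtain ⟨k, hk1, hk2⟩ := hdiff t h1
  have hkn : k = n := by
    rw [h2] at hk2
    exact_mod_cast hk2.symm
  subst hkn
  rw [h4, hσ _ h1, h3, hk1, sum_theta_add_int]
  rfl

/-- The holonomy matrix of the heat connection. -/
theorem IsReturnPath.isHolonomyMatrix_heatFlat (h : IsReturnPath S U α γ Θ T) (hU : IsOpen U)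
    (hUB : U ⊆ S.base) (hα : S.IsFirstCycle U α) (hγ : γ 1 = γ 0) {n : ℤ} (hn : Θ 1 = Θ 0 + n) :
    IsHolonomyMatrix (S.HeatFlat α) γ (fun j => theta 2 j (tau (Θ 0) (T 0)))
      (shiftMatrix (-n) : Matrix (Fin 2) (Fin 2) ℂ) := by
  refine isHolonomyMatrix_of_frame (e := thetaFrame Θ T)
    (fun t c d hcd => sum_theta_injective (tau_mem_upperHalf (h.isReturn t).1) hcd)
    (h.parallelAlong_thetaFrame hU hUB hα)
    (fun s hs => h.eventually_eq_thetaFrame hU hUB hα hs) fun c => ?_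
  simp only [thetaFrame]
  rw [hn, h.return_time_eq hU hUB hα hγ, tau_add_int, sum_theta_add_int]

/-- Nontrivial holonomy of the heat connection forces monodromy. -/
theorem hasMonodromy_of_nontrivialHolonomy (hU : IsOpen U) (hUB : U ⊆ S.base)
    (hα : S.IsFirstCycle U α) (h : NontrivialHolonomy (S.HeatFlat α) U) : S.HasMonodromy := by
  obtain ⟨b, γ, s, hs, hne⟩ := h
  obtain ⟨g, T, hg⟩ := exists_rotation hU hUB hα
  obtain ⟨Θ₀, T₀, hret⟩ := exists_isReturn hU hUB hα b.2
  obtain ⟨n, p, hp0, hp1, hp⟩ := exists_hasWinding (g := g) (Θ := Θ₀) (γ := (γ : C(I, U)))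
    (by simpa using ((hg b _ _).1 hret).2) (by simp)
  have hpath : IsReturnPath S U α (fun t => (γ t : ℝ × ℝ)) p (fun t => T (γ t)) :=
    ⟨continuous_subtype_val.comp γ.continuous, fun t => (γ t).2, p.continuous,
      fun t => (hg (γ t) _ _).2 ⟨rfl, hp t⟩⟩
  have hγ : (γ 1 : ℝ × ℝ) = γ 0 := by simp
  have hn1 : p 1 = p 0 + n := by rw [hp1, hp0]
  -- For winding number zero the theta frame returns to itself and parallel transport is the
  -- identity.
  have hn0 : n ≠ 0 := by
    rintro rfl
    refine hne ?_
    obtain ⟨c, hc⟩ := hpath.eventually_eq_thetaFrame hU hUB hα hs 0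
    obtain ⟨d, hd⟩ := hpath.eventually_eq_thetaFrame hU hUB hα hs 1
    have hd1 := hd.self_of_nhds
    have hframe : ∀ j, thetaFrame p (fun t => T (γ t)) j 1 =
        thetaFrame p (fun t => T (γ t)) j 0 := by
      intro j
      simp only [thetaFrame, hn1, γ.source, γ.target, Int.cast_zero, add_zero]
    simp only [hframe] at hd1
    have hhol := (hpath.isHolonomyMatrix_heatFlat hU hUB hα hγ hn1 c d).1
      ⟨s, hs, hc.self_of_nhds, hd1⟩
    rw [hd1, hc.self_of_nhds, hhol]
    simp [coe_shiftMatrix, ← Matrix.one_fin_two]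
  -- Along the same loop, seen in the base, `γ₂` changes by `-n γ₁`, and this is not zero.
  refine ⟨⟨b, hUB b.2⟩, γ.map (continuous_inclusion hUB), _,
    hpath.parallelAlong_cycleFrame hU hUB hα ![0, 1], ?_⟩
  rw [sum_cycleFrame, sum_cycleFrame, hγ, hn1, secondCycle_sub]
  simp only [γ.source, γ.target]
  intro heq
  simp only [Matrix.cons_val_zero, Matrix.cons_val_one, zero_smul, one_smul, zero_add,
    sub_eq_self, smul_eq_zero, Int.cast_eq_zero, hn0, false_or] at heq
  exact (hα.2 b b.2).2.2 (by rw [heq]; rfl)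

end IntegrableSystem

end HeatMonodromy
end

theorem theorem5 {M : Type*} [TopologicalSpace M] [T2Space M] [ChartedSpace HeatMonodromy.E4 M]
    [IsManifold (𝓡 4) ∞ M] (S : HeatMonodromy.IntegrableSystem M)
    (hff : {p : M | S.IsFocusFocus p}.Finite)
    (U : Set (ℝ × ℝ)) (hU : IsOpen U) (hUB : U ⊆ S.base)
    (α : ℝ × ℝ → ℝ × ℝ) (hα : S.IsFirstCycle U α) :
    (∃ Q : Subgroup.zpowers HeatMonodromy.Z₀ →* GL (Fin 2) ℂ,
      (∀ Z : Subgroup.zpowers HeatMonodromy.Z₀, HeatMonodromy.IsThetaDisplacement (Z : SL(2, ℤ)) (Q Z)) ∧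
      (Q ⟨HeatMonodromy.Z₀, Subgroup.mem_zpowers _⟩ : Matrix (Fin 2) (Fin 2) ℂ) =
        !![1, 0; 0, Complex.exp (Complex.I * (Real.pi / 2))] ∧
      ∀ b₀ : U, (∃ Θ T : ℝ, S.IsReturn α b₀ Θ T) ∧
        ∀ Θ T : ℝ, S.IsReturn α b₀ Θ T →
          ∃ (holCan : FundamentalGroup U b₀ →* Subgroup.zpowers HeatMonodromy.Z₀)
            (holHeat : FundamentalGroup U b₀ →* GL (Fin 2) ℂ),
            (∀ γ : Path b₀ b₀,
              HeatMonodromy.IsHolonomyMatrix S.CanFlat (fun t => (γ t : ℝ × ℝ))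
                ![α b₀, HeatMonodromy.IntegrableSystem.secondCycle α b₀ Θ T]
                (((holCan (FundamentalGroup.fromPath (Path.Homotopic.Quotient.mk γ)) : SL(2, ℤ)) :
                  Matrix (Fin 2) (Fin 2) ℤ).map (Int.cast : ℤ → ℝ))) ∧
            (∀ γ : Path b₀ b₀,
              HeatMonodromy.IsHolonomyMatrix (S.HeatFlat α) (fun t => (γ t : ℝ × ℝ))
                (fun j : Fin 2 =>
                  HeatMonodromy.theta 2 j (HeatMonodromy.IntegrableSystem.tau Θ T))
                (holHeat (FundamentalGroup.fromPath (Path.Homotopic.Quotient.mk γ)) :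
                  Matrix (Fin 2) (Fin 2) ℂ)) ∧
            holHeat = Q.comp holCan) ∧
    (HeatMonodromy.NontrivialHolonomy (S.HeatFlat α) U → S.HasMonodromy) := by
  refine ⟨⟨HeatMonodromy.displacement, HeatMonodromy.isThetaDisplacement_displacement,
    HeatMonodromy.displacement_Z₀, fun b₀ =>
      ⟨HeatMonodromy.IntegrableSystem.exists_isReturn hU hUB hα b₀.2, fun Θ T hret => ?_⟩⟩,
    HeatMonodromy.IntegrableSystem.hasMonodromy_of_nontrivialHolonomy hU hUB hα⟩
  obtain ⟨g, T', hg⟩ := HeatMonodromy.IntegrableSystem.exists_rotation hU hUB hα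
  obtain ⟨rfl, hΘ⟩ := (hg b₀ Θ T).1 hret
  obtain ⟨N, hN⟩ := HeatMonodromy.exists_winding g b₀ hΘ
  let Z : Subgroup.zpowers HeatMonodromy.Z₀ := ⟨HeatMonodromy.Z₀, Subgroup.mem_zpowers _⟩
  -- The inverse of `Z₀` enters because `τ = -Θ + iT`: when `Θ` winds by `n`, `τ` is displaced by
  -- `-n`.
  let holCan : FundamentalGroup U b₀ →* Subgroup.zpowers HeatMonodromy.Z₀ :=
    (zpowersHom _ Z⁻¹).comp N
  have hval : ∀ q, holCan q = Z ^ (-(N q).toAdd) := fun q => by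
    change Z⁻¹ ^ (N q).toAdd = _
    rw [inv_zpow, zpow_neg]
  have hpath : ∀ (γ : Path b₀ b₀) (p : C(unitInterval, ℝ)),
      (∀ t, (p t : AddCircle (1 : ℝ)) = g (γ t)) →
      HeatMonodromy.IntegrableSystem.IsReturnPath S U α (fun t => (γ t : ℝ × ℝ)) p
        (fun t => T' (γ t)) := fun γ p hp =>
    ⟨continuous_subtype_val.comp γ.continuous, fun t => (γ t).2, p.continuous,
      fun t => (hg (γ t) _ _).2 ⟨rfl, hp t⟩⟩
  -- The heat homomorphism is defined by the asserted relation, so what needs proof is that the two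
  -- homomorphisms compute parallel transport. One lift `p` of the rotation number serves for both.
  refine ⟨holCan, HeatMonodromy.displacement.comp holCan, fun γ => ?_, fun γ => ?_, rfl⟩
  · obtain ⟨p, hp0, hp1, hp⟩ := hN γ
    have h := (hpath γ p hp).isHolonomyMatrix_canFlat hU hUB hα (by simp) (hp0 ▸ hp1)
    simp only [hp0, γ.source] at h
    rw [hval]
    have hc := HeatMonodromy.coe_Z₀_zpow
      (-(N (FundamentalGroup.fromPath (Path.Homotopic.Quotient.mk γ))).toAdd)
    rw [← hc] at h
    exact h
  · obtain ⟨p, hp0, hp1, hp⟩ := hN γ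
    have h := (hpath γ p hp).isHolonomyMatrix_heatFlat hU hUB hα (by simp) (hp0 ▸ hp1)
    simp only [hp0, γ.source] at h
    rw [MonoidHom.comp_apply, hval]
    exact (HeatMonodromy.displacement_zpow _ (zpow_mem (Subgroup.mem_zpowers _) _)).symm ▸ h
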